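/- **Setting.** Let $\mathbb T=[-\pi,\pi]$ with periodic identification, $\langle u\rangle=\frac1{2\pi}\int_{\mathbb T}u\,dx$, $\hat u(k)=\frac1{2\pi}\int_{\mathbb T}u(x)e^{-ikx}dx$. For zero mean functions put $\|u\|_{\dot A^s}=\sum_{k}|k|^s|\hat u(k)|$ and $\|u\|_{\dot H^s}^2=\sum_k|k|^{2s}|\hat u(k)|^2$; $\dot H^s$ is the space of zero mean functions $u\in L^2(\mathbb T)$ with $\|u\|_{\dot H^s}<\infty$. Put $$\mathcal E_0(u,v)=\|u\|_{\dot A^0}+\|v\|_{\dot A^0},\qquad E_s(u,v)=\|u\|_{\dot H^s}^2+\|v\|_{\dot H^s}^2 .$$ Let $G,\mu_\pm,\rho_\pm,\gamma_f,\gamma_h>0$ and $$b=\rho_+,\quad b_\mu=\tfrac{\mu_-}{\mu_+}b,\quad b_\rho=\tfrac{\rho_-}{\rho_+}b,\quad A=\tfrac{\gamma_h}{G},\quad A_\mu=\tfrac{\mu_-}{\mu_+}A,\quad A_\gamma=\tfrac{\gamma_f+\gamma_h}{\gamma_h}A .$$ Given $f_0,g_0$ on $\mathbb T$, put $\bar f_0=f_0-\langle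 f_0\rangle$, $\bar g_0=g_0-\langle g_0\rangle$, $\mathcal E_0=\mathcal E_0(\bar f_0,\bar g_0)$. The thin film Muskat system for the zero mean unknowns $(\bar f,\bar g)$ is $$\partial_t\bar f=-\partial_x\big[(\bar f+\langle f_0\rangle)(A_\gamma\partial_x^3\bar f+A\partial_x^3\bar g-b_\rho\partial_x\bar f-b\,\partial_x\bar g)\big],$$ $$\partial_t\bar g=-\partial_x\big[(\bar g+\langle g_0\rangle)(A_\mu\partial_x^3\bar f+A_\mu\partial_x^3\bar g-b_\mu\partial_x\bar f-b_\mu\partial_x\bar g)\big],$$ with initial datum $(\bar f_0,\bar g_0)$. A weak solution on $[0,T)$ is a pair of zero mean functions in $L^1(0,T;W^{3,1}(\mathbb T))$ whose fluxes $q,r$ (the two square brackets) are integrable on $(0,T)\times\mathbb T$ and for which $$-\int_{\mathbb T}\bar f_0\,\phi(0)\,dx-\int_0^T\!\!\int_{\mathbb T}\bar f\,\partial_t\phi\,dx\,dt=\int_0^T\!\!\int_{\mathbb T}q\,\partial_x\phi\,dx\,dt,\qquad -\int_{\mathbb T}\bar g_0\,\psi(0)\,dx-\int_0^T\!\!\int_{\mathbb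 T}\bar g\,\partial_t\psi\,dx\,dt=\int_0^T\!\!\int_{\mathbb T}r\,\partial_x\psi\,dx\,dt$$ for all $\phi,\psi\in C^1_c([0,T)\times\mathbb T)$; it is global if this holds for every $T>0$. Let $$\sigma_{1,A}=\langle f_0\rangle A_\gamma-\langle g_0\rangle A_\mu-(A_\mu+2A_\gamma+2A)\mathcal E_0,\qquad \sigma_{2,A}=\langle g_0\rangle A_\mu-\langle f_0\rangle A-(A_\mu+2A_\gamma+2A)\mathcal E_0,$$ $$\sigma_{1,b}=\langle f_0\rangle b_\rho-\langle g_0\rangle b_\mu-(2b_\rho+2b+4b_\mu)\mathcal E_0,\qquad \sigma_{2,b}=\langle g_0\rangle b_\mu-\langle f_0\rangle b-(2b_\rho+2b+4b_\mu)\mathcal E_0 .$$ **Theorem 3.** Assume $(\bar f_0,\bar g_0)\in(\dot H^2(\mathbb T))^2$, $\ \mathcal E_0<\min\{\langle f_0\rangle,\langle g_0\rangle\}$, $\ \min\{\sigma_{1,A},\sigma_{2,A},\sigma_{1,b},\sigma_{2,b}\}>0$, and $$\langle g_0\rangle A_\mu-\tfrac12(\langle f_0\rangle A+\langle g_0\rangle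 A_\mu)-\big(A_\gamma+\tfrac{13}4A+\tfrac{17}4A_\mu\big)\mathcal E_0>0,$$ $$\langle f_0\rangle A_\gamma-\tfrac12(\langle f_0\rangle A+\langle g_0\rangle A_\mu)-\big(A_\gamma+\tfrac{13}4A+\tfrac{17}4A_\mu\big)\mathcal E_0>0 .$$ Then there is a global weak solution $(\bar f,\bar g)$ with the following properties. First, as for every initial datum in the Wiener algebra satisfying the conditions on $\mathcal E_0$ and the $\sigma$'s, for all $T>0$ and all $\alpha\in[0,\frac12)$ $$\bar f,\bar g\in L^\infty([0,T]\times\mathbb T)\cap L^{4/3}(0,T;W^{3,\infty})\cap L^1(0,T;C^{3+\alpha})\cap\mathcal M(0,T;W^{4,\infty})\cap L^2(0,T;\dot H^2),$$ where $\mathcal M(0,T;X)$ is the space of $X$-valued Radon measures in time, and $$\|\bar f(T)\|_{L^\infty}+\|\bar g(T)\|_{L^\infty}\le\mathcal E_0\,e^{-(\delta_A+\delta_b)T}\quad\text{for all }T>0$$ with $\delta_b=\min\{\sigma_{1,b},\sigma_{2,b}\}>0$ and some $\delta_A>0$ depending only on the initial datum and the physical parameters. Second, for all $T>0$ $$(\bar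 f,\bar g)\in\big(C([0,T];\dot H^2(\mathbb T))\cap L^2(0,T;\dot H^4(\mathbb T))\big)^2,$$ and i) $E_2(\bar f(T),\bar g(T))+c_1\int_0^TE_4(\bar f(t),\bar g(t))\,dt\le c_2$, ii) $E_s(\bar f(T),\bar g(T))\le c_3e^{-cT}$ for all $0\le s<2$, with positive constants $c_1,c_2,c_3$ depending only on the initial datum and the physical parameters, and $c>0$ depending only on these and on $s$; none of them depends on $T$. -/

import Mathlib

open MeasureTheory Set Filter Topology
open scoped ENNReal NNReal Real

noncomputable section

namespace Muskat

/-! ### The torus, derivatives and function spaces in the space variable -/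

instance instFactTwoPiPos : Fact (0 < 2 * π) := ⟨Real.two_pi_pos⟩

/-- The torus `[-π, π]` with periodic identification; its volume is Lebesgue measure, of total
mass `2π`. -/
abbrev Torus : Type := AddCircle (2 * π)

/-- The mean `⟨u⟩ = (2π)⁻¹ ∫ u`. -/
def mean (u : Torus → ℝ) : ℝ := (2 * π)⁻¹ * ∫ x, u x

/-- The fluctuation `u - ⟨u⟩`. -/
def fluct (u : Torus → ℝ) : Torus → ℝ := fun x => u x - mean u

/-- The Fourier coefficient `(2π)⁻¹ ∫ u(x) e^{-ikx} dx` of a real function. -/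
def hat (u : Torus → ℝ) (k : ℤ) : ℂ := fourierCoeff (fun x => ((u x : ℝ) : ℂ)) k

/-- The classical derivative of a function on the torus. -/
def dx (u : Torus → ℝ) (x : Torus) : ℝ := deriv (fun h : ℝ => u (x + (h : Torus))) 0

/-- `v` is the `n`-th weak derivative of `u` on the torus. -/
def IsWeakDeriv (n : ℕ) (u v : Torus → ℝ) : Prop :=
  Integrable u ∧ Integrable v ∧
    ∀ φ : Torus → ℝ, ContDiff ℝ (⊤ : ℕ∞) (fun y : ℝ => φ (y : Torus)) →
      ∫ x, u x * (dx^[n] φ) x = (-1) ^ n * ∫ x, v x * φ x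

/-- `∑ₖ |k|^{2s} |û(k)|²`, the square of the norm of the homogeneous Sobolev space of order `s`. -/
def hNormSq (s : ℝ) (u : Torus → ℝ) : ℝ := ∑' k : ℤ, |(k : ℝ)| ^ (2 * s) * ‖hat u k‖ ^ 2

/-- `u` is an element of the homogeneous Sobolev space of order `s`: a square integrable function
with zero mean and `∑ₖ |k|^{2s} |û(k)|² < ∞`. -/
def MemHdot (s : ℝ) (u : Torus → ℝ) : Prop :=
  MemLp u 2 ∧ ∫ x, u x = 0 ∧ Summable (fun k : ℤ => |(k : ℝ)| ^ (2 * s) * ‖hat u k‖ ^ 2)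

/-- `∑ₖ |k|^s |û(k)|`, the norm of the homogeneous Wiener space of order `s`. -/
def wienerNorm (s : ℝ) (u : Torus → ℝ) : ℝ := ∑' k : ℤ, |(k : ℝ)| ^ s * ‖hat u k‖

/-- The Wiener functional: the sum of the Wiener norms of order `s` of two functions. -/
def wienerE (s : ℝ) (u v : Torus → ℝ) : ℝ := wienerNorm s u + wienerNorm s v

/-- The Sobolev functional: the sum of the squared Sobolev norms of order `s` of two functions. -/
def sobolevE (s : ℝ) (u v : Torus → ℝ) : ℝ := hNormSq s u + hNormSq s v

/-- The norm of the Hölder space `C^{k+α}` (meaningful for functions of class `C^k`). -/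
def holderNorm (k : ℕ) (α : ℝ≥0) (u : Torus → ℝ) : ℝ≥0∞ :=
  (∑ j ∈ Finset.range (k + 1), ⨆ x, ‖(dx^[j] u) x‖ₑ) + eHolderNorm α (dx^[k] u)

/-! ### Functions of time and space on `(0,T) × Torus` -/

/-- Joint measurability on `(0,T) × Torus`. -/
def TXMeasurable (T : ℝ) (u : ℝ → Torus → ℝ) : Prop :=
  AEStronglyMeasurable (fun p : ℝ × Torus => u p.1 p.2)
    (((volume : Measure ℝ).restrict (Ioo 0 T)).prod volume)

/-- Integrability on `(0,T) × Torus`. -/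
def TXIntegrable (T : ℝ) (u : ℝ → Torus → ℝ) : Prop :=
  Integrable (fun p : ℝ × Torus => u p.1 p.2)
    (((volume : Measure ℝ).restrict (Ioo 0 T)).prod volume)

/-- `v` is the `n`-th weak space derivative of `u` on `(0,T) × Torus`. -/
def IsTXDeriv (T : ℝ) (n : ℕ) (u v : ℝ → Torus → ℝ) : Prop :=
  TXMeasurable T v ∧ ∀ᵐ t ∂((volume : Measure ℝ).restrict (Ioo 0 T)), IsWeakDeriv n (u t) (v t)

/-- `u ∈ L^∞((0,T) × Torus)`. -/
def MemLinfty (T : ℝ) (u : ℝ → Torus → ℝ) : Prop :=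
  MemLp (fun p : ℝ × Torus => u p.1 p.2) ∞
    (((volume : Measure ℝ).restrict (Ioo 0 T)).prod volume)

/-- `u ∈ L^q(0,T; W^{n,p})`, for a real exponent `q`. -/
def MemLW (T q : ℝ) (n : ℕ) (p : ℝ≥0∞) (u : ℝ → Torus → ℝ) : Prop :=
  TXMeasurable T u ∧ ∃ v : ℝ → Torus → ℝ, IsTXDeriv T n u v ∧
    ∫⁻ t in Ioo 0 T, (eLpNorm (u t) p volume + eLpNorm (v t) p volume) ^ q < ∞

/-- `u ∈ L¹(0,T; C^{k+α})`. -/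
def MemLHolder (T : ℝ) (k : ℕ) (α : ℝ≥0) (u : ℝ → Torus → ℝ) : Prop :=
  TXMeasurable T u ∧ ∃ w : ℝ → Torus → ℝ,
    (∀ᵐ t ∂((volume : Measure ℝ).restrict (Ioo 0 T)),
      w t =ᵐ[volume] u t ∧ ContDiff ℝ k (fun y : ℝ => w t (y : Torus))) ∧
    ∫⁻ t in Ioo 0 T, holderNorm k α (w t) < ∞

/-- `u ∈ 𝓜(0,T; W^{n,∞})`: the function `u` is an `L^∞`-valued measure of finite variation on
`(0,T)`, and so is its distributional space derivative of order `n`, where the latter is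
represented as `v(t,·) dν(t)` with a finite measure `ν` in time and a density `v`. -/
def MemMW (T : ℝ) (n : ℕ) (u : ℝ → Torus → ℝ) : Prop :=
  TXMeasurable T u ∧ ∫⁻ t in Ioo 0 T, eLpNorm (u t) ∞ volume < ∞ ∧
    ∃ (ν : Measure ℝ) (v : ℝ → Torus → ℝ), IsFiniteMeasure ν ∧
      AEStronglyMeasurable (fun p : ℝ × Torus => v p.1 p.2)
        ((ν.restrict (Ioo 0 T)).prod volume) ∧
      ∫⁻ t in Ioo 0 T, eLpNorm (v t) ∞ volume ∂ν < ∞ ∧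
      ∀ η : ℝ → Torus → ℝ, ContDiff ℝ (⊤ : ℕ∞) (fun p : ℝ × ℝ => η p.1 (p.2 : Torus)) →
        (∃ a b : ℝ, 0 < a ∧ b < T ∧ ∀ t ∉ Icc a b, ∀ x, η t x = 0) →
        ∫ t in Ioo 0 T, ∫ x, u t x * (dx^[n] (η t)) x =
          (-1) ^ n * ∫ t in Ioo 0 T, (∫ x, v t x * η t x) ∂ν

/-- `u ∈ L²(0,T; Ḣ^s)`. -/
def MemL2Hdot (T s : ℝ) (u : ℝ → Torus → ℝ) : Prop :=
  TXMeasurable T u ∧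
    (∀ᵐ t ∂((volume : Measure ℝ).restrict (Ioo 0 T)), MemHdot s (u t)) ∧
    ∫⁻ t in Ioo 0 T, ENNReal.ofReal (hNormSq s (u t)) < ∞

/-- `u ∈ C([0,T]; Ḣ^s)`. -/
def MemCHdot (T s : ℝ) (u : ℝ → Torus → ℝ) : Prop :=
  ∀ t₀ ∈ Icc 0 T, MemHdot s (u t₀) ∧
    Tendsto (fun t => hNormSq s (fun x => u t x - u t₀ x)) (𝓝[Icc 0 T] t₀) (𝓝 0)

/-! ### The physical parameters -/

/-- Gravity `G`, the viscosities and densities of the lower (`-`) and of the upper (`+`) fluid, and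
the surface tension coefficients of the two interfaces `f` and `h`. -/
structure Params where
  G : ℝ
  μm : ℝ
  μp : ℝ
  ρm : ℝ
  ρp : ℝ
  γf : ℝ
  γh : ℝ

/-- All physical parameters are positive. -/
def Params.Positive (P : Params) : Prop :=
  0 < P.G ∧ 0 < P.μm ∧ 0 < P.μp ∧ 0 < P.ρm ∧ 0 < P.ρp ∧ 0 < P.γf ∧ 0 < P.γh

def Params.b (P : Params) : ℝ := P.ρp
def Params.bμ (P : Params) : ℝ := P.μm / P.μp * P.b
def Params.bρ (P : Params) : ℝ := P.ρm / P.ρp * P.b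
def Params.A (P : Params) : ℝ := P.γh / P.G
def Params.Aμ (P : Params) : ℝ := P.μm / P.μp * P.A
def Params.Aγ (P : Params) : ℝ := (P.γf + P.γh) / P.γh * P.A

/-- The Wiener size `𝓔₀` of the fluctuations of the initial data. -/
def size (f₀ g₀ : Torus → ℝ) : ℝ := wienerE 0 (fluct f₀) (fluct g₀)

def σ1A (P : Params) (f₀ g₀ : Torus → ℝ) : ℝ :=
  mean f₀ * P.Aγ - mean g₀ * P.Aμ - (P.Aμ + 2 * P.Aγ + 2 * P.A) * size f₀ g₀

def σ2A (P : Params) (f₀ g₀ : Torus → ℝ) : ℝ :=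
  mean g₀ * P.Aμ - mean f₀ * P.A - (P.Aμ + 2 * P.Aγ + 2 * P.A) * size f₀ g₀

def σ1b (P : Params) (f₀ g₀ : Torus → ℝ) : ℝ :=
  mean f₀ * P.bρ - mean g₀ * P.bμ - size f₀ g₀ * (2 * P.bρ + 2 * P.b + 4 * P.bμ)

def σ2b (P : Params) (f₀ g₀ : Torus → ℝ) : ℝ :=
  mean g₀ * P.bμ - mean f₀ * P.b - size f₀ g₀ * (2 * P.bρ + 2 * P.b + 4 * P.bμ)

/-! ### Weak solutions -/

/-- Test functions: `C¹` functions on `[0,T) × Torus` with compact support. -/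
def IsTest (T : ℝ) (φ : ℝ → Torus → ℝ) : Prop :=
  ContDiff ℝ 1 (fun p : ℝ × ℝ => φ p.1 (p.2 : Torus)) ∧
    ∃ T' < T, ∀ t ≥ T', ∀ x, φ t x = 0

/-- The weak form, on `[0,T)`, of the conservation law `∂ₜ u = - ∂ₓ q` with `u(0) = u₀`. -/
def WeakConservationLaw (T : ℝ) (u₀ : Torus → ℝ) (u q : ℝ → Torus → ℝ) : Prop :=
  ∀ φ : ℝ → Torus → ℝ, IsTest T φ →
    -(∫ x, u₀ x * φ 0 x) - ∫ t in Ioo 0 T, ∫ x, u t x * deriv (fun τ => φ τ x) t =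
      ∫ t in Ioo 0 T, ∫ x, q t x * dx (φ t) x

/-- `(f, g)` is a weak solution on `[0,T)` of the thin film Muskat system
`∂ₜ f = - ∂ₓ[(f + ⟨f₀⟩)(A_γ ∂ₓ³f + A ∂ₓ³g - b_ρ ∂ₓf - b ∂ₓg)]`,
`∂ₜ g = - ∂ₓ[(g + ⟨g₀⟩)(A_μ ∂ₓ³f + A_μ ∂ₓ³g - b_μ ∂ₓf - b_μ ∂ₓg)]`
for the zero mean unknowns, with the fluctuations of `f₀`, `g₀` as initial data. -/
def IsWeakSolution (P : Params) (f₀ g₀ : Torus → ℝ) (T : ℝ) (f g : ℝ → Torus → ℝ) : Prop :=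
  MemLW T 1 3 1 f ∧ MemLW T 1 3 1 g ∧
  (∀ᵐ t ∂((volume : Measure ℝ).restrict (Ioo 0 T)), ∫ x, f t x = 0 ∧ ∫ x, g t x = 0) ∧
  ∃ f₁ f₃ g₁ g₃ q r : ℝ → Torus → ℝ,
    IsTXDeriv T 1 f f₁ ∧ IsTXDeriv T 3 f f₃ ∧ IsTXDeriv T 1 g g₁ ∧ IsTXDeriv T 3 g g₃ ∧
    (∀ t x, q t x = (f t x + mean f₀) *
      (P.Aγ * f₃ t x + P.A * g₃ t x - P.bρ * f₁ t x - P.b * g₁ t x)) ∧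
    (∀ t x, r t x = (g t x + mean g₀) *
      (P.Aμ * f₃ t x + P.Aμ * g₃ t x - P.bμ * f₁ t x - P.bμ * g₁ t x)) ∧
    TXIntegrable T q ∧ TXIntegrable T r ∧
    WeakConservationLaw T (fluct f₀) f q ∧ WeakConservationLaw T (fluct g₀) g r

/-- The regularity class on `(0,T)` of the global weak solutions for initial data in the Wiener
algebra. -/
def InWienerClass (T : ℝ) (u : ℝ → Torus → ℝ) : Prop :=
  MemLinfty T u ∧ MemLW T (4 / 3) 3 ∞ u ∧ (∀ α : ℝ≥0, α < 1 / 2 → MemLHolder T 3 α u) ∧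
    MemMW T 4 u ∧ MemL2Hdot T 2 u

end Muskat

end

/-!
The solution is constructed in Fourier variables. With `uᵢ = ∑ₖ uᵢₖ e^{ikx}` the thin film Muskat
system is the infinite system of ordinary differential equations `u̇ᵢₖ = -k (mᵢ Fᵢₖ + (uᵢ * Fᵢ)ₖ)`,
where `Fᵢₖ = ∑ⱼ (Aᵢⱼ k³ + Bᵢⱼ k) uⱼₖ` and `mᵢ` is the mean of the `i`-th unknown.

* Wiener algebra. The size `Φ = ∑ᵢ ∑ₖ |uᵢₖ|` decreases: the linear part contributes
  `-∑ₖ k⁴ |uₖ|` and `-∑ₖ k² |uₖ|` with the coefficients `mᵢ Aᵢᵢ`, `mᵢ Bᵢᵢ` on the diagonal. In the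
  nonlinear part the reality of the unknowns gives `|u₋ₗ| = |uₗ|`, so a pair of frequencies `l, p`
  contributes with `(|l + p| + |l - p|) / 2 = max(|l|, |p|)` instead of `|l| + |p|`, and
  `max(x, y) y³ ≤ x⁴ + y⁴`. Hence the nonlinear part costs `Aᵢⱼ + Aⱼᵢ` times `Φ` only, which the
  conditions on the `σ`'s and the first additional condition pay for; as long as `Φ ≤ 𝓔₀` this
  closes, with exponential decay since all frequencies are at least one in absolute value.
* Sobolev space. Distributing the weights by Young's inequality bounds the contribution of the
  nonlinearity to the derivative of the energy `∑ᵢ ∑ₖ k⁴ |uᵢₖ|²` by `Φ ∑ k⁸ |u|²` with the constants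
  `9/8` and `7/8`, and by lower order terms which are controlled by interpolation with the decaying
  quantity `Φ`. The energy decays exponentially and `∑ k⁸ |u|²` is integrable in time.

`System.Admissible` collects the inequalities needed, and `Params.admissible_system` verifies them
for the physical system. The bounds hold for the Galerkin truncations, which exist globally in time.
Each mode is equicontinuous in time, so a subsequence converges for every mode and every time, and
the nonlinearity passes to the limit because the tails of the convolution are small uniformly on
bounded sets of `Ḣ²` (`System.tendsto_conv`). This is `exists_isFourierSolution`.

The functions on the torus are the sums of the resulting series. For almost every time
`∑ₖ k⁴ |uₖ|` is finite, so that the solution has four classical derivatives and the flux is the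
product of absolutely convergent series. The weak formulation is an integration by parts in time on
each mode, followed by a summation over the modes (`weakConservationLaw_series`). Continuity in time
with values in `Ḣ²` follows by dominated convergence, since
`sup_t k⁴ |uₖ(t)|² ≤ k⁴ |uₖ(0)|² + 2 ∫ k⁴ |uₖ| |u̇ₖ| dt` is summable over `k`.
-/

namespace Muskat

/-! ### Convolution sums over finitely many frequencies -/

lemma sum_le_sum_of_support {S S' : Finset ℤ} {x : ℤ → ℝ} (h0 : ∀ k, 0 ≤ x k)
    (hx : ∀ k, k ∉ S' → x k = 0) : ∑ k ∈ S, x k ≤ ∑ k ∈ S', x k := by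
  classical
  calc ∑ k ∈ S, x k = ∑ k ∈ S with k ∈ S', x k := by
        rw [Finset.sum_filter]
        refine Finset.sum_congr rfl fun k _ => ?_
        split_ifs with h
        · rfl
        · exact hx k h
    _ ≤ ∑ k ∈ S', x k := Finset.sum_le_sum_of_subset_of_nonneg
        (fun k hk => (Finset.mem_filter.1 hk).2) (fun k _ _ => h0 k)

lemma sum_comp_le_of_injective {S : Finset ℤ} {x : ℤ → ℝ} (h0 : ∀ k, 0 ≤ x k)
    (hx : ∀ k, k ∉ S → x k = 0) {σ : ℤ → ℤ} (hσ : Function.Injective σ) :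
    ∑ k ∈ S, x (σ k) ≤ ∑ k ∈ S, x k := by
  classical
  rw [← Finset.sum_image (f := x) (s := S) (g := σ) (fun a _ b _ h => hσ h)]
  exact sum_le_sum_of_support h0 hx

/-- Young's convolution inequality `ℓ¹ * ℓ² ⊆ ℓ²` in bilinear form, with a free parameter `ε`. -/
lemma sum_conv_le {S : Finset ℤ} {c x y : ℤ → ℝ} (hx0 : ∀ k, 0 ≤ x k)
    (hy : ∀ k, k ∉ S → y k = 0) {ε : ℝ} (hε : 0 < ε) :
    ∑ k ∈ S, ∑ l ∈ S, c k * (x l * y (k - l)) ≤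
      (∑ k ∈ S, x k) * ((ε * ∑ k ∈ S, c k ^ 2 + ε⁻¹ * ∑ k ∈ S, y k ^ 2) / 2) := by
  rw [Finset.sum_comm, Finset.sum_mul]
  refine Finset.sum_le_sum fun l _ => ?_
  have h1 : ∑ k ∈ S, y (k - l) ^ 2 ≤ ∑ k ∈ S, y k ^ 2 :=
    sum_comp_le_of_injective (x := fun k => y k ^ 2) (fun k => sq_nonneg _)
      (fun k hk => by simp [hy k hk]) (sub_left_injective (b := l))
  calc ∑ k ∈ S, c k * (x l * y (k - l))
      ≤ ∑ k ∈ S, x l * ((ε * c k ^ 2 + ε⁻¹ * y (k - l) ^ 2) / 2) := by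
        refine Finset.sum_le_sum fun k _ => ?_
        have : c k * y (k - l) ≤ (ε * c k ^ 2 + ε⁻¹ * y (k - l) ^ 2) / 2 := by
          have h := sq_nonneg (ε * c k - y (k - l))
          have : ε⁻¹ * (ε * c k - y (k - l)) ^ 2 =
            ε * c k ^ 2 + ε⁻¹ * y (k - l) ^ 2 - 2 * (c k * y (k - l)) := by
            field_simp; ring
          nlinarith [mul_nonneg (inv_nonneg.2 hε.le) h]
        nlinarith [mul_le_mul_of_nonneg_left this (hx0 l)]
    _ = x l * ((ε * ∑ k ∈ S, c k ^ 2 + ε⁻¹ * ∑ k ∈ S, y (k - l) ^ 2) / 2) := by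
        rw [← Finset.mul_sum, ← Finset.sum_div, Finset.sum_add_distrib, Finset.mul_sum,
          Finset.mul_sum]
    _ ≤ _ := by
        have := mul_le_mul_of_nonneg_left h1 (inv_nonneg.2 hε.le)
        exact mul_le_mul_of_nonneg_left (by linarith) (hx0 l)

lemma sum_conv_le' {S : Finset ℤ} {c x y : ℤ → ℝ} (hx0 : ∀ k, 0 ≤ x k)
    (hx : ∀ k, k ∉ S → x k = 0) {ε : ℝ} (hε : 0 < ε) :
    ∑ k ∈ S, ∑ l ∈ S, c k * (y l * x (k - l)) ≤
      (∑ k ∈ S, x k) * ((ε * ∑ k ∈ S, c k ^ 2 + ε⁻¹ * ∑ k ∈ S, y k ^ 2) / 2) := by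
  have h1 : ∀ k l, c k * (y l * x (k - l)) ≤
      ε / 2 * (c k ^ 2 * x (k - l)) + ε⁻¹ / 2 * (y l ^ 2 * x (k - l)) := by
    intro k l
    have h := sq_nonneg (ε * c k - y l)
    have h2 : ε⁻¹ * (ε * c k - y l) ^ 2 = ε * c k ^ 2 + ε⁻¹ * y l ^ 2 - 2 * (c k * y l) := by
      field_simp; ring
    have h3 : c k * y l ≤ ε / 2 * c k ^ 2 + ε⁻¹ / 2 * y l ^ 2 := by
      nlinarith [mul_nonneg (inv_nonneg.2 hε.le) h]
    nlinarith [mul_le_mul_of_nonneg_right h3 (hx0 (k - l))]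
  have h2 : ∀ k, ∑ l ∈ S, x (k - l) ≤ ∑ l ∈ S, x l := fun k =>
    sum_comp_le_of_injective hx0 hx (sub_right_injective (b := k))
  have h3 : ∀ l, ∑ k ∈ S, x (k - l) ≤ ∑ k ∈ S, x k := fun l =>
    sum_comp_le_of_injective hx0 hx (sub_left_injective (b := l))
  calc ∑ k ∈ S, ∑ l ∈ S, c k * (y l * x (k - l))
      ≤ ∑ k ∈ S, ∑ l ∈ S, (ε / 2 * (c k ^ 2 * x (k - l)) + ε⁻¹ / 2 * (y l ^ 2 * x (k - l))) :=
        Finset.sum_le_sum fun k _ => Finset.sum_le_sum fun l _ => h1 k l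
    _ = ε / 2 * ∑ k ∈ S, c k ^ 2 * ∑ l ∈ S, x (k - l) +
          ε⁻¹ / 2 * ∑ l ∈ S, y l ^ 2 * ∑ k ∈ S, x (k - l) := by
        simp only [Finset.sum_add_distrib, Finset.mul_sum]
        congr 1
        rw [Finset.sum_comm]
    _ ≤ ε / 2 * ∑ k ∈ S, c k ^ 2 * ∑ l ∈ S, x l + ε⁻¹ / 2 * ∑ l ∈ S, y l ^ 2 * ∑ k ∈ S, x k := by
        refine add_le_add
          (mul_le_mul_of_nonneg_left (Finset.sum_le_sum fun k _ =>
            mul_le_mul_of_nonneg_left (h2 k) (sq_nonneg _)) (by positivity))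
          (mul_le_mul_of_nonneg_left (Finset.sum_le_sum fun l _ =>
            mul_le_mul_of_nonneg_left (h3 l) (sq_nonneg _)) (by positivity))
    _ = _ := by
        rw [← Finset.sum_mul, ← Finset.sum_mul]; ring

lemma max_mul_pow_le {x y : ℝ} (hx : 0 ≤ x) (hy : 0 ≤ y) (n : ℕ) :
    max x y * y ^ n ≤ x ^ (n + 1) + y ^ (n + 1) := by
  rcases le_total x y with h | h
  · rw [max_eq_right h, pow_succ' y]; nlinarith [pow_nonneg hx (n + 1)]
  · rw [max_eq_left h, pow_succ' x]
    have := mul_le_mul_of_nonneg_left (pow_le_pow_left₀ hy h n) hx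
    nlinarith [pow_nonneg hy (n + 1)]

/-- The frequencies of modulus at most `N`. -/
noncomputable def modes (N : ℕ) : Finset ℤ := Finset.Icc (-(N : ℤ)) N

lemma mem_modes {N : ℕ} {k : ℤ} : k ∈ modes N ↔ |k| ≤ N := by
  rw [modes, Finset.mem_Icc, abs_le]

lemma neg_mem_modes {N : ℕ} {k : ℤ} : -k ∈ modes N ↔ k ∈ modes N := by
  simp [mem_modes]

lemma sum_modes_neg (N : ℕ) (g : ℤ → ℝ) : ∑ l ∈ modes N, g (-l) = ∑ l ∈ modes N, g l :=
  Finset.sum_equiv (Equiv.neg ℤ) (fun _ => neg_mem_modes.symm) (fun _ _ => rfl)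

/-- The Wiener estimate of the derivative of a product. For an even sequence `a` the frequencies
`p + l` and `p - l` carry the same weight, and the mean of `|p + l|` and `|p - l|` is
`max |p| |l|`: this is what makes the constants in front of both products equal to one. -/
lemma sum_conv_wiener_le {N : ℕ} {a b : ℤ → ℝ} (ha0 : ∀ k, 0 ≤ a k) (hb0 : ∀ k, 0 ≤ b k)
    (hae : ∀ k, a (-k) = a k) (hb : ∀ k, k ∉ modes N → b k = 0) (n : ℕ) :
    ∑ k ∈ modes N, ∑ l ∈ modes N, |(k : ℝ)| * (a l * (|((k - l : ℤ) : ℝ)| ^ n * b (k - l))) ≤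
      (∑ k ∈ modes N, a k) * (∑ k ∈ modes N, |(k : ℝ)| ^ (n + 1) * b k) +
      (∑ k ∈ modes N, |(k : ℝ)| ^ (n + 1) * a k) * (∑ k ∈ modes N, b k) := by
  set S := modes N
  have h1 : ∑ k ∈ S, ∑ l ∈ S, |(k : ℝ)| * (a l * (|((k - l : ℤ) : ℝ)| ^ n * b (k - l))) ≤
      ∑ l ∈ S, ∑ p ∈ S, |(p : ℝ) + l| * (a l * (|(p : ℝ)| ^ n * b p)) := by
    rw [Finset.sum_comm]
    refine Finset.sum_le_sum fun l _ => ?_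
    have := sum_comp_le_of_injective (S := S)
      (x := fun p : ℤ => |(p : ℝ) + l| * (a l * (|(p : ℝ)| ^ n * b p)))
      (fun p => mul_nonneg (abs_nonneg _) (mul_nonneg (ha0 _)
        (mul_nonneg (by positivity) (hb0 _))))
      (fun p hp => by simp [hb p hp]) (sub_left_injective (b := l))
    refine le_trans (le_of_eq ?_) this
    refine Finset.sum_congr rfl fun k _ => ?_
    push_cast
    simp
  have h2 : ∑ l ∈ S, ∑ p ∈ S, |(p : ℝ) + l| * (a l * (|(p : ℝ)| ^ n * b p)) =
      ∑ l ∈ S, ∑ p ∈ S, ((|(p : ℝ) + l| + |(p : ℝ) - l|) / 2) * (a l * (|(p : ℝ)| ^ n * b p)) := by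
    have h3 := sum_modes_neg N
      (fun l => ∑ p ∈ S, |(p : ℝ) + l| * (a l * (|(p : ℝ)| ^ n * b p)))
    simp only [hae, Int.cast_neg, ← sub_eq_add_neg] at h3
    have h4 : ∀ x y : ℝ, y = x → x = (x + y) / 2 := by intro x y h; linarith
    refine (h4 _ _ h3).trans ?_
    rw [← Finset.sum_add_distrib, Finset.sum_div]
    refine Finset.sum_congr rfl fun l _ => ?_
    rw [← Finset.sum_add_distrib, Finset.sum_div]
    refine Finset.sum_congr rfl fun p _ => ?_
    ring
  rw [h2] at h1
  refine h1.trans ?_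
  rw [Finset.sum_mul_sum, Finset.sum_mul_sum, ← Finset.sum_add_distrib]
  refine Finset.sum_le_sum fun l _ => ?_
  rw [← Finset.sum_add_distrib]
  refine Finset.sum_le_sum fun p _ => ?_
  have h5 : (|(p : ℝ) + l| + |(p : ℝ) - l|) / 2 ≤ max |(l : ℝ)| |(p : ℝ)| := by
    rcases le_total |(l : ℝ)| |(p : ℝ)| with h | h
    · rw [max_eq_right h]
      rcases abs_cases ((p : ℝ) + l) with h1 | h1 <;> rcases abs_cases ((p : ℝ) - l) with h2 | h2 <;>
      rcases abs_cases (p : ℝ) with h3 | h3 <;> rcases abs_cases (l : ℝ) with h4 | h4 <;> linarith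
    · rw [max_eq_left h]
      rcases abs_cases ((p : ℝ) + l) with h1 | h1 <;> rcases abs_cases ((p : ℝ) - l) with h2 | h2 <;>
      rcases abs_cases (p : ℝ) with h3 | h3 <;> rcases abs_cases (l : ℝ) with h4 | h4 <;> linarith
  have h6 := max_mul_pow_le (abs_nonneg (l : ℝ)) (abs_nonneg (p : ℝ)) n
  have h7 : (|(p : ℝ) + l| + |(p : ℝ) - l|) / 2 * |(p : ℝ)| ^ n ≤
      |(l : ℝ)| ^ (n + 1) + |(p : ℝ)| ^ (n + 1) :=
    (mul_le_mul_of_nonneg_right h5 (by positivity)).trans h6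
  have h8 := mul_le_mul_of_nonneg_right h7 (mul_nonneg (ha0 l) (hb0 p))
  linarith

/-- The trilinear estimate behind the `Ḣ²` bound of the fourth order terms. -/
lemma sum_conv_energy_four_le {N : ℕ} {c a b : ℤ → ℝ} (hc0 : ∀ k, 0 ≤ c k) (ha0 : ∀ k, 0 ≤ a k)
    (hb0 : ∀ k, 0 ≤ b k)
    (hb : ∀ k, k ∉ modes N → b k = 0) :
    ∑ k ∈ modes N, ∑ l ∈ modes N,
        |(k : ℝ)| ^ 5 * c k * (a l * (|((k - l : ℤ) : ℝ)| ^ 3 * b (k - l))) ≤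
      7 / 8 * (∑ k ∈ modes N, a k) * (∑ k ∈ modes N, |(k : ℝ)| ^ 8 * c k ^ 2 +
        ∑ k ∈ modes N, |(k : ℝ)| ^ 8 * b k ^ 2) +
      1 / 8 * (∑ k ∈ modes N, b k) * (∑ k ∈ modes N, |(k : ℝ)| ^ 8 * c k ^ 2 +
        ∑ k ∈ modes N, |(k : ℝ)| ^ 8 * a k ^ 2) := by
  set S := modes N
  have e1 := sum_conv_le (S := S) (c := fun k => |(k : ℝ)| ^ 4 * c k) (x := a)
    (y := fun k => |(k : ℝ)| ^ 4 * b k) ha0 (fun k hk => by simp [hb k hk]) one_pos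
  have e2 := sum_conv_le' (S := S) (c := fun k => |(k : ℝ)| ^ 4 * c k) (x := b)
    (y := fun k => |(k : ℝ)| ^ 4 * a k) hb0 hb one_pos
  simp only [mul_pow, ← pow_mul, inv_one, one_mul] at e1 e2
  have key : ∑ k ∈ S, ∑ l ∈ S,
        |(k : ℝ)| ^ 5 * c k * (a l * (|((k - l : ℤ) : ℝ)| ^ 3 * b (k - l))) ≤
      7 / 4 * ∑ k ∈ S, ∑ l ∈ S, |(k : ℝ)| ^ 4 * c k *
        (a l * (|((k - l : ℤ) : ℝ)| ^ 4 * b (k - l))) +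
      1 / 4 * ∑ k ∈ S, ∑ l ∈ S, |(k : ℝ)| ^ 4 * c k * (|(l : ℝ)| ^ 4 * a l * b (k - l)) := by
    simp only [Finset.mul_sum, ← Finset.sum_add_distrib]
    refine Finset.sum_le_sum fun k _ => Finset.sum_le_sum fun l _ => ?_
    set p := |((k - l : ℤ) : ℝ)|
    have hp : 0 ≤ p := abs_nonneg _
    have hl : 0 ≤ |(l : ℝ)| := abs_nonneg _
    have hk : |(k : ℝ)| ≤ p + |(l : ℝ)| := by
      have : (k : ℝ) = ((k - l : ℤ) : ℝ) + l := by push_cast; ring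
      rw [this]; exact abs_add_le _ _
    have hy : |(l : ℝ)| * p ^ 3 ≤ 3 / 4 * p ^ 4 + 1 / 4 * |(l : ℝ)| ^ 4 := by
      have := mul_nonneg (sq_nonneg (p - |(l : ℝ)|))
        (by positivity : 0 ≤ 3 * p ^ 2 + 2 * p * |(l : ℝ)| + |(l : ℝ)| ^ 2)
      nlinarith
    have h1 : |(k : ℝ)| * p ^ 3 ≤ 7 / 4 * p ^ 4 + 1 / 4 * |(l : ℝ)| ^ 4 := by
      have := mul_le_mul_of_nonneg_right hk (by positivity : 0 ≤ p ^ 3)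
      nlinarith
    have h2 := mul_le_mul_of_nonneg_left h1
      (by have := hc0 k; have := ha0 l; have := hb0 (k - l); positivity :
        0 ≤ |(k : ℝ)| ^ 4 * c k * (a l * b (k - l)))
    nlinarith
  linarith

/-- The trilinear estimate behind the `Ḣ²` bound of the second order terms. -/
lemma sum_conv_energy_two_le {N : ℕ} {c a b : ℤ → ℝ} (hc0 : ∀ k, 0 ≤ c k) (ha0 : ∀ k, 0 ≤ a k)
    (hb0 : ∀ k, 0 ≤ b k)
    (hb : ∀ k, k ∉ modes N → b k = 0) {ε : ℝ} (hε : 0 < ε) :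
    ∑ k ∈ modes N, ∑ l ∈ modes N,
        |(k : ℝ)| ^ 5 * c k * (a l * (|((k - l : ℤ) : ℝ)| * b (k - l))) ≤
      (∑ k ∈ modes N, a k) * (ε * ∑ k ∈ modes N, |(k : ℝ)| ^ 8 * c k ^ 2 +
        ε⁻¹ * ∑ k ∈ modes N, |(k : ℝ)| ^ 4 * b k ^ 2) +
      (∑ k ∈ modes N, b k) * (ε * ∑ k ∈ modes N, |(k : ℝ)| ^ 8 * c k ^ 2 +
        ε⁻¹ * ∑ k ∈ modes N, |(k : ℝ)| ^ 4 * a k ^ 2) := by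
  set S := modes N
  have e1 := sum_conv_le (S := S) (c := fun k => |(k : ℝ)| ^ 4 * c k) (x := a)
    (y := fun k => |(k : ℝ)| ^ 2 * b k) ha0 (fun k hk => by simp [hb k hk]) hε
  have e2 := sum_conv_le' (S := S) (c := fun k => |(k : ℝ)| ^ 4 * c k) (x := b)
    (y := fun k => |(k : ℝ)| ^ 2 * a k) hb0 hb hε
  simp only [mul_pow, ← pow_mul] at e1 e2
  norm_num at e1 e2
  have key : ∑ k ∈ S, ∑ l ∈ S,
        |(k : ℝ)| ^ 5 * c k * (a l * (|((k - l : ℤ) : ℝ)| * b (k - l))) ≤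
      2 * ∑ k ∈ S, ∑ l ∈ S, |(k : ℝ)| ^ 4 * c k *
        (a l * (|((k - l : ℤ) : ℝ)| ^ 2 * b (k - l))) +
      2 * ∑ k ∈ S, ∑ l ∈ S, |(k : ℝ)| ^ 4 * c k * (|(l : ℝ)| ^ 2 * a l * b (k - l)) := by
    simp only [Finset.mul_sum, ← Finset.sum_add_distrib]
    refine Finset.sum_le_sum fun k _ => Finset.sum_le_sum fun l _ => ?_
    set p := |((k - l : ℤ) : ℝ)|
    have hp : 0 ≤ p := abs_nonneg _
    have hl : 0 ≤ |(l : ℝ)| := abs_nonneg _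
    have hk : |(k : ℝ)| ≤ p + |(l : ℝ)| := by
      have : (k : ℝ) = ((k - l : ℤ) : ℝ) + l := by push_cast; ring
      rw [this]; exact abs_add_le _ _
    have h1 : |(k : ℝ)| * p ≤ 2 * p ^ 2 + 2 * |(l : ℝ)| ^ 2 := by
      have := mul_le_mul_of_nonneg_right hk hp
      nlinarith [sq_nonneg (p - |(l : ℝ)|)]
    have h2 := mul_le_mul_of_nonneg_left h1
      (by have := hc0 k; have := ha0 l; have := hb0 (k - l); positivity :
        0 ≤ |(k : ℝ)| ^ 4 * c k * (a l * b (k - l)))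
    nlinarith
  simp only [sq_abs, Int.cast_sub] at *
  have e3 : ∀ x : ℝ, (x:ℝ) ^ 4 = |x| ^ 4 := fun x => by
    rw [show (4:ℕ) = 2 * 2 from rfl, pow_mul, pow_mul, sq_abs]
  linarith

/-! ### The system in Fourier variables -/

/-- The coefficients of the system
`∂ₜ uᵢ = - ∂ₓ[(uᵢ + mᵢ) ∑ⱼ (Aᵢⱼ ∂ₓ³uⱼ - Bᵢⱼ ∂ₓuⱼ)]` for two zero mean unknowns. -/
structure System where
  m : Fin 2 → ℝ
  A : Fin 2 → Fin 2 → ℝ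
  B : Fin 2 → Fin 2 → ℝ

namespace System

variable (C : System)

/-- The sequence `Fᵢ = ∑ⱼ (Aᵢⱼ k³ + Bᵢⱼ k) uⱼ`; the Fourier coefficients of
`∑ⱼ (Aᵢⱼ ∂ₓ³uⱼ - Bᵢⱼ ∂ₓuⱼ)` are `-i Fᵢ`. -/
noncomputable def force (u : Fin 2 → ℤ → ℂ) (i : Fin 2) (k : ℤ) : ℂ :=
  ∑ j, ((C.A i j * (k : ℝ) ^ 3 + C.B i j * (k : ℝ) : ℝ) : ℂ) * u j k

/-- The convolution `uᵢ * Fᵢ`. -/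
noncomputable def conv (u : Fin 2 → ℤ → ℂ) (i : Fin 2) (k : ℤ) : ℂ :=
  ∑' l, u i l * C.force u i (k - l)

/-- The right hand side of the evolution equation of the Fourier coefficients. -/
noncomputable def rhs (u : Fin 2 → ℤ → ℂ) (i : Fin 2) (k : ℤ) : ℂ :=
  -(k : ℂ) * (C.m i * C.force u i k + C.conv u i k)

/-- The smallness conditions on the Wiener size `E` of the data which make the system dissipative:
with the rates `α` (fourth order) and `β` (second order) in the Wiener algebra, and with the rate
`κ` in `Ḣ²`. -/
structure Admissible (E α β κ : ℝ) : Prop where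
  m_nonneg : ∀ i, 0 ≤ C.m i
  A_nonneg : ∀ i j, 0 ≤ C.A i j
  B_nonneg : ∀ i j, 0 ≤ C.B i j
  E_nonneg : 0 ≤ E
  α_pos : 0 < α
  β_nonneg : 0 ≤ β
  κ_pos : 0 < κ
  wienerA : ∀ i j, α + (C.A i j + C.A j i) * E ≤ C.m i * C.A i i - C.m (i + 1) * C.A (i + 1) i
  wienerB : ∀ i j, β + (C.B i j + C.B j i) * E ≤ C.m i * C.B i i - C.m (i + 1) * C.B (i + 1) i
  energyA : ∀ i, κ + (9 / 8 * ∑ j, C.A i j + 7 / 8 * ∑ j, C.A j i) * E ≤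
    C.m i * C.A i i - (C.m 0 * C.A 0 1 + C.m 1 * C.A 1 0) / 2
  energyB : ∀ i, 0 ≤ C.m i * C.B i i - (C.m 0 * C.B 0 1 + C.m 1 * C.B 1 0) / 2

end System

/-- The pair `u` consists of the Fourier coefficients of real trigonometric polynomials of degree
at most `N` with zero mean. -/
structure IsTrig (N : ℕ) (u : Fin 2 → ℤ → ℂ) : Prop where
  supp : ∀ i k, k ∉ modes N → u i k = 0
  zero : ∀ i, u i 0 = 0
  symm : ∀ i k, u i (-k) = starRingEnd ℂ (u i k)

lemma IsTrig.norm_neg {N : ℕ} {u : Fin 2 → ℤ → ℂ} (hu : IsTrig N u) (i : Fin 2) (k : ℤ) :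
    ‖u i (-k)‖ = ‖u i k‖ := by rw [hu.symm, RCLike.norm_conj]

/-- The Wiener norm of order `s`, restricted to frequencies of modulus at most `N`. -/
noncomputable def W (N s : ℕ) (a : ℤ → ℂ) : ℝ := ∑ k ∈ modes N, |(k : ℝ)| ^ s * ‖a k‖

/-- The sum `∑ |k|^s |aₖ|²` over the frequencies of modulus at most `N`. -/
noncomputable def En (N s : ℕ) (a : ℤ → ℂ) : ℝ := ∑ k ∈ modes N, |(k : ℝ)| ^ s * ‖a k‖ ^ 2

lemma W_nonneg (N s : ℕ) (a : ℤ → ℂ) : 0 ≤ W N s a :=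
  Finset.sum_nonneg fun _ _ => by positivity

lemma En_nonneg (N s : ℕ) (a : ℤ → ℂ) : 0 ≤ En N s a :=
  Finset.sum_nonneg fun _ _ => by positivity

lemma one_le_abs_cast {k : ℤ} (hk : k ≠ 0) : (1 : ℝ) ≤ |(k : ℝ)| := by
  have := Int.one_le_abs hk
  exact_mod_cast this

lemma W_mono {a : ℤ → ℂ} (h0 : a 0 = 0) (N : ℕ) {s r : ℕ} (h : s ≤ r) : W N s a ≤ W N r a := by
  refine Finset.sum_le_sum fun k _ => ?_
  rcases eq_or_ne k 0 with rfl | hk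
  · simp [h0]
  · exact mul_le_mul_of_nonneg_right (pow_le_pow_right₀ (one_le_abs_cast hk) h) (norm_nonneg _)

lemma En_mono {a : ℤ → ℂ} (h0 : a 0 = 0) (N : ℕ) {s r : ℕ} (h : s ≤ r) : En N s a ≤ En N r a := by
  refine Finset.sum_le_sum fun k _ => ?_
  rcases eq_or_ne k 0 with rfl | hk
  · simp [h0]
  · exact mul_le_mul_of_nonneg_right (pow_le_pow_right₀ (one_le_abs_cast hk) h) (by positivity)

lemma En_zero_le (N : ℕ) (a : ℤ → ℂ) : En N 0 a ≤ W N 0 a ^ 2 := by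
  simp only [En, W, pow_zero, one_mul]
  exact Finset.sum_sq_le_sq_sum_of_nonneg fun _ _ => norm_nonneg _

/-- Interpolation of `Ḣ²` between `Ḣ⁴` and the Wiener algebra. -/
lemma En_four_le (N : ℕ) (a : ℤ → ℂ) {ε : ℝ} (hε : 0 < ε) :
    En N 4 a ≤ (ε ^ 2 * En N 8 a + (ε⁻¹) ^ 2 * W N 0 a ^ 2) / 2 := by
  have h1 : En N 4 a ≤ (ε ^ 2 * En N 8 a + (ε⁻¹) ^ 2 * En N 0 a) / 2 := by
    simp only [En, Finset.mul_sum, ← Finset.sum_add_distrib, Finset.sum_div]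
    refine Finset.sum_le_sum fun k _ => ?_
    have h := sq_nonneg (ε * |(k : ℝ)| ^ 4 - ε⁻¹)
    have h2 : |(k : ℝ)| ^ 4 ≤ (ε ^ 2 * |(k : ℝ)| ^ 8 + (ε⁻¹) ^ 2) / 2 := by
      have : ε * ε⁻¹ = 1 := mul_inv_cancel₀ hε.ne'
      have h3 : (ε * |(k : ℝ)| ^ 4 - ε⁻¹) ^ 2 =
        ε ^ 2 * |(k : ℝ)| ^ 8 + (ε⁻¹) ^ 2 - 2 * |(k : ℝ)| ^ 4 * (ε * ε⁻¹) := by ring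
      rw [this] at h3
      linarith
    have := mul_le_mul_of_nonneg_right h2 (sq_nonneg ‖a k‖)
    nlinarith
  have := mul_le_mul_of_nonneg_left (En_zero_le N a) (sq_nonneg ε⁻¹)
  linarith

namespace System

variable {C : System} {E α β κ : ℝ}

lemma conv_eq_sum {N : ℕ} {u : Fin 2 → ℤ → ℂ} (hu : IsTrig N u) (i : Fin 2) (k : ℤ) :
    C.conv u i k = ∑ l ∈ modes N, u i l * C.force u i (k - l) :=
  tsum_eq_sum fun l hl => by simp [hu.supp _ _ hl]

lemma norm_force_le (h : C.Admissible E α β κ) (u : Fin 2 → ℤ → ℂ) (i : Fin 2) (k : ℤ) :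
    ‖C.force u i k‖ ≤ ∑ j, (C.A i j * |(k : ℝ)| ^ 3 + C.B i j * |(k : ℝ)|) * ‖u j k‖ := by
  refine (norm_sum_le _ _).trans (Finset.sum_le_sum fun j _ => ?_)
  rw [norm_mul, Complex.norm_real, Real.norm_eq_abs]
  refine mul_le_mul_of_nonneg_right ((abs_add_le _ _).trans ?_) (norm_nonneg _)
  rw [abs_mul, abs_mul, abs_pow, abs_of_nonneg (h.A_nonneg i j), abs_of_nonneg (h.B_nonneg i j)]

lemma norm_conv_le (h : C.Admissible E α β κ) {N : ℕ} {u : Fin 2 → ℤ → ℂ} (hu : IsTrig N u)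
    (i : Fin 2) (k : ℤ) :
    ‖C.conv u i k‖ ≤ ∑ j, (C.A i j * ∑ l ∈ modes N,
        ‖u i l‖ * (|((k - l : ℤ) : ℝ)| ^ 3 * ‖u j (k - l)‖) +
      C.B i j * ∑ l ∈ modes N, ‖u i l‖ * (|((k - l : ℤ) : ℝ)| * ‖u j (k - l)‖)) := by
  rw [conv_eq_sum hu]
  refine (norm_sum_le _ _).trans ?_
  have : ∀ l ∈ modes N, ‖u i l * C.force u i (k - l)‖ ≤ ∑ j, (C.A i j *
        (‖u i l‖ * (|((k - l : ℤ) : ℝ)| ^ 3 * ‖u j (k - l)‖)) +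
      C.B i j * (‖u i l‖ * (|((k - l : ℤ) : ℝ)| * ‖u j (k - l)‖))) := by
    intro l _
    rw [norm_mul]
    refine (mul_le_mul_of_nonneg_left (norm_force_le h u i (k - l)) (norm_nonneg _)).trans
      (le_of_eq ?_)
    rw [Finset.mul_sum]
    refine Finset.sum_congr rfl fun j _ => by ring
  refine (Finset.sum_le_sum this).trans (le_of_eq ?_)
  rw [Finset.sum_comm]
  refine Finset.sum_congr rfl fun j _ => ?_
  rw [Finset.sum_add_distrib, Finset.mul_sum, Finset.mul_sum]

lemma sum_abs_mul_norm_conv_le (h : C.Admissible E α β κ) {N : ℕ} {u : Fin 2 → ℤ → ℂ}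
    (hu : IsTrig N u) (i : Fin 2) :
    ∑ k ∈ modes N, |(k : ℝ)| * ‖C.conv u i k‖ ≤
      ∑ j, (C.A i j * (W N 0 (u i) * W N 4 (u j) + W N 4 (u i) * W N 0 (u j)) +
        C.B i j * (W N 0 (u i) * W N 2 (u j) + W N 2 (u i) * W N 0 (u j))) := by
  have key := fun (n : ℕ) (j : Fin 2) => sum_conv_wiener_le (N := N) (a := fun l => ‖u i l‖)
    (b := fun l => ‖u j l‖) (fun _ => norm_nonneg _) (fun _ => norm_nonneg _)
    (hu.norm_neg i) (fun k hk => by simp [hu.supp _ _ hk]) n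
  calc ∑ k ∈ modes N, |(k : ℝ)| * ‖C.conv u i k‖
      ≤ ∑ k ∈ modes N, |(k : ℝ)| * ∑ j, (C.A i j * ∑ l ∈ modes N,
        ‖u i l‖ * (|((k - l : ℤ) : ℝ)| ^ 3 * ‖u j (k - l)‖) +
      C.B i j * ∑ l ∈ modes N, ‖u i l‖ * (|((k - l : ℤ) : ℝ)| * ‖u j (k - l)‖)) :=
        Finset.sum_le_sum fun k _ =>
          mul_le_mul_of_nonneg_left (norm_conv_le h hu i k) (abs_nonneg _)
    _ = ∑ j, (C.A i j * ∑ k ∈ modes N, ∑ l ∈ modes N,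
        |(k : ℝ)| * (‖u i l‖ * (|((k - l : ℤ) : ℝ)| ^ 3 * ‖u j (k - l)‖)) +
      C.B i j * ∑ k ∈ modes N, ∑ l ∈ modes N,
        |(k : ℝ)| * (‖u i l‖ * (|((k - l : ℤ) : ℝ)| ^ 1 * ‖u j (k - l)‖))) := by
        simp only [Finset.mul_sum, pow_one, Finset.sum_add_distrib, mul_add]
        rw [Finset.sum_comm]
        conv_lhs => arg 2; rw [Finset.sum_comm]
        congr 1 <;>
        · refine Finset.sum_congr rfl fun j _ => Finset.sum_congr rfl fun k _ =>
            Finset.sum_congr rfl fun l _ => by ring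
    _ ≤ _ := by
        refine Finset.sum_le_sum fun j _ => add_le_add
          (mul_le_mul_of_nonneg_left ((key 3 j).trans (le_of_eq ?_)) (h.A_nonneg i j))
          (mul_le_mul_of_nonneg_left ((key 1 j).trans (le_of_eq ?_)) (h.B_nonneg i j)) <;>
        simp [W]

lemma sum_pow_mul_norm_conv_le (h : C.Admissible E α β κ) {N : ℕ} {u : Fin 2 → ℤ → ℂ}
    (hu : IsTrig N u) (i : Fin 2) {ε : ℝ} (hε : 0 < ε) :
    ∑ k ∈ modes N, |(k : ℝ)| ^ 5 * ‖u i k‖ * ‖C.conv u i k‖ ≤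
      ∑ j, (C.A i j * (7 / 8 * W N 0 (u i) * (En N 8 (u i) + En N 8 (u j)) +
          1 / 8 * W N 0 (u j) * (En N 8 (u i) + En N 8 (u i))) +
        C.B i j * (W N 0 (u i) * (ε * En N 8 (u i) + ε⁻¹ * En N 4 (u j)) +
          W N 0 (u j) * (ε * En N 8 (u i) + ε⁻¹ * En N 4 (u i)))) := by
  have key1 := fun (j : Fin 2) => sum_conv_energy_four_le (N := N) (c := fun l => ‖u i l‖)
    (a := fun l => ‖u i l‖)
    (b := fun l => ‖u j l‖) (fun _ => norm_nonneg _) (fun _ => norm_nonneg _)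
    (fun _ => norm_nonneg _) (fun k hk => by simp [hu.supp _ _ hk])
  have key2 := fun (j : Fin 2) => sum_conv_energy_two_le (N := N) (c := fun l => ‖u i l‖)
    (a := fun l => ‖u i l‖)
    (b := fun l => ‖u j l‖) (fun _ => norm_nonneg _) (fun _ => norm_nonneg _)
    (fun _ => norm_nonneg _) (fun k hk => by simp [hu.supp _ _ hk]) hε
  calc ∑ k ∈ modes N, |(k : ℝ)| ^ 5 * ‖u i k‖ * ‖C.conv u i k‖
      ≤ ∑ k ∈ modes N, |(k : ℝ)| ^ 5 * ‖u i k‖ * ∑ j, (C.A i j * ∑ l ∈ modes N,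
        ‖u i l‖ * (|((k - l : ℤ) : ℝ)| ^ 3 * ‖u j (k - l)‖) +
      C.B i j * ∑ l ∈ modes N, ‖u i l‖ * (|((k - l : ℤ) : ℝ)| * ‖u j (k - l)‖)) :=
        Finset.sum_le_sum fun k _ =>
          mul_le_mul_of_nonneg_left (norm_conv_le h hu i k) (by positivity)
    _ = ∑ j, (C.A i j * ∑ k ∈ modes N, ∑ l ∈ modes N,
        |(k : ℝ)| ^ 5 * ‖u i k‖ * (‖u i l‖ * (|((k - l : ℤ) : ℝ)| ^ 3 * ‖u j (k - l)‖)) +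
      C.B i j * ∑ k ∈ modes N, ∑ l ∈ modes N,
        |(k : ℝ)| ^ 5 * ‖u i k‖ * (‖u i l‖ * (|((k - l : ℤ) : ℝ)| * ‖u j (k - l)‖))) := by
        simp only [Finset.mul_sum, Finset.sum_add_distrib, mul_add]
        rw [Finset.sum_comm]
        conv_lhs => arg 2; rw [Finset.sum_comm]
        congr 1 <;>
        · refine Finset.sum_congr rfl fun j _ => Finset.sum_congr rfl fun k _ =>
            Finset.sum_congr rfl fun l _ => by ring
    _ ≤ _ := by
        refine Finset.sum_le_sum fun j _ => add_le_add
          (mul_le_mul_of_nonneg_left ((key1 j).trans (le_of_eq ?_)) (h.A_nonneg i j))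
          (mul_le_mul_of_nonneg_left ((key2 j).trans (le_of_eq ?_)) (h.B_nonneg i j)) <;>
        simp [W, En]

/-- Dissipation in the Wiener algebra: the left hand side bounds the time derivative of
`∑ᵢ ∑ₖ |uᵢₖ|`. -/
lemma wiener_dissipation (h : C.Admissible E α β κ) {N : ℕ} {u : Fin 2 → ℤ → ℂ}
    (hu : IsTrig N u) (hE : ∑ i, W N 0 (u i) ≤ E) :
    ∑ i, ∑ k ∈ modes N, (-(C.m i * (C.A i i * |(k : ℝ)| ^ 4 + C.B i i * |(k : ℝ)| ^ 2) * ‖u i k‖) +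
        C.m i * (C.A i (i + 1) * |(k : ℝ)| ^ 4 + C.B i (i + 1) * |(k : ℝ)| ^ 2) * ‖u (i + 1) k‖ +
        |(k : ℝ)| * ‖C.conv u i k‖) ≤
      -α * ∑ i, W N 4 (u i) - β * ∑ i, W N 2 (u i) := by
  have e0 := sum_abs_mul_norm_conv_le h hu 0
  have e1 := sum_abs_mul_norm_conv_le h hu 1
  have lin : ∀ i, ∑ k ∈ modes N,
      (-(C.m i * (C.A i i * |(k : ℝ)| ^ 4 + C.B i i * |(k : ℝ)| ^ 2) * ‖u i k‖) +
        C.m i * (C.A i (i + 1) * |(k : ℝ)| ^ 4 + C.B i (i + 1) * |(k : ℝ)| ^ 2) * ‖u (i + 1) k‖ +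
        |(k : ℝ)| * ‖C.conv u i k‖) =
      -(C.m i * (C.A i i * W N 4 (u i) + C.B i i * W N 2 (u i))) +
      C.m i * (C.A i (i + 1) * W N 4 (u (i + 1)) + C.B i (i + 1) * W N 2 (u (i + 1))) +
      ∑ k ∈ modes N, |(k : ℝ)| * ‖C.conv u i k‖ := by
    intro i
    simp only [W, Finset.mul_sum, ← Finset.sum_add_distrib, ← Finset.sum_neg_distrib]
    refine Finset.sum_congr rfl fun k _ => by ring
  simp only [lin]
  simp only [Fin.sum_univ_two] at *
  have a00 := h.wienerA 0 0
  have a01 := h.wienerA 0 1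
  have a10 := h.wienerA 1 0
  have a11 := h.wienerA 1 1
  have b00 := h.wienerB 0 0
  have b01 := h.wienerB 0 1
  have b10 := h.wienerB 1 0
  have b11 := h.wienerB 1 1
  have t1 : (1 : Fin 2) + 1 = 0 := rfl
  have t0 : (0 : Fin 2) + 1 = 1 := rfl
  rw [t0] at a00 a01 b00 b01 ⊢
  rw [t1] at a10 a11 b10 b11 ⊢
  have key : ∀ x0 x1 y α p q D : ℝ, 0 ≤ x0 → 0 ≤ x1 → 0 ≤ y → x0 + x1 ≤ E →
      0 ≤ p → 0 ≤ q → α + p * E ≤ D → α + q * E ≤ D →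
      (p * x0 + q * x1) * y ≤ (D - α) * y := by
    intro x0 x1 y α p q D h0 h1 hy hx hp hq h2 h3
    refine mul_le_mul_of_nonneg_right ?_ hy
    rcases le_total p q with hpq | hpq
    · nlinarith [mul_le_mul_of_nonneg_right hpq h0, mul_le_mul_of_nonneg_left hx hq]
    · nlinarith [mul_le_mul_of_nonneg_right hpq h1, mul_le_mul_of_nonneg_left hx hp]
  have n0 := W_nonneg N 0 (u 0)
  have n1 := W_nonneg N 0 (u 1)
  have A := h.A_nonneg
  have B := h.B_nonneg
  have k1 := key _ _ (W N 4 (u 0)) _ _ _ _ n0 n1 (W_nonneg _ _ _) hE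
    (add_nonneg (A 0 0) (A 0 0)) (add_nonneg (A 0 1) (A 1 0)) a00 a01
  have k2 := key _ _ (W N 4 (u 1)) _ _ _ _ n0 n1 (W_nonneg _ _ _) hE
    (add_nonneg (A 1 0) (A 0 1)) (add_nonneg (A 1 1) (A 1 1)) a10 a11
  have k3 := key _ _ (W N 2 (u 0)) _ _ _ _ n0 n1 (W_nonneg _ _ _) hE
    (add_nonneg (B 0 0) (B 0 0)) (add_nonneg (B 0 1) (B 1 0)) b00 b01
  have k4 := key _ _ (W N 2 (u 1)) _ _ _ _ n0 n1 (W_nonneg _ _ _) hE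
    (add_nonneg (B 1 0) (B 0 1)) (add_nonneg (B 1 1) (B 1 1)) b10 b11
  linarith

/-- The nonlinear part of the energy estimate in `Ḣ²`. The second order terms are lower order: they
are absorbed by the dissipation up to a cubic remainder in the Wiener size. -/
lemma exists_sum_pow_mul_norm_conv_le (h : C.Admissible E α β κ) : ∃ K, 0 ≤ K ∧
    ∀ (N : ℕ) (u : Fin 2 → ℤ → ℂ), IsTrig N u → ∑ i, W N 0 (u i) ≤ E →
      ∑ i, ∑ k ∈ modes N, |(k : ℝ)| ^ 5 * ‖u i k‖ * ‖C.conv u i k‖ ≤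
        ∑ i, (9 / 8 * ∑ j, C.A i j + 7 / 8 * ∑ j, C.A j i) * E * En N 8 (u i) +
        κ / 2 * ∑ i, En N 8 (u i) + K * (∑ i, W N 0 (u i)) ^ 3 := by
  set b := ∑ i, ∑ j, C.B i j with hb
  have hb0 : 0 ≤ b := Finset.sum_nonneg fun i _ => Finset.sum_nonneg fun j _ => h.B_nonneg i j
  have hE0 := h.E_nonneg
  have hκ := h.κ_pos
  set ε := κ / (6 * (b * E + 1)) with hε
  have hd : 0 < b * E + 1 := by positivity
  have hε0 : 0 < ε := by positivity
  refine ⟨b * (ε⁻¹) ^ 3, by positivity, fun N u hu hE => ?_⟩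
  set Φ := ∑ i, W N 0 (u i) with hΦ
  have hΦ0 : 0 ≤ Φ := Finset.sum_nonneg fun i _ => W_nonneg _ _ _
  have hW : ∀ i, W N 0 (u i) ≤ Φ := fun i =>
    Finset.single_le_sum (f := fun i => W N 0 (u i)) (fun i _ => W_nonneg _ _ _)
      (Finset.mem_univ i)
  set X := ∑ i, En N 8 (u i) with hX
  have hX0 : 0 ≤ X := Finset.sum_nonneg fun i _ => En_nonneg _ _ _
  have hE8 : ∀ i, En N 8 (u i) ≤ X := fun i =>
    Finset.single_le_sum (f := fun i => En N 8 (u i)) (fun i _ => En_nonneg _ _ _)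
      (Finset.mem_univ i)
  clear_value Φ X b ε
  have hE4 : ∀ i, En N 4 (u i) ≤ (ε ^ 2 * X + (ε⁻¹) ^ 2 * Φ ^ 2) / 2 := by
    intro i
    have h1 := En_four_le N (u i) hε0
    have h2 := mul_le_mul_of_nonneg_left (hE8 i) (sq_nonneg ε)
    have h3 := mul_le_mul_of_nonneg_left (pow_le_pow_left₀ (W_nonneg N 0 (u i)) (hW i) 2)
      (sq_nonneg ε⁻¹)
    linarith
  have hB : ∀ i j, C.B i j * (W N 0 (u i) * (ε * En N 8 (u i) + ε⁻¹ * En N 4 (u j)) +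
      W N 0 (u j) * (ε * En N 8 (u i) + ε⁻¹ * En N 4 (u i))) ≤
      C.B i j * (Φ * (3 * ε * X + (ε⁻¹) ^ 3 * Φ ^ 2)) := by
    intro i j
    refine mul_le_mul_of_nonneg_left ?_ (h.B_nonneg i j)
    have hbd : ∀ j, ε * En N 8 (u i) + ε⁻¹ * En N 4 (u j) ≤
        (3 * ε * X + (ε⁻¹) ^ 3 * Φ ^ 2) / 2 := by
      intro j
      have h1 := mul_le_mul_of_nonneg_left (hE8 i) hε0.le
      have h2 := mul_le_mul_of_nonneg_left (hE4 j) (inv_nonneg.2 hε0.le)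
      have h3 : ε⁻¹ * ((ε ^ 2 * X + (ε⁻¹) ^ 2 * Φ ^ 2) / 2) =
          (ε * X + (ε⁻¹) ^ 3 * Φ ^ 2) / 2 := by
        field_simp
      linarith
    have h0 : 0 ≤ (3 * ε * X + (ε⁻¹) ^ 3 * Φ ^ 2) / 2 := by positivity
    have h1 := mul_le_mul (hW i) (hbd j)
      (by have := En_nonneg N 8 (u i); have := En_nonneg N 4 (u j); positivity) hΦ0
    have h2 := mul_le_mul (hW j) (hbd i)
      (by have := En_nonneg N 8 (u i); have := En_nonneg N 4 (u i); positivity) hΦ0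
    linarith
  have hA : ∀ i j, C.A i j * (7 / 8 * W N 0 (u i) * (En N 8 (u i) + En N 8 (u j)) +
        1 / 8 * W N 0 (u j) * (En N 8 (u i) + En N 8 (u i))) ≤
      C.A i j * (E * (9 / 8 * En N 8 (u i) + 7 / 8 * En N 8 (u j))) := by
    intro i j
    refine mul_le_mul_of_nonneg_left ?_ (h.A_nonneg i j)
    have n1 := En_nonneg N 8 (u i)
    have n2 := En_nonneg N 8 (u j)
    have h1 := mul_le_mul_of_nonneg_right ((hW i).trans hE) (add_nonneg n1 n2)
    have h2 := mul_le_mul_of_nonneg_right ((hW j).trans hE) n1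
    linarith
  have hsum : ∑ i, ∑ k ∈ modes N, |(k : ℝ)| ^ 5 * ‖u i k‖ * ‖C.conv u i k‖ ≤
      ∑ i, ∑ j, (C.A i j * (E * (9 / 8 * En N 8 (u i) + 7 / 8 * En N 8 (u j))) +
        C.B i j * (Φ * (3 * ε * X + (ε⁻¹) ^ 3 * Φ ^ 2))) :=
    Finset.sum_le_sum fun i _ => (sum_pow_mul_norm_conv_le h hu i hε0).trans
      (Finset.sum_le_sum fun j _ => add_le_add (hA i j) (hB i j))
  refine hsum.trans ?_
  have hbs : ∑ i, ∑ j, C.B i j * (Φ * (3 * ε * X + (ε⁻¹) ^ 3 * Φ ^ 2)) =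
      b * (Φ * (3 * ε * X + (ε⁻¹) ^ 3 * Φ ^ 2)) := by
    simp only [hb, Finset.sum_mul]
  simp only [Finset.sum_add_distrib] at hbs ⊢
  rw [hbs]
  have hfin : b * Φ * (3 * ε) ≤ κ / 2 := by
    have h1 : b * Φ ≤ b * E := mul_le_mul_of_nonneg_left hE hb0
    have h2 : b * Φ * (3 * ε) ≤ (b * E + 1) * (3 * ε) := by
      refine mul_le_mul_of_nonneg_right (by linarith) (by positivity)
    refine h2.trans (le_of_eq ?_)
    rw [hε]; field_simp; norm_num
  have hfin2 := mul_le_mul_of_nonneg_right hfin hX0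
  have hAeq : ∑ i, ∑ j, C.A i j * (E * (9 / 8 * En N 8 (u i) + 7 / 8 * En N 8 (u j))) =
      ∑ i, (9 / 8 * ∑ j, C.A i j + 7 / 8 * ∑ j, C.A j i) * E * En N 8 (u i) := by
    simp only [Fin.sum_univ_two]; ring
  rw [hAeq]
  linarith

/-- The linear part of the energy estimate in `Ḣ²`. -/
lemma linear_energy_le (h : C.Admissible E α β κ) (u : Fin 2 → ℤ → ℂ) (k : ℤ) :
    ∑ i, (starRingEnd ℂ (u i k) * (-(k : ℂ) * (C.m i * C.force u i k))).re ≤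
      -∑ i, (κ + (9 / 8 * ∑ j, C.A i j + 7 / 8 * ∑ j, C.A j i) * E) * |(k : ℝ)| ^ 4 *
        ‖u i k‖ ^ 2 := by
  have n1 : |(k : ℝ)| ^ 4 = (k : ℝ) ^ 4 := by
    rw [show (4:ℕ) = 2 * 2 from rfl, pow_mul, pow_mul, sq_abs]
  have a0 := h.energyA 0
  have a1 := h.energyA 1
  have b0 := h.energyB 0
  have b1 := h.energyB 1
  simp only [force, Fin.sum_univ_two] at *
  set x := u 0 k
  set y := u 1 k
  rw [n1]
  have e : ∀ z : ℂ, ‖z‖ ^ 2 = z.re ^ 2 + z.im ^ 2 := fun z => by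
    rw [Complex.sq_norm, Complex.normSq_apply]; ring
  simp only [e]
  simp only [Complex.mul_re, Complex.mul_im, Complex.add_re, Complex.add_im, Complex.neg_re,
    Complex.neg_im, Complex.conj_re, Complex.conj_im, Complex.intCast_re, Complex.intCast_im,
    Complex.ofReal_re, Complex.ofReal_im]
  set r := (k : ℝ)
  have mA : 0 ≤ C.m 0 * C.A 0 1 + C.m 1 * C.A 1 0 := by
    have := h.m_nonneg; have := h.A_nonneg
    exact add_nonneg (mul_nonneg (h.m_nonneg 0) (h.A_nonneg 0 1))
      (mul_nonneg (h.m_nonneg 1) (h.A_nonneg 1 0))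
  have mB : 0 ≤ C.m 0 * C.B 0 1 + C.m 1 * C.B 1 0 := by
    exact add_nonneg (mul_nonneg (h.m_nonneg 0) (h.B_nonneg 0 1))
      (mul_nonneg (h.m_nonneg 1) (h.B_nonneg 1 0))
  have r4 : 0 ≤ r ^ 4 := by positivity
  have hx : 0 ≤ x.re ^ 2 + x.im ^ 2 := by positivity
  have hy : 0 ≤ y.re ^ 2 + y.im ^ 2 := by positivity
  have s : 0 ≤ (x.re + y.re) ^ 2 + (x.im + y.im) ^ 2 := by positivity
  have p1 := mul_le_mul_of_nonneg_right a0 (mul_nonneg r4 hx)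
  have p2 := mul_le_mul_of_nonneg_right a1 (mul_nonneg r4 hy)
  have p3 := mul_nonneg b0 (mul_nonneg (sq_nonneg r) hx)
  have p4 := mul_nonneg b1 (mul_nonneg (sq_nonneg r) hy)
  have p5 := mul_nonneg mA (mul_nonneg r4 s)
  have p6 := mul_nonneg mB (mul_nonneg (sq_nonneg r) s)
  ring_nf at *
  linarith

/-- The energy estimate in `Ḣ²`, together with a bound for the absolute values of all the terms
that occur in it. -/
lemma exists_energy_dissipation (h : C.Admissible E α β κ) : ∃ K, 0 ≤ K ∧
    ∀ (N : ℕ) (u : Fin 2 → ℤ → ℂ), IsTrig N u → ∑ i, W N 0 (u i) ≤ E →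
      ∑ i, ∑ k ∈ modes N, |(k : ℝ)| ^ 4 * (starRingEnd ℂ (u i k) * C.rhs u i k).re ≤
        -(κ / 2) * ∑ i, En N 8 (u i) + K * (∑ i, W N 0 (u i)) ^ 3 ∧
      ∑ i, ∑ k ∈ modes N, |(k : ℝ)| ^ 4 * (‖u i k‖ * ‖C.rhs u i k‖) ≤
        K * (∑ i, En N 8 (u i) + (∑ i, W N 0 (u i)) ^ 3) := by
  obtain ⟨K, hK, hKu⟩ := exists_sum_pow_mul_norm_conv_le h
  set M := ∑ i, ∑ j, (C.m i * (C.A i j + C.B i j)) with hM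
  set M' := ∑ i, (9 / 8 * ∑ j, C.A i j + 7 / 8 * ∑ j, C.A j i) * E with hM'
  have hMn : ∀ i j, 0 ≤ C.m i * (C.A i j + C.B i j) := fun i j =>
    mul_nonneg (h.m_nonneg i) (add_nonneg (h.A_nonneg i j) (h.B_nonneg i j))
  have hM0 : 0 ≤ M := Finset.sum_nonneg fun i _ => Finset.sum_nonneg fun j _ => hMn i j
  have hA0 : ∀ i, 0 ≤ (9 / 8 * ∑ j, C.A i j + 7 / 8 * ∑ j, C.A j i) * E := by
    intro i
    have := Finset.sum_nonneg fun j (_ : j ∈ Finset.univ) => h.A_nonneg i j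
    have := Finset.sum_nonneg fun j (_ : j ∈ Finset.univ) => h.A_nonneg j i
    have := h.E_nonneg
    positivity
  have hM0' : 0 ≤ M' := Finset.sum_nonneg fun i _ => hA0 i
  have hκ := h.κ_pos
  refine ⟨M + M' + κ + K, by positivity, fun N u hu hE => ?_⟩
  have hN := hKu N u hu hE
  set Φ := ∑ i, W N 0 (u i) with hΦ
  have hΦ0 : 0 ≤ Φ := Finset.sum_nonneg fun i _ => W_nonneg _ _ _
  set X := ∑ i, En N 8 (u i) with hX
  have hX0 : 0 ≤ X := Finset.sum_nonneg fun i _ => En_nonneg _ _ _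
  have hp : ∀ k : ℤ, |(k : ℝ)| ^ 4 * |(k : ℝ)| = |(k : ℝ)| ^ 5 := fun k => by ring
  have hcub : 0 ≤ Φ ^ 3 := by positivity
  have hE8 : ∀ i, En N 8 (u i) ≤ X := fun i =>
    Finset.single_le_sum (f := fun i => En N 8 (u i)) (fun i _ => En_nonneg _ _ _)
      (Finset.mem_univ i)
  clear_value Φ X M M'
  constructor
  · have h1 : ∑ i, ∑ k ∈ modes N, |(k : ℝ)| ^ 4 * (starRingEnd ℂ (u i k) * C.rhs u i k).re ≤
        ∑ k ∈ modes N, |(k : ℝ)| ^ 4 *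
          ∑ i, (starRingEnd ℂ (u i k) * (-(k : ℂ) * (C.m i * C.force u i k))).re +
        ∑ i, ∑ k ∈ modes N, |(k : ℝ)| ^ 5 * ‖u i k‖ * ‖C.conv u i k‖ := by
      simp only [Finset.mul_sum]
      rw [Finset.sum_comm (s := modes N), ← Finset.sum_add_distrib]
      refine Finset.sum_le_sum fun i _ => ?_
      rw [← Finset.sum_add_distrib]
      refine Finset.sum_le_sum fun k _ => ?_
      have h2 : starRingEnd ℂ (u i k) * C.rhs u i k =
          starRingEnd ℂ (u i k) * (-(k : ℂ) * (C.m i * C.force u i k)) +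
          starRingEnd ℂ (u i k) * (-(k : ℂ) * C.conv u i k) := by
        rw [rhs]; ring
      rw [h2, Complex.add_re, mul_add]
      have h3 : (starRingEnd ℂ (u i k) * (-(k : ℂ) * C.conv u i k)).re ≤
          |(k : ℝ)| * ‖u i k‖ * ‖C.conv u i k‖ := by
        refine (Complex.re_le_norm _).trans (le_of_eq ?_)
        rw [norm_mul, norm_mul, norm_neg, RCLike.norm_conj, Complex.norm_intCast]; ring
      have h4 := mul_le_mul_of_nonneg_left h3 (by positivity : 0 ≤ |(k : ℝ)| ^ 4)
      have h5 := hp k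
      rw [← h5]
      linarith
    have h2 : ∑ k ∈ modes N, |(k : ℝ)| ^ 4 *
          ∑ i, (starRingEnd ℂ (u i k) * (-(k : ℂ) * (C.m i * C.force u i k))).re ≤
        -∑ i, (κ + (9 / 8 * ∑ j, C.A i j + 7 / 8 * ∑ j, C.A j i) * E) * En N 8 (u i) := by
      refine (Finset.sum_le_sum fun k _ =>
        mul_le_mul_of_nonneg_left (linear_energy_le h u k) (by positivity)).trans (le_of_eq ?_)
      simp only [En, Finset.mul_sum, mul_neg, Finset.sum_neg_distrib]
      rw [Finset.sum_comm]
      congr 1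
      refine Finset.sum_congr rfl fun i _ => Finset.sum_congr rfl fun k _ => by ring
    have h3 : ∑ i, (κ + (9 / 8 * ∑ j, C.A i j + 7 / 8 * ∑ j, C.A j i) * E) * En N 8 (u i) =
        κ * X + ∑ i, (9 / 8 * ∑ j, C.A i j + 7 / 8 * ∑ j, C.A j i) * E * En N 8 (u i) := by
      simp only [hX, Finset.mul_sum, ← Finset.sum_add_distrib, add_mul]
    have h4 : 0 ≤ (M + M' + κ) * Φ ^ 3 := by positivity
    linarith
  · have h1 : ∑ i, ∑ k ∈ modes N, |(k : ℝ)| ^ 4 * (‖u i k‖ * ‖C.rhs u i k‖) ≤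
        ∑ i, ∑ k ∈ modes N, ∑ j, C.m i * (C.A i j + C.B i j) *
          ((|(k : ℝ)| ^ 8 * ‖u i k‖ ^ 2 + |(k : ℝ)| ^ 8 * ‖u j k‖ ^ 2) / 2) +
        ∑ i, ∑ k ∈ modes N, |(k : ℝ)| ^ 5 * ‖u i k‖ * ‖C.conv u i k‖ := by
      rw [← Finset.sum_add_distrib]
      refine Finset.sum_le_sum fun i _ => ?_
      rw [← Finset.sum_add_distrib]
      refine Finset.sum_le_sum fun k _ => ?_
      have hm : ‖(C.m i : ℂ)‖ = C.m i := by
        rw [Complex.norm_real, Real.norm_eq_abs, abs_of_nonneg (h.m_nonneg i)]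
      have h2 : ‖C.rhs u i k‖ ≤ |(k : ℝ)| * (C.m i * ∑ j, (C.A i j * |(k : ℝ)| ^ 3 +
          C.B i j * |(k : ℝ)|) * ‖u j k‖ + ‖C.conv u i k‖) := by
        rw [rhs, norm_mul, norm_neg, Complex.norm_intCast]
        refine mul_le_mul_of_nonneg_left ((norm_add_le _ _).trans ?_) (abs_nonneg _)
        rw [norm_mul, hm]
        have := mul_le_mul_of_nonneg_left (norm_force_le h u i k) (h.m_nonneg i)
        linarith
      have h3 := mul_le_mul_of_nonneg_left h2
        (by positivity : 0 ≤ |(k : ℝ)| ^ 4 * ‖u i k‖)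
      have h4 : ∀ j, |(k : ℝ)| ^ 4 * ‖u i k‖ * (|(k : ℝ)| * (C.m i *
          ((C.A i j * |(k : ℝ)| ^ 3 + C.B i j * |(k : ℝ)|) * ‖u j k‖))) ≤
          C.m i * (C.A i j + C.B i j) *
          ((|(k : ℝ)| ^ 8 * ‖u i k‖ ^ 2 + |(k : ℝ)| ^ 8 * ‖u j k‖ ^ 2) / 2) := by
        intro j
        rcases eq_or_ne k 0 with rfl | hk
        · simp
        have hk1 := one_le_abs_cast hk
        have q1 : |(k : ℝ)| ^ 6 ≤ |(k : ℝ)| ^ 8 := pow_le_pow_right₀ hk1 (by norm_num)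
        have q2 : ‖u i k‖ * ‖u j k‖ ≤ (‖u i k‖ ^ 2 + ‖u j k‖ ^ 2) / 2 := by
          nlinarith [sq_nonneg (‖u i k‖ - ‖u j k‖)]
        have q3 : C.m i * (C.A i j * |(k : ℝ)| ^ 8 + C.B i j * |(k : ℝ)| ^ 6) ≤
            C.m i * (C.A i j + C.B i j) * |(k : ℝ)| ^ 8 := by
          have := mul_le_mul_of_nonneg_left q1 (mul_nonneg (h.m_nonneg i) (h.B_nonneg i j))
          linarith
        have q4 := mul_le_mul q3 q2 (by positivity)
          (mul_nonneg (hMn i j) (by positivity))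
        linarith
      have h5 := Finset.sum_le_sum fun j (_ : j ∈ Finset.univ) => h4 j
      simp only [← Finset.mul_sum] at h5
      have h6 := hp k
      rw [← h6]
      linarith
    have h2 : ∑ i, ∑ k ∈ modes N, ∑ j, C.m i * (C.A i j + C.B i j) *
          ((|(k : ℝ)| ^ 8 * ‖u i k‖ ^ 2 + |(k : ℝ)| ^ 8 * ‖u j k‖ ^ 2) / 2) ≤ M * X := by
      rw [hM, Finset.sum_mul]
      refine Finset.sum_le_sum fun i _ => ?_
      rw [Finset.sum_comm, Finset.sum_mul]
      refine Finset.sum_le_sum fun j _ => ?_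
      rw [← Finset.mul_sum, ← Finset.sum_div, Finset.sum_add_distrib]
      refine mul_le_mul_of_nonneg_left ?_ (hMn i j)
      have := hE8 i
      have := hE8 j
      simp only [En] at *
      linarith
    have h3 : ∑ i, (9 / 8 * ∑ j, C.A i j + 7 / 8 * ∑ j, C.A j i) * E * En N 8 (u i) ≤ M' * X := by
      rw [hM', Finset.sum_mul]
      exact Finset.sum_le_sum fun i _ => mul_le_mul_of_nonneg_left (hE8 i) (hA0 i)
    have h4 : 0 ≤ (M + M' + κ) * Φ ^ 3 := by positivity
    have h5 : 0 ≤ K * X := by positivity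
    have h6 : 0 ≤ κ * X := by positivity
    linarith

end System

/-! ### Galerkin approximations -/

/-- The right derivative of `t ↦ ‖z t‖` at a point where `z` has the value `z` and the right
derivative `z'`. -/
noncomputable def normDeriv (z z' : ℂ) : ℝ :=
  if z = 0 then ‖z'‖ else (starRingEnd ℂ z * z').re / ‖z‖

lemma hasDerivWithinAt_norm {z : ℝ → ℂ} {z' : ℂ} {t : ℝ} (h : HasDerivWithinAt z z' (Ici t) t) :
    HasDerivWithinAt (fun s => ‖z s‖) (normDeriv (z t) z') (Ici t) t := by
  rcases eq_or_ne (z t) 0 with h0 | h0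
  · rw [normDeriv, if_pos h0]
    rw [hasDerivWithinAt_iff_tendsto_slope] at h ⊢
    refine h.norm.congr' ?_
    filter_upwards [self_mem_nhdsWithin] with s hs
    have hs' : t < s := lt_of_le_of_ne hs.1 fun h => hs.2 h.symm
    rw [slope_def_module, slope_def_module, h0, norm_smul, sub_zero, norm_zero, sub_zero,
      Real.norm_of_nonneg (inv_nonneg.2 (sub_nonneg.2 hs'.le)), smul_eq_mul]
  · rw [normDeriv, if_neg h0]
    have h1 : HasDerivWithinAt (fun s => ‖z s‖ ^ 2) (2 * (starRingEnd ℂ (z t) * z').re)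
        (Ici t) t := by
      have := h.norm_sq
      simpa [Complex.inner, mul_comm] using this
    have h2 := h1.sqrt (by simpa using h0)
    simp only [Real.sqrt_sq (norm_nonneg _)] at h2
    convert h2 using 1
    field_simp

lemma normDeriv_le {z z' w : ℂ} {a : ℝ} (h : z' = -(a : ℂ) * z + w) :
    normDeriv z z' ≤ -a * ‖z‖ + ‖w‖ := by
  rcases eq_or_ne z 0 with h0 | h0
  · rw [normDeriv, if_pos h0, h, h0]; simp
  · rw [normDeriv, if_neg h0, div_le_iff₀ (norm_pos_iff.2 h0), h]
    have h1 : starRingEnd ℂ z * (-(a : ℂ) * z + w) =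
        ((-a * ‖z‖ ^ 2 : ℝ) : ℂ) + starRingEnd ℂ z * w := by
      have := Complex.conj_mul' z
      push_cast
      rw [← this]; ring
    rw [h1, Complex.add_re, Complex.ofReal_re]
    have h2 : (starRingEnd ℂ z * w).re ≤ ‖z‖ * ‖w‖ := by
      refine (Complex.re_le_norm _).trans (le_of_eq ?_)
      rw [norm_mul, RCLike.norm_conj]
    nlinarith

/-- A `C¹` vector field on a finite dimensional space has, after multiplication with a cutoff
function, solutions on time intervals of any length. -/
lemma exists_ode_solution_cutoff {V : Type*} [NormedAddCommGroup V] [NormedSpace ℝ V]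
    [FiniteDimensional ℝ V] {F : V → V} (hF : ContDiff ℝ 1 F) (R : ℝ) (x₀ : V) {T : ℝ}
    (hT : 0 ≤ T) : ∃ χ : V → ℝ, (∀ v, ‖v‖ ≤ R → χ v = 1) ∧ ∃ α : ℝ → V, α 0 = x₀ ∧
      ∀ t ∈ Icc 0 T, HasDerivWithinAt α (χ (α t) • F (α t)) (Icc 0 T) t := by
  let χ : ContDiffBump (0 : V) := ⟨max R 1, max R 1 + 1, by positivity, by linarith⟩
  refine ⟨χ, fun v hv => χ.one_of_mem_closedBall ?_, ?_⟩
  · rw [mem_closedBall_zero_iff]; exact hv.trans (le_max_left _ _)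
  have hc : HasCompactSupport (fun v => χ v • F v) := χ.hasCompactSupport.smul_right
  have hd : ContDiff ℝ 1 (fun v => χ v • F v) := χ.contDiff.smul hF
  obtain ⟨K, hK⟩ := hd.lipschitzWith_of_hasCompactSupport hc one_ne_zero
  obtain ⟨L, hL⟩ := hc.exists_bound_of_continuous hd.continuous
  have hL0 : 0 ≤ L := (norm_nonneg _).trans (hL 0)
  have hPL : IsPicardLindelof (fun _ v => χ v • F v) (⟨0, left_mem_Icc.2 hT⟩ : Icc 0 T) x₀
      ⟨L * T, mul_nonneg hL0 hT⟩ 0 ⟨L, hL0⟩ K :=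
    { lipschitzOnWith := fun _ _ => hK.lipschitzOnWith
      continuousOn := fun _ _ => continuousOn_const
      norm_le := fun _ _ v _ => hL v
      mul_max_le := by
        simp only [sub_zero, sub_self, max_eq_left hT, NNReal.coe_zero]
        exact le_rfl }
  exact hPL.exists_eq_forall_mem_Icc_hasDerivWithinAt₀

/-- The state space of the Galerkin system: the Fourier coefficients with frequencies `1, …, N`. -/
abbrev Coords (N : ℕ) : Type := Fin 2 → Fin N → ℂ

/-- The sequence of Fourier coefficients of real functions with zero mean which is determined by its
entries with frequencies `1, …, N`. -/
noncomputable def extend {N : ℕ} (v : Coords N) (i : Fin 2) : ℤ → ℂ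
  | Int.ofNat 0 => 0
  | Int.ofNat (n + 1) => if h : n < N then v i ⟨n, h⟩ else 0
  | Int.negSucc n => starRingEnd ℂ (if h : n < N then v i ⟨n, h⟩ else 0)

lemma extend_natCast_succ {N : ℕ} (v : Coords N) (i : Fin 2) (n : Fin N) :
    extend v i ((n : ℤ) + 1) = v i n := by
  change extend v i (Int.ofNat (n + 1)) = _
  simp [extend]

lemma isTrig_extend {N : ℕ} (v : Coords N) : IsTrig N (extend v) where
  supp i k hk := by
    rw [mem_modes] at hk
    match k with
    | Int.ofNat 0 => rfl
    | Int.ofNat (n + 1) =>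
      have : ¬ n < N := fun h => hk (by
        change |((n + 1 : ℕ) : ℤ)| ≤ N
        rw [abs_of_nonneg (Int.natCast_nonneg _)]; omega)
      simp [extend, this]
    | Int.negSucc n =>
      have : ¬ n < N := fun h => hk (by
        rw [abs_of_neg (Int.negSucc_lt_zero n), Int.neg_negSucc]; simp; omega)
      simp [extend, this]
  zero i := rfl
  symm i k := by
    match k with
    | Int.ofNat 0 => simp [extend]
    | Int.ofNat (n + 1) => rfl
    | Int.negSucc n =>
      change extend v i (Int.ofNat (n + 1)) = _
      simp [extend]

lemma IsTrig.eq_extend {N : ℕ} {u : Fin 2 → ℤ → ℂ} (hu : IsTrig N u) :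
    extend (fun i (n : Fin N) => u i ((n : ℤ) + 1)) = u := by
  have hE := isTrig_extend (fun i (n : Fin N) => u i ((n : ℤ) + 1))
  have hpos : ∀ (i : Fin 2) (n : ℕ), extend (fun i (n : Fin N) => u i ((n : ℤ) + 1)) i
      ((n : ℤ) + 1) = u i ((n : ℤ) + 1) := by
    intro i n
    by_cases h : n < N
    · exact extend_natCast_succ _ i ⟨n, h⟩
    · have : ((n : ℤ) + 1) ∉ modes N := by
        rw [mem_modes, abs_of_nonneg (by positivity)]; omega
      rw [hu.supp i _ this, hE.supp i _ this]
  funext i k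
  rcases lt_trichotomy k 0 with hk | rfl | hk
  · obtain ⟨n, hn⟩ : ∃ n : ℕ, k = -((n : ℤ) + 1) := ⟨(-k - 1).toNat, by omega⟩
    rw [hn, hu.symm, hE.symm, hpos]
  · rw [hE.zero, hu.zero]
  · obtain ⟨n, hn⟩ : ∃ n : ℕ, k = (n : ℤ) + 1 := ⟨(k - 1).toNat, by omega⟩
    rw [hn, hpos]

lemma contDiff_extend {N : ℕ} (i : Fin 2) (k : ℤ) :
    ContDiff ℝ 1 (fun v : Coords N => extend v i k) := by
  have h : ∀ n : ℕ, ContDiff ℝ 1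
      (fun v : Coords N => if h : n < N then v i ⟨n, h⟩ else 0) := by
    intro n
    split_ifs with h
    · exact contDiff_apply_apply ℝ ℂ i (⟨n, h⟩ : Fin N)
    · exact contDiff_const
  match k with
  | Int.ofNat 0 => exact contDiff_const
  | Int.ofNat (n + 1) => exact h n
  | Int.negSucc n => exact (Complex.conjCLE : ℂ ≃L[ℝ] ℂ).contDiff.comp (h n)

lemma norm_le_of_sum_extend_le {N : ℕ} (v : Coords N) {R : ℝ} (h : ∑ i, W N 0 (extend v i) ≤ R) :
    ‖v‖ ≤ R := by
  have hR : 0 ≤ R := (Finset.sum_nonneg fun i _ => W_nonneg _ _ _).trans h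
  refine (pi_norm_le_iff_of_nonneg hR).2 fun i => (pi_norm_le_iff_of_nonneg hR).2 fun n => ?_
  rw [← extend_natCast_succ v i n]
  have h1 : ‖extend v i ((n : ℤ) + 1)‖ ≤ W N 0 (extend v i) := by
    have := Finset.single_le_sum (f := fun k : ℤ => |(k : ℝ)| ^ 0 * ‖extend v i k‖)
      (s := modes N) (fun k _ => by positivity) (a := (n : ℤ) + 1)
      (by rw [mem_modes, abs_of_nonneg (by positivity)]; omega)
    simpa [W] using this
  exact (h1.trans (Finset.single_le_sum (f := fun i => W N 0 (extend v i))
    (fun i _ => W_nonneg _ _ _) (Finset.mem_univ i))).trans h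

namespace System

variable {C : System} {E α β κ : ℝ}

lemma force_neg {u : Fin 2 → ℤ → ℂ} (hu : ∀ i k, u i (-k) = starRingEnd ℂ (u i k))
    (i : Fin 2) (k : ℤ) : C.force u i (-k) = -starRingEnd ℂ (C.force u i k) := by
  simp only [force, map_sum, map_mul, Complex.conj_ofReal, hu, ← Finset.sum_neg_distrib]
  refine Finset.sum_congr rfl fun j _ => ?_
  push_cast; ring

lemma conv_neg {u : Fin 2 → ℤ → ℂ} (hu : ∀ i k, u i (-k) = starRingEnd ℂ (u i k))
    (i : Fin 2) (k : ℤ) : C.conv u i (-k) = -starRingEnd ℂ (C.conv u i k) := by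
  rw [conv, conv, Complex.conj_tsum, ← (Equiv.neg ℤ).tsum_eq, ← tsum_neg]
  refine tsum_congr fun l => ?_
  rw [Equiv.neg_apply, map_mul, hu, show -k - -l = -(k - l) by ring, force_neg hu]
  ring

/-- The system preserves real valued functions. -/
lemma rhs_neg {u : Fin 2 → ℤ → ℂ} (hu : ∀ i k, u i (-k) = starRingEnd ℂ (u i k))
    (i : Fin 2) (k : ℤ) : C.rhs u i (-k) = starRingEnd ℂ (C.rhs u i k) := by
  rw [rhs, rhs, force_neg hu, conv_neg hu]
  simp only [map_mul, map_neg, map_add, Complex.conj_ofReal, map_intCast]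
  push_cast; ring

lemma contDiff_force {N : ℕ} (i : Fin 2) (k : ℤ) :
    ContDiff ℝ 1 (fun v : Coords N => C.force (extend v) i k) :=
  ContDiff.sum fun j _ => contDiff_const.mul (contDiff_extend j k)

lemma contDiff_rhs {N : ℕ} (i : Fin 2) (k : ℤ) :
    ContDiff ℝ 1 (fun v : Coords N => C.rhs (extend v) i k) := by
  have : (fun v : Coords N => C.rhs (extend v) i k) = fun v => -(k : ℂ) *
      (C.m i * C.force (extend v) i k +
        ∑ l ∈ modes N, extend v i l * C.force (extend v) i (k - l)) := by
    funext v
    rw [rhs, conv_eq_sum (isTrig_extend v)]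
  rw [this]
  exact contDiff_const.mul ((contDiff_const.mul (contDiff_force i k)).add
    (ContDiff.sum fun l _ => (contDiff_extend i l).mul (contDiff_force i (k - l))))

lemma normDeriv_rhs_le (h : C.Admissible E α β κ) (u : Fin 2 → ℤ → ℂ) (i : Fin 2) (k : ℤ) :
    normDeriv (u i k) (C.rhs u i k) ≤
      -(C.m i * (C.A i i * |(k : ℝ)| ^ 4 + C.B i i * |(k : ℝ)| ^ 2) * ‖u i k‖) +
        C.m i * (C.A i (i + 1) * |(k : ℝ)| ^ 4 + C.B i (i + 1) * |(k : ℝ)| ^ 2) * ‖u (i + 1) k‖ +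
        |(k : ℝ)| * ‖C.conv u i k‖ := by
  have n1 : |(k : ℝ)| ^ 4 = (k : ℝ) ^ 4 := by
    rw [show (4:ℕ) = 2 * 2 from rfl, pow_mul, pow_mul, sq_abs]
  have e : C.rhs u i k =
      -((C.m i * (C.A i i * |(k : ℝ)| ^ 4 + C.B i i * |(k : ℝ)| ^ 2) : ℝ) : ℂ) * u i k +
      (-((C.m i * (C.A i (i + 1) * |(k : ℝ)| ^ 4 + C.B i (i + 1) * |(k : ℝ)| ^ 2) : ℝ) : ℂ) *
        u (i + 1) k + -((k : ℝ) : ℂ) * C.conv u i k) := by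
    rw [n1, sq_abs, rhs, force]
    fin_cases i <;> simp [Fin.sum_univ_two] <;> ring
  refine (normDeriv_le e).trans ?_
  rw [neg_mul, add_assoc]
  refine add_le_add le_rfl ((norm_add_le _ _).trans (le_of_eq ?_))
  have h1 : 0 ≤ C.m i * (C.A i (i + 1) * |(k : ℝ)| ^ 4 + C.B i (i + 1) * |(k : ℝ)| ^ 2) := by
    have := h.m_nonneg i
    have := h.A_nonneg i (i + 1)
    have := h.B_nonneg i (i + 1)
    positivity
  rw [norm_mul, norm_mul, norm_neg, norm_neg, Complex.norm_real, Complex.norm_real,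
    Real.norm_of_nonneg h1, Real.norm_eq_abs]

lemma rhs_zero (i : Fin 2) (k : ℤ) : C.rhs (fun _ _ => 0) i k = 0 := by
  simp [rhs, force, conv]

end System

/-- The function `u` solves the Galerkin system of order `N` on `[0,T]`: the projection of the
system onto trigonometric polynomials of degree at most `N`. -/
structure IsGalerkin (C : System) (N : ℕ) (T : ℝ) (u : ℝ → Fin 2 → ℤ → ℂ) : Prop where
  trig : ∀ t, IsTrig N (u t)
  deriv : ∀ t ∈ Icc 0 T, ∀ i, ∀ k ∈ modes N,
    HasDerivWithinAt (fun s => u s i k) (C.rhs (u t) i k) (Icc 0 T) t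

lemma hasDerivWithinAt_sum_norm {N : ℕ} {u : ℝ → Fin 2 → ℤ → ℂ} {u' : Fin 2 → ℤ → ℂ} {t : ℝ}
    (h : ∀ i, ∀ k ∈ modes N, HasDerivWithinAt (fun s => u s i k) (u' i k) (Ici t) t) :
    HasDerivWithinAt (fun s => ∑ i, W N 0 (u s i))
      (∑ i, ∑ k ∈ modes N, normDeriv (u t i k) (u' i k)) (Ici t) t := by
  simp only [W, pow_zero, one_mul]
  exact HasDerivWithinAt.fun_sum fun i _ => HasDerivWithinAt.fun_sum fun k hk =>
    hasDerivWithinAt_norm (h i k hk)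

lemma Icc_mem_nhdsWithin_Ici {T t : ℝ} (ht : t ∈ Ico 0 T) : Icc 0 T ∈ 𝓝[≥] t :=
  Icc_mem_nhdsGE_of_mem ht

/-- The Galerkin approximations exist on every time interval, and decay exponentially in the Wiener
algebra. -/
theorem exists_galerkin {C : System} {E α β κ : ℝ} (h : C.Admissible E α β κ) {r : ℝ}
    (hr : r < α + β) {N : ℕ} {a : Fin 2 → ℤ → ℂ} (ha : IsTrig N a)
    (haE : ∑ i, W N 0 (a i) ≤ E) {T : ℝ} (hT : 0 ≤ T) :
    ∃ u, IsGalerkin C N T u ∧ u 0 = a ∧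
      ∀ t ∈ Icc 0 T, ∑ i, W N 0 (u t i) ≤ E * Real.exp (-r * t) := by
  rcases h.E_nonneg.eq_or_lt with hE0 | hEpos
  · have ha0 : a = fun _ _ => 0 := by
      rw [← hE0] at haE
      have h1 := (Finset.sum_eq_zero_iff_of_nonneg fun i _ => W_nonneg N 0 (a i)).1
        (le_antisymm haE (Finset.sum_nonneg fun i _ => W_nonneg _ _ _))
      funext i k
      by_cases hk : k ∈ modes N
      · have h2 := (Finset.sum_eq_zero_iff_of_nonneg (fun k _ => by positivity)).1
          (h1 i (Finset.mem_univ i)) k hk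
        simpa using h2
      · exact ha.supp i k hk
    refine ⟨fun _ => a, ⟨fun _ => ha, fun t _ i k _ => ?_⟩, rfl, fun t _ => ?_⟩
    · rw [ha0, System.rhs_zero]; exact hasDerivWithinAt_const _ _ _
    · rw [← hE0] at haE ⊢; simpa using haE
  set r' := max r 0 with hr'
  have hαβ : 0 < α + β := add_pos_of_pos_of_nonneg h.α_pos h.β_nonneg
  have hr1 : r' < α + β := max_lt hr hαβ
  obtain ⟨χ, hχ, v, hv0, hv⟩ := exists_ode_solution_cutoff
    (F := fun v : Coords N => fun i (n : Fin N) => C.rhs (extend v) i ((n : ℤ) + 1))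
    (contDiff_pi.2 fun i => contDiff_pi.2 fun n => System.contDiff_rhs i _) E
    (fun i (n : Fin N) => a i ((n : ℤ) + 1)) hT
  have hu : ∀ t ∈ Icc 0 T, ∀ i, ∀ k ∈ modes N, HasDerivWithinAt (fun s => extend (v s) i k)
      (χ (v t) * C.rhs (extend (v t)) i k) (Icc 0 T) t := by
    intro t ht i k hk
    have hpos : ∀ n : ℕ, n < N → HasDerivWithinAt (fun s => extend (v s) i ((n : ℤ) + 1))
        (χ (v t) * C.rhs (extend (v t)) i ((n : ℤ) + 1)) (Icc 0 T) t := by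
      intro n hn
      have h1 := hasDerivWithinAt_pi.1 (hasDerivWithinAt_pi.1 (hv t ht) i) ⟨n, hn⟩
      have h2 : (fun s => extend (v s) i ((n : ℤ) + 1)) = fun s => v s i ⟨n, hn⟩ := by
        funext s; exact extend_natCast_succ (v s) i ⟨n, hn⟩
      rw [h2]
      simpa using h1
    rw [mem_modes] at hk
    rcases lt_trichotomy k 0 with hk0 | rfl | hk0
    · obtain ⟨n, hn⟩ : ∃ n : ℕ, k = -((n : ℤ) + 1) := ⟨(-k - 1).toNat, by omega⟩
      have h1 := hpos n (by rw [hn, abs_neg, abs_of_nonneg (by positivity)] at hk; omega)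
      have h2 := (Complex.conjCLE : ℂ ≃L[ℝ] ℂ).toContinuousLinearMap.hasFDerivAt.comp_hasDerivWithinAt
        t h1
      rw [hn, System.rhs_neg (isTrig_extend _).symm]
      simp only [(isTrig_extend _).symm]
      simpa [Function.comp_def] using h2
    · simp only [(isTrig_extend _).zero, System.rhs]
      simpa using hasDerivWithinAt_const t (Icc 0 T) (0 : ℂ)
    · obtain ⟨n, hn⟩ : ∃ n : ℕ, k = (n : ℤ) + 1 := ⟨(k - 1).toNat, by omega⟩
      rw [hn]
      exact hpos n (by rw [hn, abs_of_nonneg (by positivity)] at hk; omega)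
  have hbound : ∀ t ∈ Icc 0 T, ∑ i, W N 0 (extend (v t) i) ≤ E * Real.exp (-r' * t) := by
    have hcont : ContinuousOn (fun t => ∑ i, W N 0 (extend (v t) i)) (Icc 0 T) := by
      simp only [W]
      exact continuousOn_finsetSum _ fun i _ => continuousOn_finsetSum _ fun k hk =>
        continuousOn_const.mul (fun t ht => (hu t ht i k hk).continuousWithinAt.norm)
    have hB : ∀ t, HasDerivAt (fun t => E * Real.exp (-r' * t))
        (E * (Real.exp (-r' * t) * -r')) t := by
      intro t
      have := ((hasDerivAt_id t).const_mul (-r')).exp.const_mul E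
      simpa using this
    refine image_le_of_deriv_right_lt_deriv_boundary hcont
      (f' := fun t => ∑ i, ∑ k ∈ modes N,
        normDeriv (extend (v t) i k) (χ (v t) * C.rhs (extend (v t)) i k))
      (fun t ht => hasDerivWithinAt_sum_norm fun i k hk =>
        (hu t (Ico_subset_Icc_self ht) i k hk).mono_of_mem_nhdsWithin
          (Icc_mem_nhdsWithin_Ici ht)) ?_ hB ?_
    · rw [hv0, ha.eq_extend]; simpa using haE
    · intro t ht heq
      have hpos : 0 < E * Real.exp (-r' * t) := by positivity
      have hle : ∑ i, W N 0 (extend (v t) i) ≤ E := by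
        rw [heq]
        refine mul_le_of_le_one_right hEpos.le (Real.exp_le_one_iff.2 ?_)
        have := mul_nonneg (le_max_right r 0) ht.1
        rw [← hr'] at this
        linarith
      have hχ1 : χ (v t) = 1 := hχ _ (norm_le_of_sum_extend_le _ hle)
      simp only [hχ1, Complex.ofReal_one, one_mul]
      have hd := System.wiener_dissipation h (isTrig_extend (v t)) hle
      have hs : ∑ i, ∑ k ∈ modes N,
          normDeriv (extend (v t) i k) (C.rhs (extend (v t)) i k) ≤ _ :=
        (Finset.sum_le_sum fun i _ => Finset.sum_le_sum fun k _ =>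
          System.normDeriv_rhs_le h (extend (v t)) i k).trans hd
      have m4 := Finset.sum_le_sum fun i (_ : i ∈ Finset.univ) =>
        W_mono ((isTrig_extend (v t)).zero i) N (Nat.zero_le 4)
      have m2 := Finset.sum_le_sum fun i (_ : i ∈ Finset.univ) =>
        W_mono ((isTrig_extend (v t)).zero i) N (Nat.zero_le 2)
      rw [heq] at m4 m2
      have k1 := mul_le_mul_of_nonneg_left m4 h.α_pos.le
      have k2 := mul_le_mul_of_nonneg_left m2 h.β_nonneg
      have k3 := mul_lt_mul_of_pos_right hr1 hpos
      linarith
  refine ⟨fun t => extend (v t), ⟨fun t => isTrig_extend _, fun t ht i k hk => ?_⟩, ?_,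
    fun t ht => (hbound t ht).trans ?_⟩
  · have hle : ∑ i, W N 0 (extend (v t) i) ≤ E := by
      refine (hbound t ht).trans (mul_le_of_le_one_right hEpos.le (Real.exp_le_one_iff.2 ?_))
      have := mul_nonneg (le_max_right r 0) ht.1
      rw [← hr'] at this
      linarith
    simpa [hχ _ (norm_le_of_sum_extend_le _ hle)] using hu t ht i k hk
  · change extend (v 0) = a
    rw [hv0, ha.eq_extend]
  · refine mul_le_mul_of_nonneg_left (Real.exp_le_exp.2 ?_) hEpos.le
    have := mul_le_mul_of_nonneg_right (le_max_left r 0) ht.1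
    rw [← hr'] at this
    linarith

/-! ### Uniform bounds for the Galerkin approximations -/

section Bounds

variable {C : System} {N : ℕ} {T : ℝ} {u : ℝ → Fin 2 → ℤ → ℂ}

lemma IsGalerkin.continuousOn (hu : IsGalerkin C N T u) (i : Fin 2) (k : ℤ) :
    ContinuousOn (fun t => u t i k) (Icc 0 T) := by
  by_cases hk : k ∈ modes N
  · exact fun t ht => (hu.deriv t ht i k hk).continuousWithinAt
  · have : (fun t => u t i k) = fun _ => 0 := funext fun t => (hu.trig t).supp i k hk
    rw [this]; exact continuousOn_const

lemma IsGalerkin.continuousOn_W (hu : IsGalerkin C N T u) (s : ℕ) :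
    ContinuousOn (fun t => ∑ i, W N s (u t i)) (Icc 0 T) := by
  simp only [W]
  exact continuousOn_finsetSum _ fun i _ => continuousOn_finsetSum _ fun k _ =>
    continuousOn_const.mul (hu.continuousOn i k).norm

lemma IsGalerkin.continuousOn_En (hu : IsGalerkin C N T u) (s : ℕ) :
    ContinuousOn (fun t => ∑ i, En N s (u t i)) (Icc 0 T) := by
  simp only [En]
  exact continuousOn_finsetSum _ fun i _ => continuousOn_finsetSum _ fun k _ =>
    continuousOn_const.mul ((hu.continuousOn i k).norm.pow 2)

lemma IsGalerkin.hasDerivWithinAt_En (hu : IsGalerkin C N T u) (s : ℕ) {t : ℝ}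
    (ht : t ∈ Icc 0 T) :
    HasDerivWithinAt (fun t => ∑ i, En N s (u t i))
      (2 * ∑ i, ∑ k ∈ modes N, |(k : ℝ)| ^ s * (starRingEnd ℂ (u t i k) * C.rhs (u t) i k).re)
      (Icc 0 T) t := by
  simp only [En, Finset.mul_sum]
  refine HasDerivWithinAt.fun_sum fun i _ => HasDerivWithinAt.fun_sum fun k hk => ?_
  have h1 := ((hu.deriv t ht i k hk).norm_sq).const_mul (|(k : ℝ)| ^ s)
  have h2 : 2 * (|(k : ℝ)| ^ s * (starRingEnd ℂ (u t i k) * C.rhs (u t) i k).re) =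
      |(k : ℝ)| ^ s * (2 * inner ℝ (u t i k) (C.rhs (u t) i k)) := by
    rw [Complex.inner, mul_comm (starRingEnd ℂ (u t i k))]; ring
  rw [h2]
  exact h1

variable {E α β κ r : ℝ}

/-- Exponential decay makes the bound of the Wiener size global. -/
lemma wiener_le_of_decay (h : C.Admissible E α β κ) (hr : 0 < r) {t : ℝ} (ht : 0 ≤ t)
    {x : ℝ} (hx : x ≤ E * Real.exp (-r * t)) : x ≤ E :=
  hx.trans (mul_le_of_le_one_right h.E_nonneg (Real.exp_le_one_iff.2 (by nlinarith)))

lemma IsGalerkin.integral_W_four_le (h : C.Admissible E α β κ) (hu : IsGalerkin C N T u)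
    (hT : 0 ≤ T) (hE : ∀ t ∈ Icc 0 T, ∑ i, W N 0 (u t i) ≤ E) :
    ∫ t in (0)..T, ∑ i, W N 4 (u t i) ≤ E / α := by
  have hint : ContinuousOn (fun t => -α * ∑ i, W N 4 (u t i)) (Icc 0 T) :=
    continuousOn_const.mul (hu.continuousOn_W 4)
  have key := intervalIntegral.sub_le_integral_of_hasDeriv_right_of_le_Ico hT (hu.continuousOn_W 0)
    (fun t ht => (hasDerivWithinAt_sum_norm (u' := fun i k => C.rhs (u t) i k) fun i k hk =>
      (hu.deriv t (Ico_subset_Icc_self ht) i k hk).mono_of_mem_nhdsWithin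
        (Icc_mem_nhdsWithin_Ici ht)).mono Ioi_subset_Ici_self)
    hint.integrableOn_Icc (fun t ht => by
      have ht' := Ico_subset_Icc_self ht
      have hd := System.wiener_dissipation h (hu.trig t) (hE t ht')
      have hs : ∑ i, ∑ k ∈ modes N, normDeriv (u t i k) (C.rhs (u t) i k) ≤ _ :=
        (Finset.sum_le_sum fun i _ => Finset.sum_le_sum fun k _ =>
          System.normDeriv_rhs_le h (u t) i k).trans hd
      have : 0 ≤ β * ∑ i, W N 2 (u t i) :=
        mul_nonneg h.β_nonneg (Finset.sum_nonneg fun i _ => W_nonneg _ _ _)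
      linarith)
  rw [intervalIntegral.integral_const_mul] at key
  have h0 : 0 ≤ ∑ i, W N 0 (u T i) := Finset.sum_nonneg fun i _ => W_nonneg _ _ _
  have h1 := hE 0 (left_mem_Icc.2 hT)
  rw [le_div_iff₀ h.α_pos]
  linarith

/-- The energy estimate, integrated in time. -/
lemma exists_energy_bounds (h : C.Admissible E α β κ) (hr : 0 < r) (M₀ : ℝ) (hM₀ : 0 ≤ M₀) :
    ∃ M γ, 0 < M ∧ 0 < γ ∧ ∀ (N : ℕ) (T : ℝ) (u : ℝ → Fin 2 → ℤ → ℂ), 0 ≤ T →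
      IsGalerkin C N T u → (∀ t ∈ Icc 0 T, ∑ i, W N 0 (u t i) ≤ E * Real.exp (-r * t)) →
      ∑ i, En N 4 (u 0 i) ≤ M₀ →
      (∀ t ∈ Icc 0 T, ∑ i, En N 4 (u t i) ≤ M * Real.exp (-γ * t)) ∧
      (∀ t ∈ Icc 0 T, ∫ s in (0)..t, ∑ i, W N 4 (u s i) ≤ M) ∧
      (∀ t ∈ Icc 0 T, ∫ s in (0)..t, ∑ i, En N 8 (u s i) ≤ M) ∧
      (∀ s ∈ Icc 0 T, ∑ i, ∑ k ∈ modes N, |(k : ℝ)| ^ 4 * (‖u s i k‖ * ‖C.rhs (u s) i k‖) ≤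
        M * (∑ i, En N 8 (u s i) + 1)) := by
  obtain ⟨K, hK, hKu⟩ := System.exists_energy_dissipation h
  have hκ := h.κ_pos
  have hE0 := h.E_nonneg
  have hα := h.α_pos
  set D := K * E ^ 3 with hD
  have hD0 : 0 ≤ D := by positivity
  set M₁ := M₀ + D / r with hM₁
  have hM₁0 : 0 ≤ M₁ := by positivity
  refine ⟨M₁ + M₁ / κ + E / α + K + D + 1, min κ r, by positivity, lt_min hκ hr,
    fun N T u hT hu hW h0 => ?_⟩
  have hWE : ∀ t ∈ Icc 0 T, ∑ i, W N 0 (u t i) ≤ E := fun t ht =>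
    wiener_le_of_decay h hr ht.1 (hW t ht)
  have hΦ3 : ∀ t ∈ Icc 0 T, K * (∑ i, W N 0 (u t i)) ^ 3 ≤ D * Real.exp (-(3 * r) * t) := by
    intro t ht
    have h1 := pow_le_pow_left₀ (Finset.sum_nonneg fun i _ => W_nonneg N 0 (u t i)) (hW t ht) 3
    have h2 := mul_le_mul_of_nonneg_left h1 hK
    refine h2.trans (le_of_eq ?_)
    rw [hD, mul_pow, ← Real.exp_nat_mul]
    rw [show ((3 : ℕ) : ℝ) * (-r * t) = -(3 * r) * t by push_cast; ring]
    ring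
  have hder : ∀ t ∈ Icc 0 T, 2 * ∑ i, ∑ k ∈ modes N, |(k : ℝ)| ^ 4 *
      (starRingEnd ℂ (u t i k) * C.rhs (u t) i k).re ≤
      -κ * ∑ i, En N 8 (u t i) + 2 * D * Real.exp (-(3 * r) * t) := by
    intro t ht
    have h1 := (hKu N (u t) (hu.trig t) (hWE t ht)).1
    have h2 := hΦ3 t ht
    linarith
  have hright : ∀ t ∈ Ico 0 T, HasDerivWithinAt (fun t => ∑ i, En N 4 (u t i))
      (2 * ∑ i, ∑ k ∈ modes N, |(k : ℝ)| ^ 4 * (starRingEnd ℂ (u t i k) * C.rhs (u t) i k).re)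
      (Ioi t) t := fun t ht =>
    ((hu.hasDerivWithinAt_En 4 (Ico_subset_Icc_self ht)).mono_of_mem_nhdsWithin
        (Icc_mem_nhdsWithin_Ici ht)).mono Ioi_subset_Ici_self
  have hexp : ∀ c t : ℝ, HasDerivAt (fun t => Real.exp (c * t)) (c * Real.exp (c * t)) t := by
    intro c t
    have := ((hasDerivAt_id t).const_mul c).exp
    simpa [mul_comm] using this
  have hnn : 0 ≤ M₁ / κ := by positivity
  have hnn2 : 0 ≤ E / α := by positivity
  have hE84 : ∀ t, ∑ i, En N 4 (u t i) ≤ ∑ i, En N 8 (u t i) := fun t =>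
    Finset.sum_le_sum fun i _ => En_mono ((hu.trig t).zero i) N (by norm_num)
  have hE4n : ∀ t, 0 ≤ ∑ i, En N 4 (u t i) := fun t =>
    Finset.sum_nonneg fun i _ => En_nonneg _ _ _
  have hE8n : ∀ t, 0 ≤ ∑ i, En N 8 (u t i) := fun t =>
    Finset.sum_nonneg fun i _ => En_nonneg _ _ _
  refine ⟨fun t ht => ?_, fun t ht => ?_, fun t ht => ?_, fun t ht => ?_⟩
  · set γ := min κ r with hγ
    have hγκ : γ ≤ κ := min_le_left _ _
    have hγr : γ ≤ r := min_le_right _ _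
    -- The functional `exp (γ t) E₂ + (D / r) exp (- 2 r t)` is nonincreasing.
    have key := intervalIntegral.sub_le_integral_of_hasDeriv_right_of_le_Ico (a := 0) (b := t)
      (g := fun t => Real.exp (γ * t) * ∑ i, En N 4 (u t i) + D / r * Real.exp (-(2 * r) * t))
      (g' := fun t => γ * Real.exp (γ * t) * ∑ i, En N 4 (u t i) + Real.exp (γ * t) *
        (2 * ∑ i, ∑ k ∈ modes N, |(k : ℝ)| ^ 4 *
          (starRingEnd ℂ (u t i k) * C.rhs (u t) i k).re) +
        D / r * (-(2 * r) * Real.exp (-(2 * r) * t)))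
      (φ := fun _ => 0) ht.1
      (((by fun_prop : Continuous fun t => Real.exp (γ * t)).continuousOn.mul
        ((hu.continuousOn_En 4).mono (Icc_subset_Icc_right ht.2))).add
        (by fun_prop : Continuous fun t => D / r * Real.exp (-(2 * r) * t)).continuousOn)
      (fun s hs => (((hexp γ s).hasDerivWithinAt.mul
        (hright s ⟨hs.1, hs.2.trans_le ht.2⟩)).add
        ((hexp (-(2 * r)) s).const_mul (D / r)).hasDerivWithinAt))
      (integrableOn_const (by simp)) (fun s hs => by
        have hs' : s ∈ Icc 0 T := ⟨hs.1, hs.2.le.trans ht.2⟩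
        have h1 := hder s hs'
        have hep := Real.exp_pos (γ * s)
        have h2 := mul_le_mul_of_nonneg_left h1 hep.le
        have h3 : D / r * (-(2 * r) * Real.exp (-(2 * r) * s)) =
            -(2 * D * Real.exp (-(2 * r) * s)) := by field_simp
        have h4 : Real.exp (γ * s) * Real.exp (-(3 * r) * s) ≤ Real.exp (-(2 * r) * s) := by
          rw [← Real.exp_add]
          refine Real.exp_le_exp.2 ?_
          nlinarith [mul_le_mul_of_nonneg_right hγr hs.1]
        have h5 := mul_le_mul_of_nonneg_left h4 (by positivity : 0 ≤ 2 * D)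
        have h6 : γ * ∑ i, En N 4 (u s i) ≤ κ * ∑ i, En N 8 (u s i) :=
          mul_le_mul hγκ (hE84 s) (hE4n s) hκ.le
        have h7 := mul_le_mul_of_nonneg_left h6 hep.le
        rw [h3]
        linarith)
    simp only [intervalIntegral.integral_zero, mul_zero, Real.exp_zero, one_mul, mul_one] at key
    have h1 : 0 ≤ D / r * Real.exp (-(2 * r) * t) := by positivity
    have h2 : Real.exp (γ * t) * ∑ i, En N 4 (u t i) ≤ M₁ := by linarith
    have h3 : ∑ i, En N 4 (u t i) ≤ M₁ * Real.exp (-γ * t) := by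
      rw [neg_mul, Real.exp_neg, ← div_eq_mul_inv, le_div_iff₀ (Real.exp_pos _)]
      linarith
    refine h3.trans (mul_le_mul_of_nonneg_right ?_ (Real.exp_pos _).le)
    linarith
  · have hut : IsGalerkin C N t u := ⟨hu.trig, fun s hs i k hk =>
      (hu.deriv s (Icc_subset_Icc_right ht.2 hs) i k hk).mono (Icc_subset_Icc_right ht.2)⟩
    have := hut.integral_W_four_le h ht.1 (fun s hs => hWE s (Icc_subset_Icc_right ht.2 hs))
    linarith
  · have key := intervalIntegral.sub_le_integral_of_hasDeriv_right_of_le_Ico (a := 0) (b := t)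
      (g := fun t => ∑ i, En N 4 (u t i) + D / r * Real.exp (-(3 * r) * t))
      (g' := fun t => (2 * ∑ i, ∑ k ∈ modes N, |(k : ℝ)| ^ 4 *
          (starRingEnd ℂ (u t i k) * C.rhs (u t) i k).re) +
        D / r * (-(3 * r) * Real.exp (-(3 * r) * t)))
      (φ := fun t => -κ * ∑ i, En N 8 (u t i)) ht.1
      (((hu.continuousOn_En 4).mono (Icc_subset_Icc_right ht.2)).add
        (by fun_prop : Continuous fun t => D / r * Real.exp (-(3 * r) * t)).continuousOn)
      (fun s hs => (hright s ⟨hs.1, hs.2.trans_le ht.2⟩).add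
        ((hexp (-(3 * r)) s).const_mul (D / r)).hasDerivWithinAt)
      (continuousOn_const.mul ((hu.continuousOn_En 8).mono
        (Icc_subset_Icc_right ht.2))).integrableOn_Icc (fun s hs => by
        have hs' : s ∈ Icc 0 T := ⟨hs.1, hs.2.le.trans ht.2⟩
        have h1 := hder s hs'
        have h3 : D / r * (-(3 * r) * Real.exp (-(3 * r) * s)) =
            -(3 * D * Real.exp (-(3 * r) * s)) := by field_simp
        have h4 : 0 ≤ D * Real.exp (-(3 * r) * s) := by positivity
        rw [h3]
        linarith)
    rw [intervalIntegral.integral_const_mul] at key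
    simp only [mul_zero, Real.exp_zero, mul_one] at key
    have h1 : 0 ≤ D / r * Real.exp (-(3 * r) * t) := by positivity
    have h2 := hE4n t
    have h3 : ∫ s in (0)..t, ∑ i, En N 8 (u s i) ≤ M₁ / κ := by
      rw [le_div_iff₀ hκ]; linarith
    linarith
  · have h1 := (hKu N (u t) (hu.trig t) (hWE t ht)).2
    have h2 : K * (∑ i, W N 0 (u t i)) ^ 3 ≤ D :=
      (hΦ3 t ht).trans (mul_le_of_le_one_right hD0 (Real.exp_le_one_iff.2 (by nlinarith [ht.1])))
    have h3 := hE8n t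
    have h4 := mul_nonneg (by positivity : 0 ≤ M₁ + M₁ / κ + E / α + D + 1) h3
    linarith

end Bounds

/-! ### Continuity of the nonlinearity on bounded sets of `Ḣ²` -/

/-- A pair of sequences in the ball of `Ḣ²` whose squared radius is `M`. -/
def BoundedH2 (M : ℝ) (u : Fin 2 → ℤ → ℂ) : Prop :=
  (∀ i, u i 0 = 0) ∧ ∀ S : Finset ℤ, ∑ i, ∑ k ∈ S, |(k : ℝ)| ^ 4 * ‖u i k‖ ^ 2 ≤ M

lemma BoundedH2.sum_le {M : ℝ} {u : Fin 2 → ℤ → ℂ} (hu : BoundedH2 M u) (i : Fin 2)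
    (S : Finset ℤ) : ∑ k ∈ S, |(k : ℝ)| ^ 4 * ‖u i k‖ ^ 2 ≤ M :=
  (Finset.single_le_sum (f := fun i => ∑ k ∈ S, |(k : ℝ)| ^ 4 * ‖u i k‖ ^ 2)
    (fun i _ => Finset.sum_nonneg fun k _ => by positivity) (Finset.mem_univ i)).trans (hu.2 S)

lemma IsTrig.boundedH2 {N : ℕ} {u : Fin 2 → ℤ → ℂ} (hu : IsTrig N u) {M : ℝ}
    (h : ∑ i, En N 4 (u i) ≤ M) : BoundedH2 M u := by
  refine ⟨hu.zero, fun S => (Finset.sum_le_sum fun i _ => ?_).trans h⟩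
  exact sum_le_sum_of_support (x := fun k : ℤ => |(k : ℝ)| ^ 4 * ‖u i k‖ ^ 2)
    (fun k => by positivity) (fun k hk => by simp [hu.supp i k hk])

namespace System

variable {C : System} {E α β κ M : ℝ}

lemma norm_conv_term_le (h : C.Admissible E α β κ) {u : Fin 2 → ℤ → ℂ} {J : ℕ} (hJ : 0 < J)
    (i : Fin 2) (k l : ℤ) (hl : (J : ℝ) ≤ |(l : ℝ)|) :
    ‖u i l * C.force u i (k - l)‖ ≤ (1 + |(k : ℝ)|) / J * ∑ j, (C.A i j + C.B i j) *
      ((|(l : ℝ)| ^ 4 * ‖u i l‖ ^ 2 + |((k - l : ℤ) : ℝ)| ^ 4 * ‖u j (k - l)‖ ^ 2) / 2) := by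
  rw [norm_mul]
  refine (mul_le_mul_of_nonneg_left (norm_force_le h u i (k - l)) (norm_nonneg _)).trans ?_
  rw [Finset.mul_sum, Finset.mul_sum]
  refine Finset.sum_le_sum fun j _ => ?_
  have hA := h.A_nonneg i j
  have hB := h.B_nonneg i j
  have hJ' : (1 : ℝ) ≤ J := by exact_mod_cast hJ
  set p : ℝ := |((k - l : ℤ) : ℝ)| with hp
  set L : ℝ := |(l : ℝ)| with hL
  have hp0 : 0 ≤ p := abs_nonneg _
  have hpL : p ≤ |(k : ℝ)| + L := by
    rw [hp, hL]; push_cast; exact abs_sub _ _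
  have hp3 : C.A i j * p ^ 3 + C.B i j * p ≤ (C.A i j + C.B i j) * p ^ 3 := by
    rcases eq_or_ne (k - l) 0 with h0 | h0
    · have : p = 0 := by rw [hp, h0]; simp
      simp [this]
    · have h1 : 1 ≤ p := one_le_abs_cast h0
      have h2 : p ≤ p ^ 3 := le_self_pow₀ h1 (by norm_num)
      nlinarith [mul_le_mul_of_nonneg_left h2 hB]
  have hk0 : 0 ≤ |(k : ℝ)| := abs_nonneg _
  have h1 : p ≤ (1 + |(k : ℝ)|) / J * L ^ 2 := by
    have h2 : L ≤ L ^ 2 / J := by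
      rw [le_div_iff₀ (by positivity), sq]
      exact mul_le_mul_of_nonneg_left hl (by positivity)
    have h3 : p ≤ (1 + |(k : ℝ)|) * L := by nlinarith
    refine h3.trans ?_
    rw [div_mul_eq_mul_div, mul_div_assoc]
    exact mul_le_mul_of_nonneg_left h2 (by positivity)
  set x := ‖u i l‖
  set y := ‖u j (k - l)‖
  have hx : 0 ≤ x := norm_nonneg _
  have hy : 0 ≤ y := norm_nonneg _
  have hq : 0 ≤ (1 + |(k : ℝ)|) / J := by positivity
  calc x * ((C.A i j * p ^ 3 + C.B i j * p) * y)
      ≤ x * (((C.A i j + C.B i j) * p ^ 3) * y) := by gcongr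
    _ = (C.A i j + C.B i j) * (p ^ 2 * x * y) * p := by ring
    _ ≤ (C.A i j + C.B i j) * (p ^ 2 * x * y) * ((1 + |(k : ℝ)|) / J * L ^ 2) := by gcongr
    _ = (1 + |(k : ℝ)|) / J * ((C.A i j + C.B i j) * ((L ^ 2 * x) * (p ^ 2 * y))) := by ring
    _ ≤ (1 + |(k : ℝ)|) / J * ((C.A i j + C.B i j) *
        ((L ^ 4 * x ^ 2 + p ^ 4 * y ^ 2) / 2)) := by
        gcongr
        nlinarith [sq_nonneg (L ^ 2 * x - p ^ 2 * y)]

/-- The sum of the coefficients of the system, which enters the bounds of the nonlinearity. -/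
noncomputable def total (C : System) : ℝ := ∑ i, ∑ j, (C.A i j + C.B i j)

lemma sum_norm_conv_term_le (h : C.Admissible E α β κ) {u : Fin 2 → ℤ → ℂ} (hu : BoundedH2 M u)
    {J : ℕ} (hJ : 0 < J) (i : Fin 2) (k : ℤ) (S : Finset ℤ) (hS : ∀ l ∈ S, (J : ℝ) ≤ |(l : ℝ)|) :
    ∑ l ∈ S, ‖u i l * C.force u i (k - l)‖ ≤ (1 + |(k : ℝ)|) / J * (C.total * M) := by
  refine (Finset.sum_le_sum fun l hl => norm_conv_term_le h hJ i k l (hS l hl)).trans ?_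
  rw [← Finset.mul_sum]
  refine mul_le_mul_of_nonneg_left ?_ (by positivity)
  have hM : 0 ≤ M := by simpa using hu.2 ∅
  have hn : ∀ i j, 0 ≤ C.A i j + C.B i j := fun i j => add_nonneg (h.A_nonneg i j) (h.B_nonneg i j)
  rw [Finset.sum_comm]
  have h1 : ∀ j, ∑ l ∈ S, (C.A i j + C.B i j) * ((|(l : ℝ)| ^ 4 * ‖u i l‖ ^ 2 +
      |((k - l : ℤ) : ℝ)| ^ 4 * ‖u j (k - l)‖ ^ 2) / 2) ≤ (C.A i j + C.B i j) * M := by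
    intro j
    rw [← Finset.mul_sum, ← Finset.sum_div, Finset.sum_add_distrib]
    refine mul_le_mul_of_nonneg_left ?_ (hn i j)
    have h2 := hu.sum_le i S
    have h3 : ∑ l ∈ S, |((k - l : ℤ) : ℝ)| ^ 4 * ‖u j (k - l)‖ ^ 2 ≤ M := by
      classical
      rw [← Finset.sum_image (f := fun p : ℤ => |(p : ℝ)| ^ 4 * ‖u j p‖ ^ 2) (s := S)
        (g := fun l => k - l) (fun a _ b _ hab => sub_right_injective hab)]
      exact hu.sum_le j _
    linarith
  refine (Finset.sum_le_sum fun j _ => h1 j).trans ?_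
  rw [← Finset.sum_mul]
  exact mul_le_mul_of_nonneg_right (Finset.single_le_sum
    (f := fun i => ∑ j, (C.A i j + C.B i j)) (fun i _ => Finset.sum_nonneg fun j _ => hn i j)
    (Finset.mem_univ i)) hM

lemma summable_norm_conv (h : C.Admissible E α β κ) {u : Fin 2 → ℤ → ℂ} (hu : BoundedH2 M u)
    (i : Fin 2) (k : ℤ) : Summable (fun l => ‖u i l * C.force u i (k - l)‖) := by
  refine summable_of_sum_le (c := (1 + |(k : ℝ)|) / (1 : ℕ) * (C.total * M))
    (fun l => norm_nonneg _) fun S => ?_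
  classical
  have h1 := sum_norm_conv_term_le h hu one_pos i k (S.erase 0) (fun l hl => by
    simpa using one_le_abs_cast (Finset.ne_of_mem_erase hl))
  refine le_trans (le_of_eq ?_) h1
  exact (Finset.sum_erase S (by simp [hu.1])).symm

lemma norm_conv_sub_le (h : C.Admissible E α β κ) {u : Fin 2 → ℤ → ℂ} (hu : BoundedH2 M u)
    (i : Fin 2) (k : ℤ) (J : ℕ) :
    ‖C.conv u i k - ∑ l ∈ modes J, u i l * C.force u i (k - l)‖ ≤
      (1 + |(k : ℝ)|) / (J + 1 : ℕ) * (C.total * M) := by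
  have hs : HasSum (fun l => u i l * C.force u i (k - l)) (C.conv u i k) :=
    (summable_norm_conv h hu i k).of_norm.hasSum
  have hs' := (Filter.Tendsto.sub_const hs (∑ l ∈ modes J, u i l * C.force u i (k - l))).norm
  refine le_of_tendsto hs' ?_
  filter_upwards [eventually_ge_atTop (modes J)] with S hS
  classical
  rw [← Finset.sum_sdiff hS, add_sub_cancel_right]
  refine (norm_sum_le _ _).trans (sum_norm_conv_term_le h hu J.succ_pos i k _ fun l hl => ?_)
  have h1 := (Finset.mem_sdiff.1 hl).2
  rw [mem_modes, not_le] at h1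
  have h2 : ((J + 1 : ℕ) : ℤ) ≤ |l| := by push_cast; omega
  exact_mod_cast h2

lemma norm_conv_le_of_boundedH2 (h : C.Admissible E α β κ) {u : Fin 2 → ℤ → ℂ}
    (hu : BoundedH2 M u) (i : Fin 2) (k : ℤ) :
    ‖C.conv u i k‖ ≤ (1 + |(k : ℝ)|) * (C.total * M) := by
  have h1 := norm_conv_sub_le h hu i k 0
  have h2 : ∑ l ∈ modes 0, u i l * C.force u i (k - l) = 0 := by
    simp [modes, hu.1]
  rw [h2, sub_zero] at h1
  simpa using h1

variable {ι : Type*} {𝓕 : Filter ι} {w : ι → Fin 2 → ℤ → ℂ} {v : Fin 2 → ℤ → ℂ}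

lemma tendsto_force (hwv : ∀ i k, Tendsto (fun n => w n i k) 𝓕 (𝓝 (v i k))) (i : Fin 2) (k : ℤ) :
    Tendsto (fun n => C.force (w n) i k) 𝓕 (𝓝 (C.force v i k)) :=
  tendsto_finsetSum _ fun j _ => (hwv j k).const_mul _

/-- The nonlinearity is weakly sequentially continuous on bounded subsets of `Ḣ²`: the tails of the
convolution are small uniformly on such sets. -/
lemma tendsto_conv (h : C.Admissible E α β κ) (hw : ∀ n, BoundedH2 M (w n)) (hv : BoundedH2 M v)
    (hwv : ∀ i k, Tendsto (fun n => w n i k) 𝓕 (𝓝 (v i k))) (i : Fin 2) (k : ℤ) :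
    Tendsto (fun n => C.conv (w n) i k) 𝓕 (𝓝 (C.conv v i k)) := by
  rw [Metric.tendsto_nhds]
  intro ε hε
  have hlim : Tendsto (fun J : ℕ => (1 + |(k : ℝ)|) / (J + 1 : ℕ) * (C.total * M)) atTop
      (𝓝 0) := by
    have h1 := (tendsto_const_div_atTop_nhds_zero_nat (1 + |(k : ℝ)|)).comp (tendsto_add_atTop_nat 1)
    simpa using h1.mul_const (C.total * M)
  obtain ⟨J, hJ⟩ := (hlim.eventually (gt_mem_nhds (by positivity : 0 < ε / 3))).exists
  have hfin : Tendsto (fun n => ∑ l ∈ modes J, w n i l * C.force (w n) i (k - l)) 𝓕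
      (𝓝 (∑ l ∈ modes J, v i l * C.force v i (k - l))) :=
    tendsto_finsetSum _ fun l _ => (hwv i l).mul (tendsto_force hwv i (k - l))
  filter_upwards [(Metric.tendsto_nhds.1 hfin) (ε / 3) (by positivity)] with n hn
  have h1 := norm_conv_sub_le h (hw n) i k J
  have h2 := norm_conv_sub_le h hv i k J
  rw [← dist_eq_norm] at h1 h2
  have h3 := dist_triangle4 (C.conv (w n) i k) (∑ l ∈ modes J, w n i l * C.force (w n) i (k - l))
    (∑ l ∈ modes J, v i l * C.force v i (k - l)) (C.conv v i k)
  rw [dist_comm] at h2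
  linarith

lemma tendsto_rhs (h : C.Admissible E α β κ) (hw : ∀ n, BoundedH2 M (w n)) (hv : BoundedH2 M v)
    (hwv : ∀ i k, Tendsto (fun n => w n i k) 𝓕 (𝓝 (v i k))) (i : Fin 2) (k : ℤ) :
    Tendsto (fun n => C.rhs (w n) i k) 𝓕 (𝓝 (C.rhs v i k)) :=
  (((tendsto_force hwv i k).const_mul _).add (tendsto_conv h hw hv hwv i k)).const_mul _

lemma continuous_rhs (h : C.Admissible E α β κ) {w : ℝ → Fin 2 → ℤ → ℂ}
    (hw : ∀ t, BoundedH2 M (w t)) (hc : ∀ i k, Continuous fun t => w t i k) (i : Fin 2) (k : ℤ) :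
    Continuous fun t => C.rhs (w t) i k :=
  continuous_iff_continuousAt.2 fun t =>
    tendsto_rhs h hw (hw t) (fun i k => (hc i k).continuousAt) i k

/-- A bound of the right hand side of the equation with frequency `k` on the ball of `Ḣ²` with
squared radius `M`. -/
lemma norm_rhs_le_of_boundedH2 (h : C.Admissible E α β κ) {u : Fin 2 → ℤ → ℂ}
    (hu : BoundedH2 M u) (i : Fin 2) (k : ℤ) :
    ‖C.rhs u i k‖ ≤ |(k : ℝ)| * (C.m i * (∑ j, (C.A i j * |(k : ℝ)| ^ 3 + C.B i j * |(k : ℝ)|)) *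
      (1 + M) + (1 + |(k : ℝ)|) * (C.total * M)) := by
  have hM : 0 ≤ M := by simpa using hu.2 ∅
  rcases eq_or_ne k 0 with rfl | hk
  · simp [rhs]
  have hk1 := one_le_abs_cast hk
  have hm := h.m_nonneg i
  rw [rhs, norm_mul, norm_neg, Complex.norm_intCast]
  refine mul_le_mul_of_nonneg_left ((norm_add_le _ _).trans
    (add_le_add ?_ (norm_conv_le_of_boundedH2 h hu i k))) (abs_nonneg _)
  rw [norm_mul, Complex.norm_real, Real.norm_of_nonneg hm, mul_assoc]
  refine mul_le_mul_of_nonneg_left ((norm_force_le h u i k).trans ?_) hm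
  rw [Finset.sum_mul]
  refine Finset.sum_le_sum fun j _ => mul_le_mul_of_nonneg_left ?_ ?_
  · have h1 := hu.sum_le j {k}
    rw [Finset.sum_singleton] at h1
    have h2 : ‖u j k‖ ^ 2 ≤ |(k : ℝ)| ^ 4 * ‖u j k‖ ^ 2 :=
      le_mul_of_one_le_left (sq_nonneg _) (one_le_pow₀ hk1)
    nlinarith [sq_nonneg (‖u j k‖ - 1)]
  · have := h.A_nonneg i j
    have := h.B_nonneg i j
    positivity

end System

/-! ### Compactness and passage to the limit -/

/-- A sequence of countable families of uniformly bounded functions, equi-Lipschitz for each member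
of the family, has a subsequence which converges at every point. -/
lemma exists_subseq_tendsto_of_lipschitz {ι : Type*} [Countable ι] {w : ℕ → ι → ℝ → ℂ} {R : ℝ}
    {L : ι → ℝ≥0} (hb : ∀ n x t, ‖w n x t‖ ≤ R) (hL : ∀ n x, LipschitzWith (L x) (w n x)) :
    ∃ φ : ℕ → ℕ, StrictMono φ ∧ ∃ v : ι → ℝ → ℂ,
      ∀ x t, Tendsto (fun n => w (φ n) x t) atTop (𝓝 (v x t)) := by
  have hK : IsCompact (Set.pi univ (fun _ : ι × ℚ => Metric.closedBall (0 : ℂ) R)) :=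
    isCompact_univ_pi fun _ => isCompact_closedBall _ _
  obtain ⟨g, -, φ, hφ, hg⟩ := hK.tendsto_subseq
    (x := fun n (p : ι × ℚ) => w n p.1 p.2) (fun n p _ => by simpa using hb n p.1 p.2)
  rw [tendsto_pi_nhds] at hg
  have hc : ∀ x t, CauchySeq (fun n => w (φ n) x t) := by
    intro x t
    rw [Metric.cauchySeq_iff]
    intro ε hε
    obtain ⟨q, hq1, hq2⟩ := exists_rat_btwn
      (show t < t + ε / (4 * (L x + 1)) from lt_add_of_pos_right _ (by positivity))
    have hcq := (hg (x, q)).cauchySeq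
    rw [Metric.cauchySeq_iff] at hcq
    obtain ⟨N, hN⟩ := hcq (ε / 4) (by positivity)
    have hclose : ∀ n, dist (w (φ n) x t) (w (φ n) x q) ≤ ε / 4 := by
      intro n
      refine ((hL (φ n) x).dist_le_mul t q).trans ?_
      have h1 : dist t (q : ℝ) ≤ ε / (4 * (L x + 1)) := by
        rw [Real.dist_eq, abs_le]; constructor <;> linarith
      have h2 : (L x : ℝ) * dist t q ≤ (L x + 1) * (ε / (4 * (L x + 1))) :=
        mul_le_mul (by linarith) h1 dist_nonneg (by positivity)
      refine h2.trans (le_of_eq ?_)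
      field_simp
    refine ⟨N, fun m hm n hn => ?_⟩
    have h1 := hN m hm n hn
    simp only [Function.comp_apply] at h1
    have h2 := dist_triangle4 (w (φ m) x t) (w (φ m) x q) (w (φ n) x q) (w (φ n) x t)
    have h3 := hclose m
    have h4 := hclose n
    rw [dist_comm] at h4
    linarith
  choose v hv using fun x t => cauchySeq_tendsto_of_complete (hc x t)
  exact ⟨φ, hφ, v, hv⟩

/-- The Fourier coefficients of a global solution, with the bounds that it inherits from the
Galerkin approximations. The sums are taken over arbitrary finite sets of frequencies; the
evolution equation is required for nonnegative times only. -/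
structure IsFourierSolution (C : System) (a : Fin 2 → ℤ → ℂ) (E r M γ : ℝ)
    (v : ℝ → Fin 2 → ℤ → ℂ) : Prop where
  symm : ∀ t i k, v t i (-k) = starRingEnd ℂ (v t i k)
  cont : ∀ i k, Continuous fun t => v t i k
  rhs_cont : ∀ i k, Continuous fun t => C.rhs (v t) i k
  bounded : ∀ t, BoundedH2 M (v t)
  init : ∀ i k, v 0 i k = a i k
  evol : ∀ t, 0 ≤ t → ∀ i k, v t i k = a i k + ∫ s in (0)..t, C.rhs (v s) i k
  wiener_le : ∀ t, 0 ≤ t → ∀ S : Finset ℤ, ∑ i, ∑ k ∈ S, ‖v t i k‖ ≤ E * Real.exp (-r * t)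
  energy_le : ∀ t, 0 ≤ t → ∀ S : Finset ℤ,
    ∑ i, ∑ k ∈ S, |(k : ℝ)| ^ 4 * ‖v t i k‖ ^ 2 ≤ M * Real.exp (-γ * t)
  int_wiener : ∀ T, 0 ≤ T → ∀ S : Finset ℤ,
    ∫ t in (0)..T, ∑ i, ∑ k ∈ S, |(k : ℝ)| ^ 4 * ‖v t i k‖ ≤ M
  int_energy : ∀ T, 0 ≤ T → ∀ S : Finset ℤ,
    ∫ t in (0)..T, ∑ i, ∑ k ∈ S, |(k : ℝ)| ^ 8 * ‖v t i k‖ ^ 2 ≤ M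
  int_rate : ∀ T, 0 ≤ T → ∀ S : Finset ℤ,
    ∫ t in (0)..T, ∑ i, ∑ k ∈ S, |(k : ℝ)| ^ 4 * (‖v t i k‖ * ‖C.rhs (v t) i k‖) ≤ M * (M + T)

/-- Integrals of uniformly bounded continuous functions pass to the pointwise limit. -/
lemma tendsto_integral_of_bounded {G : Type*} [NormedAddCommGroup G] [NormedSpace ℝ G]
    {F : ℕ → ℝ → G} {f : ℝ → G} {B : ℝ}
    (hF : ∀ n, Continuous (F n)) (hB : ∀ n t, ‖F n t‖ ≤ B)
    (h : ∀ t, Tendsto (fun n => F n t) atTop (𝓝 (f t))) (a b : ℝ) :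
    Tendsto (fun n => ∫ t in a..b, F n t) atTop (𝓝 (∫ t in a..b, f t)) :=
  intervalIntegral.tendsto_integral_filter_of_dominated_convergence (fun _ => B)
    (Eventually.of_forall fun n => (hF n).aestronglyMeasurable)
    (Eventually.of_forall fun n => Eventually.of_forall fun t _ => hB n t)
    intervalIntegrable_const (Eventually.of_forall fun t _ => h t)

theorem exists_isFourierSolution {C : System} {E α β κ : ℝ} (h : C.Admissible E α β κ) {r : ℝ}
    (hr0 : 0 < r) (hr : r < α + β) {a : Fin 2 → ℤ → ℂ} (ha0 : ∀ i, a i 0 = 0)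
    (hasymm : ∀ i k, a i (-k) = starRingEnd ℂ (a i k))
    (haE : ∀ S : Finset ℤ, ∑ i, ∑ k ∈ S, ‖a i k‖ ≤ E) {M₀ : ℝ}
    (haM : ∀ S : Finset ℤ, ∑ i, ∑ k ∈ S, |(k : ℝ)| ^ 4 * ‖a i k‖ ^ 2 ≤ M₀) :
    ∃ M γ v, 0 < M ∧ 0 < γ ∧ IsFourierSolution C a E r M γ v := by
  classical
  have hM₀ : 0 ≤ M₀ := by simpa using haM ∅
  obtain ⟨M, γ, hM, hγ, hbd⟩ := exists_energy_bounds h hr0 M₀ hM₀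
  set trunc : ℕ → Fin 2 → ℤ → ℂ := fun n i k => if k ∈ modes n then a i k else 0 with htr
  have htrig : ∀ n, IsTrig n (trunc n) := fun n =>
    { supp := fun i k hk => if_neg hk
      zero := fun i => by simp [htr, ha0]
      symm := fun i k => by
        simp only [htr, neg_mem_modes, hasymm]
        split_ifs <;> simp }
  have htE : ∀ n, ∑ i, W n 0 (trunc n i) ≤ E := fun n => by
    refine le_trans (Finset.sum_le_sum fun i _ => le_of_eq ?_) (haE (modes n))
    simp only [W, htr, pow_zero, one_mul]
    exact Finset.sum_congr rfl fun k hk => by rw [if_pos hk]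
  have htM : ∀ n, ∑ i, En n 4 (trunc n i) ≤ M₀ := fun n => by
    refine le_trans (Finset.sum_le_sum fun i _ => le_of_eq ?_) (haM (modes n))
    simp only [En, htr]
    exact Finset.sum_congr rfl fun k hk => by rw [if_pos hk]
  choose u hu hu0 hudec using fun n : ℕ =>
    exists_galerkin h hr (htrig n) (htE n) (Nat.cast_nonneg n : (0 : ℝ) ≤ n)
  have hb := fun n => hbd n n (u n) (Nat.cast_nonneg n) (hu n) (hudec n)
    (by rw [hu0 n]; exact htM n)
  -- The approximations are extended to all times by constants.
  set w : ℕ → ℝ → Fin 2 → ℤ → ℂ := fun n t => u n (max 0 (min (n : ℝ) t)) with hw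
  have hcl : ∀ (n : ℕ) (t : ℝ), max 0 (min (n : ℝ) t) ∈ Icc (0 : ℝ) n := fun n t =>
    ⟨le_max_left _ _, max_le (Nat.cast_nonneg n) (min_le_left _ _)⟩
  have hweq : ∀ (n : ℕ) (t : ℝ), t ∈ Icc (0 : ℝ) n → w n t = u n t := fun n t ht => by
    simp only [hw]; rw [min_eq_right ht.2, max_eq_right ht.1]
  have hexp1 : ∀ t : ℝ, 0 ≤ t → M * Real.exp (-γ * t) ≤ M := fun t ht =>
    mul_le_of_le_one_right hM.le (Real.exp_le_one_iff.2 (by nlinarith))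
  have hwH2 : ∀ n t, BoundedH2 M (w n t) := fun n t =>
    ((hu n).trig _).boundedH2 (((hb n).1 _ (hcl n t)).trans (hexp1 _ (hcl n t).1))
  have hwE : ∀ n t, ∑ i, W n 0 (w n t i) ≤ E := fun n t =>
    wiener_le_of_decay h hr0 (hcl n t).1 (hudec n _ (hcl n t))
  have hsumW : ∀ n t (s : ℕ) (S : Finset ℤ),
      ∑ i, ∑ k ∈ S, |(k : ℝ)| ^ s * ‖w n t i k‖ ≤ ∑ i, W n s (w n t i) := fun n t s S =>
    Finset.sum_le_sum fun i _ => sum_le_sum_of_support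
      (x := fun k : ℤ => |(k : ℝ)| ^ s * ‖w n t i k‖) (fun k => by positivity)
      (fun k hk => by simp [((hu n).trig _).supp i k hk, hw])
  have hsumEn : ∀ n t (s : ℕ) (S : Finset ℤ),
      ∑ i, ∑ k ∈ S, |(k : ℝ)| ^ s * ‖w n t i k‖ ^ 2 ≤ ∑ i, En n s (w n t i) := fun n t s S =>
    Finset.sum_le_sum fun i _ => sum_le_sum_of_support
      (x := fun k : ℤ => |(k : ℝ)| ^ s * ‖w n t i k‖ ^ 2) (fun k => by positivity)
      (fun k hk => by simp [((hu n).trig _).supp i k hk, hw])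
  have hwnorm : ∀ n t i k, ‖w n t i k‖ ≤ E := by
    intro n t i k
    have h1 := (hsumW n t 0 {k}).trans (hwE n t)
    simp only [pow_zero, one_mul, Finset.sum_singleton] at h1
    exact (Finset.single_le_sum (f := fun i => ‖w n t i k‖) (fun i _ => norm_nonneg _)
      (Finset.mem_univ i)).trans h1
  set L : Fin 2 → ℤ → ℝ := fun i k => |(k : ℝ)| * (C.m i * (∑ j, (C.A i j * |(k : ℝ)| ^ 3 +
    C.B i j * |(k : ℝ)|)) * (1 + M) + (1 + |(k : ℝ)|) * (C.total * M)) with hLdef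
  have hrhs : ∀ n t i k, ‖C.rhs (w n t) i k‖ ≤ L i k := fun n t i k =>
    System.norm_rhs_le_of_boundedH2 h (hwH2 n t) i k
  have hL0 : ∀ i k, 0 ≤ L i k := fun i k => (norm_nonneg _).trans (hrhs 0 0 i k)
  have hlip : ∀ n (x : Fin 2 × ℤ),
      LipschitzWith (Real.toNNReal (L x.1 x.2)) (fun t => w n t x.1 x.2) := by
    rintro n ⟨i, k⟩
    have h1 : LipschitzOnWith (Real.toNNReal (L i k)) (fun t => u n t i k) (Icc 0 n) := by
      by_cases hk : k ∈ modes n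
      · refine (convex_Icc (0 : ℝ) n).lipschitzOnWith_of_nnnorm_hasDerivWithin_le
          (fun t ht => (hu n).deriv t ht i k hk) fun t ht => ?_
        rw [← NNReal.coe_le_coe, coe_nnnorm, Real.coe_toNNReal _ (hL0 i k)]
        have := hrhs n t i k
        rwa [hweq n t ht] at this
      · have : (fun t => u n t i k) = fun _ => 0 := funext fun t => ((hu n).trig t).supp i k hk
        rw [this]
        exact (LipschitzWith.const' 0).lipschitzOnWith
    have h2 : LipschitzWith 1 (fun t : ℝ => max 0 (min (n : ℝ) t)) :=
      (LipschitzWith.id.const_min _).const_max _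
    have h3 := h1.comp h2.lipschitzOnWith (s := univ) (fun t _ => hcl n t)
    rw [mul_one] at h3
    exact lipschitzOnWith_univ.1 h3
  obtain ⟨φ, hφ, v', hv'⟩ := exists_subseq_tendsto_of_lipschitz
    (w := fun n (x : Fin 2 × ℤ) t => w n t x.1 x.2) (fun n x t => hwnorm n t x.1 x.2) hlip
  set v : ℝ → Fin 2 → ℤ → ℂ := fun t i k => v' (i, k) t with hvdef
  have hv : ∀ t i k, Tendsto (fun n => w (φ n) t i k) atTop (𝓝 (v t i k)) :=
    fun t i k => hv' (i, k) t
  have hev : ∀ T : ℝ, ∀ᶠ n in atTop, T ≤ (φ n : ℝ) := fun T => by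
    filter_upwards [(tendsto_natCast_atTop_atTop (R := ℝ)).comp hφ.tendsto_atTop
      |>.eventually (eventually_ge_atTop T)] with n hn using hn
  have hvnorm : ∀ (t : ℝ) (s : ℕ) (S : Finset ℤ), Tendsto
      (fun n => ∑ i, ∑ k ∈ S, |(k : ℝ)| ^ s * ‖w (φ n) t i k‖) atTop
      (𝓝 (∑ i, ∑ k ∈ S, |(k : ℝ)| ^ s * ‖v t i k‖)) := fun t s S =>
    tendsto_finsetSum _ fun i _ => tendsto_finsetSum _ fun k _ =>
      ((hv t i k).norm).const_mul _
  have hvsq : ∀ (t : ℝ) (s : ℕ) (S : Finset ℤ), Tendsto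
      (fun n => ∑ i, ∑ k ∈ S, |(k : ℝ)| ^ s * ‖w (φ n) t i k‖ ^ 2) atTop
      (𝓝 (∑ i, ∑ k ∈ S, |(k : ℝ)| ^ s * ‖v t i k‖ ^ 2)) := fun t s S =>
    tendsto_finsetSum _ fun i _ => tendsto_finsetSum _ fun k _ =>
      (((hv t i k).norm).pow 2).const_mul _
  have hvH2 : ∀ t, BoundedH2 M (v t) := fun t =>
    ⟨fun i => tendsto_nhds_unique (hv t i 0) (by simp [(hwH2 _ t).1]),
      fun S => le_of_tendsto (hvsq t 4 S) (Eventually.of_forall fun n => (hwH2 (φ n) t).2 S)⟩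
  have hvr : ∀ t i k, Tendsto (fun n => C.rhs (w (φ n) t) i k) atTop (𝓝 (C.rhs (v t) i k)) :=
    fun t i k => System.tendsto_rhs h (fun n => hwH2 (φ n) t) (hvH2 t) (hv t) i k
  have hwc : ∀ n i k, Continuous fun t => w n t i k := fun n i k => (hlip n (i, k)).continuous
  have hwrc : ∀ n i k, Continuous fun t => C.rhs (w n t) i k := fun n i k =>
    System.continuous_rhs h (hwH2 n) (hwc n) i k
  have hvc : ∀ i k, Continuous fun t => v t i k := fun i k => by
    have : LipschitzWith (Real.toNNReal (L i k)) (fun t => v t i k) :=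
      LipschitzWith.of_dist_le_mul fun s t => le_of_tendsto ((hv s i k).dist (hv t i k))
        (Eventually.of_forall fun n => (hlip (φ n) (i, k)).dist_le_mul s t)
    exact this.continuous
  have hmono : ∀ {f g : ℝ → ℝ} {T B : ℝ}, 0 ≤ T → Continuous f → ContinuousOn g (Icc 0 T) →
      (∀ t ∈ Icc 0 T, f t ≤ g t) → ∫ t in (0)..T, g t ≤ B → ∫ t in (0)..T, f t ≤ B :=
    fun hT hf hg hfg hB => (intervalIntegral.integral_mono_on hT (hf.intervalIntegrable _ _)
      (hg.intervalIntegrable_of_Icc hT) hfg).trans hB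
  refine ⟨M, γ, v, hM, hγ, ⟨fun t i k => ?_, hvc,
    fun i k => System.continuous_rhs h hvH2 hvc i k, hvH2, fun i k => ?_, fun t ht i k => ?_,
    fun t ht S => ?_, fun t ht S => ?_, fun T hT S => ?_, fun T hT S => ?_, fun T hT S => ?_⟩⟩
  · refine tendsto_nhds_unique (hv t i (-k)) ?_
    have h1 := (Complex.continuous_conj.tendsto _).comp (hv t i k)
    refine h1.congr fun n => ?_
    exact (((hu (φ n)).trig _).symm i k).symm
  · refine tendsto_nhds_unique (hv 0 i k) ?_
    refine tendsto_const_nhds.congr' ?_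
    filter_upwards [hev |(k : ℝ)|] with n hn
    rw [hweq (φ n) 0 (left_mem_Icc.2 (Nat.cast_nonneg _)), hu0]
    have : k ∈ modes (φ n) := by rw [mem_modes]; exact_mod_cast hn
    simp [htr, this]
  · have h1 : Tendsto (fun n => a i k + ∫ s in (0)..t, C.rhs (w (φ n) s) i k) atTop
        (𝓝 (a i k + ∫ s in (0)..t, C.rhs (v s) i k)) :=
      (tendsto_integral_of_bounded (fun n => hwrc (φ n) i k) (fun n s => hrhs (φ n) s i k)
        (fun s => hvr s i k) 0 t).const_add _
    refine tendsto_nhds_unique (hv t i k) (h1.congr' ?_)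
    filter_upwards [hev |(k : ℝ)|, hev t] with n hn hnt
    have hk : k ∈ modes (φ n) := by rw [mem_modes]; exact_mod_cast hn
    have h2 := intervalIntegral.integral_eq_sub_of_hasDeriv_right_of_le ht
      (f := fun s => w (φ n) s i k) (f' := fun s => C.rhs (w (φ n) s) i k)
      (hwc (φ n) i k).continuousOn (fun s hs => by
        have hs' : s ∈ Ico (0 : ℝ) (φ n) := ⟨hs.1.le, hs.2.trans_le hnt⟩
        have h3 := (hu (φ n)).deriv s (Ico_subset_Icc_self hs') i k hk
        rw [← hweq (φ n) s (Ico_subset_Icc_self hs')] at h3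
        have h4 := h3.congr (f₁ := fun s => w (φ n) s i k)
          (fun y hy => by simp only [hweq (φ n) y hy])
          (by simp only [hweq (φ n) s (Ico_subset_Icc_self hs')])
        exact (h4.mono_of_mem_nhdsWithin (Icc_mem_nhdsWithin_Ici hs')).mono Ioi_subset_Ici_self)
      ((hwrc (φ n) i k).intervalIntegrable _ _)
    rw [h2]
    have h5 : w (φ n) 0 i k = a i k := by
      rw [hweq (φ n) 0 (left_mem_Icc.2 (Nat.cast_nonneg _)), hu0]
      simp [htr, hk]
    rw [h5]; ring
  · have h1 := hvnorm t 0 S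
    simp only [pow_zero, one_mul] at h1
    refine le_of_tendsto h1 ?_
    filter_upwards [hev t] with n hn
    have h2 := hsumW (φ n) t 0 S
    simp only [pow_zero, one_mul] at h2
    rw [hweq (φ n) t ⟨ht, hn⟩] at h2 ⊢
    exact h2.trans (hudec (φ n) t ⟨ht, hn⟩)
  · refine le_of_tendsto (hvsq t 4 S) ?_
    filter_upwards [hev t] with n hn
    have h2 := hsumEn (φ n) t 4 S
    rw [hweq (φ n) t ⟨ht, hn⟩] at h2 ⊢
    exact h2.trans ((hb (φ n)).1 t ⟨ht, hn⟩)
  · have hcont : ∀ n, Continuous fun t => ∑ i, ∑ k ∈ S, |(k : ℝ)| ^ 4 * ‖w (φ n) t i k‖ := fun n =>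
      continuous_finsetSum _ fun i _ => continuous_finsetSum _ fun k _ =>
        continuous_const.mul (hwc (φ n) i k).norm
    refine le_of_tendsto (tendsto_integral_of_bounded hcont
      (B := ∑ i : Fin 2, ∑ k ∈ S, |(k : ℝ)| ^ 4 * E) (fun n t => ?_)
      (fun t => hvnorm t 4 S) 0 T) ?_
    · rw [Real.norm_of_nonneg (by positivity)]
      exact Finset.sum_le_sum fun i _ => Finset.sum_le_sum fun k _ =>
        mul_le_mul_of_nonneg_left (hwnorm _ _ _ _) (by positivity)
    · filter_upwards [hev T] with n hn
      refine hmono hT (hcont n) (((hu (φ n)).continuousOn_W 4).mono (Icc_subset_Icc_right hn))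
        (fun t ht => ?_) ((hb (φ n)).2.1 T ⟨hT, hn⟩)
      have h2 := hsumW (φ n) t 4 S
      rwa [hweq (φ n) t ⟨ht.1, ht.2.trans hn⟩] at h2 ⊢
  · have hcont : ∀ n, Continuous fun t => ∑ i, ∑ k ∈ S, |(k : ℝ)| ^ 8 * ‖w (φ n) t i k‖ ^ 2 :=
      fun n => continuous_finsetSum _ fun i _ => continuous_finsetSum _ fun k _ =>
        continuous_const.mul ((hwc (φ n) i k).norm.pow 2)
    refine le_of_tendsto (tendsto_integral_of_bounded hcont
      (B := ∑ i : Fin 2, ∑ k ∈ S, |(k : ℝ)| ^ 8 * E ^ 2) (fun n t => ?_)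
      (fun t => hvsq t 8 S) 0 T) ?_
    · rw [Real.norm_of_nonneg (by positivity)]
      exact Finset.sum_le_sum fun i _ => Finset.sum_le_sum fun k _ =>
        mul_le_mul_of_nonneg_left (pow_le_pow_left₀ (norm_nonneg _) (hwnorm _ _ _ _) 2)
          (by positivity)
    · filter_upwards [hev T] with n hn
      refine hmono hT (hcont n) (((hu (φ n)).continuousOn_En 8).mono (Icc_subset_Icc_right hn))
        (fun t ht => ?_) ((hb (φ n)).2.2.1 T ⟨hT, hn⟩)
      have h2 := hsumEn (φ n) t 8 S
      rwa [hweq (φ n) t ⟨ht.1, ht.2.trans hn⟩] at h2 ⊢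
  · have hcont : ∀ n, Continuous fun t => ∑ i, ∑ k ∈ S, |(k : ℝ)| ^ 4 *
        (‖w (φ n) t i k‖ * ‖C.rhs (w (φ n) t) i k‖) := fun n =>
      continuous_finsetSum _ fun i _ => continuous_finsetSum _ fun k _ =>
        continuous_const.mul ((hwc (φ n) i k).norm.mul (hwrc (φ n) i k).norm)
    refine le_of_tendsto (tendsto_integral_of_bounded hcont
      (B := ∑ i : Fin 2, ∑ k ∈ S, |(k : ℝ)| ^ 4 * (E * L i k)) (fun n t => ?_)
      (fun t => tendsto_finsetSum _ fun i _ => tendsto_finsetSum _ fun k _ =>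
        ((hv t i k).norm.mul (hvr t i k).norm).const_mul _) 0 T) ?_
    · rw [Real.norm_of_nonneg (by positivity)]
      exact Finset.sum_le_sum fun i _ => Finset.sum_le_sum fun k _ =>
        mul_le_mul_of_nonneg_left (mul_le_mul (hwnorm _ _ _ _) (hrhs _ _ _ _) (norm_nonneg _)
          h.E_nonneg) (by positivity)
    · filter_upwards [hev T] with n hn
      have hgc : ContinuousOn (fun t => ∑ i, En (φ n) 8 (u (φ n) t i)) (Icc 0 T) :=
        ((hu (φ n)).continuousOn_En 8).mono (Icc_subset_Icc_right hn)
      refine hmono hT (hcont n) (g := fun t => M * (∑ i, En (φ n) 8 (u (φ n) t i) + 1))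
        (continuousOn_const.mul (hgc.add continuousOn_const)) (fun t ht => ?_) ?_
      · have ht' : t ∈ Icc (0 : ℝ) (φ n) := ⟨ht.1, ht.2.trans hn⟩
        refine le_trans ?_ ((hb (φ n)).2.2.2 t ht')
        rw [hweq (φ n) t ht']
        refine Finset.sum_le_sum fun i _ => sum_le_sum_of_support
          (x := fun k : ℤ => |(k : ℝ)| ^ 4 * (‖u (φ n) t i k‖ * ‖C.rhs (u (φ n) t) i k‖))
          (fun k => by positivity) (fun k hk => by simp [((hu (φ n)).trig _).supp i k hk])
      · rw [intervalIntegral.integral_const_mul, intervalIntegral.integral_add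
          (hgc.intervalIntegrable_of_Icc hT) intervalIntegrable_const]
        have h1 := (hb (φ n)).2.2.1 T ⟨hT, hn⟩
        refine mul_le_mul_of_nonneg_left ?_ hM.le
        rw [intervalIntegral.integral_const, sub_zero, smul_eq_mul, mul_one]
        linarith

/-! ### Real Fourier series on the torus -/

/-- The real part of the Fourier series `∑ₖ aₖ e^{ikx}`. -/
noncomputable def series (a : ℤ → ℂ) (x : Torus) : ℝ := (∑' k, a k * fourier k x).re

/-- The Fourier coefficients `(ik)ⁿ aₖ` of the `n`-th derivative. -/
noncomputable def der (n : ℕ) (a : ℤ → ℂ) (k : ℤ) : ℂ := (Complex.I * k) ^ n * a k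

/-- The symmetry of the Fourier coefficients of a real function. -/
def IsReal (a : ℤ → ℂ) : Prop := ∀ k, a (-k) = starRingEnd ℂ (a k)

lemma norm_fourier_apply (k : ℤ) (x : Torus) : ‖(fourier k x : ℂ)‖ = 1 := Circle.norm_coe _

lemma norm_mul_fourier (a : ℤ → ℂ) (k : ℤ) (x : Torus) : ‖a k * fourier k x‖ = ‖a k‖ := by
  rw [norm_mul, norm_fourier_apply, mul_one]

lemma norm_der (n : ℕ) (a : ℤ → ℂ) (k : ℤ) : ‖der n a k‖ = |(k : ℝ)| ^ n * ‖a k‖ := by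
  rw [der, norm_mul, norm_pow, norm_mul, Complex.norm_I, one_mul, Complex.norm_intCast]

lemma IsReal.der {a : ℤ → ℂ} (ha : IsReal a) (n : ℕ) : IsReal (der n a) := fun k => by
  simp only [Muskat.der, map_mul, map_pow, Complex.conj_I, map_intCast, ha k]
  push_cast; ring

lemma der_succ (n : ℕ) (a : ℤ → ℂ) : der (n + 1) a = der 1 (der n a) := by
  funext k; simp only [der]; ring

lemma der_zero (a : ℤ → ℂ) : der 0 a = a := by funext k; simp [der]

section Series

variable {a b : ℤ → ℂ}

lemma summable_mul_fourier (ha : Summable fun k => ‖a k‖) (x : Torus) :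
    Summable fun k => a k * fourier k x :=
  Summable.of_norm (by simpa only [norm_mul_fourier] using ha)

lemma hasSum_series (hr : IsReal a) (ha : Summable fun k => ‖a k‖) (x : Torus) :
    HasSum (fun k => a k * fourier k x) (series a x : ℂ) := by
  have h1 := (summable_mul_fourier ha x).hasSum
  have h2 : starRingEnd ℂ (∑' k, a k * fourier k x) = ∑' k, a k * fourier k x := by
    rw [Complex.conj_tsum, ← (Equiv.neg ℤ).tsum_eq]
    refine tsum_congr fun k => ?_
    rw [Equiv.neg_apply, map_mul, hr k, Complex.conj_conj, fourier_neg, Complex.conj_conj]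
  rwa [← Complex.conj_eq_iff_re.1 h2] at h1

lemma abs_series_le (ha : Summable fun k => ‖a k‖) (x : Torus) :
    |series a x| ≤ ∑' k, ‖a k‖ := by
  refine (Complex.abs_re_le_norm _).trans ?_
  refine (norm_tsum_le_tsum_norm (by simpa only [norm_mul_fourier] using ha)).trans (le_of_eq ?_)
  simp only [norm_mul_fourier]

lemma continuous_series (ha : Summable fun k => ‖a k‖) : Continuous (series a) := by
  refine Complex.continuous_re.comp (continuous_tsum (fun k => ?_) ha fun k x => ?_)
  · exact continuous_const.mul (ContinuousMap.continuous _)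
  · exact (norm_mul_fourier a k x).le

lemma integrable_of_continuous {f : Torus → ℝ} (hf : Continuous f) : Integrable f :=
  hf.integrable_of_hasCompactSupport (HasCompactSupport.of_compactSpace f)

lemma series_sub (ha : Summable fun k => ‖a k‖) (hb : Summable fun k => ‖b k‖) (x : Torus) :
    series (fun k => a k - b k) x = series a x - series b x := by
  simp only [series, sub_mul]
  rw [(summable_mul_fourier ha x).tsum_sub (summable_mul_fourier hb x), Complex.sub_re]

/-- The pairing of a real function with the Fourier modes. -/
noncomputable def pair (k : ℤ) (ψ : Torus → ℝ) : ℂ := ∫ x, (fourier k x : ℂ) * (ψ x : ℂ)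

lemma norm_pair_le (k : ℤ) {ψ : Torus → ℝ} {B : ℝ} (hB : ∀ x, |ψ x| ≤ B) :
    ‖pair k ψ‖ ≤ B * (2 * π) := by
  refine (norm_integral_le_of_norm_le_const (C := B) (Eventually.of_forall fun x => ?_)).trans ?_
  · rw [norm_mul, norm_fourier_apply, one_mul, Complex.norm_real]; exact hB x
  · rw [measureReal_def, AddCircle.measure_univ, ENNReal.toReal_ofReal Real.two_pi_pos.le]

lemma hasSum_pair (hr : IsReal a) (ha : Summable fun k => ‖a k‖) {ψ : Torus → ℝ}
    (hψ : Continuous ψ) :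
    HasSum (fun k => a k * pair k ψ) ((∫ x, series a x * ψ x : ℝ) : ℂ) := by
  obtain ⟨B, hB⟩ := isCompact_univ.exists_bound_of_continuousOn hψ.continuousOn
  have hcont : ∀ k, Continuous fun x : Torus => a k * fourier k x * (ψ x : ℂ) := fun k =>
    (continuous_const.mul (ContinuousMap.continuous _)).mul (Complex.continuous_ofReal.comp hψ)
  have hint : ∀ k, Integrable fun x : Torus => a k * fourier k x * (ψ x : ℂ) := fun k =>
    (hcont k).integrable_of_hasCompactSupport (HasCompactSupport.of_compactSpace _)
  have hn : ∀ k, ∫ x : Torus, ‖a k * fourier k x * (ψ x : ℂ)‖ ≤ ‖a k‖ * (B * (2 * π)) := by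
    intro k
    refine (Real.le_norm_self _).trans ((norm_integral_le_of_norm_le_const (C := ‖a k‖ * B)
      (Eventually.of_forall fun x => ?_)).trans ?_)
    · rw [norm_norm, norm_mul, norm_mul_fourier, Complex.norm_real]
      exact mul_le_mul_of_nonneg_left (hB x (mem_univ x)) (norm_nonneg _)
    · rw [measureReal_def, AddCircle.measure_univ, ENNReal.toReal_ofReal Real.two_pi_pos.le,
        mul_assoc]
  have key := hasSum_integral_of_summable_integral_norm hint
    (Summable.of_nonneg_of_le (fun k => integral_nonneg fun x => norm_nonneg _) hn
      (ha.mul_right _))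
  have e1 : ∀ k, ∫ x : Torus, a k * fourier k x * (ψ x : ℂ) = a k * pair k ψ := fun k => by
    rw [pair, ← integral_const_mul]
    simp only [mul_assoc]
  have e2 : (∫ x : Torus, ∑' k, a k * fourier k x * (ψ x : ℂ)) =
      ((∫ x, series a x * ψ x : ℝ) : ℂ) := by
    rw [← integral_complex_ofReal]
    refine integral_congr_ae (Eventually.of_forall fun x => ?_)
    simp only
    rw [tsum_mul_right, (hasSum_series hr ha x).tsum_eq]
    push_cast; rfl
  simp only [e1, e2] at key
  exact key

lemma hat_series (hr : IsReal a) (ha : Summable fun k => ‖a k‖) (k : ℤ) :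
    hat (series a) k = a k := by
  have hs : Summable fun j => a j • (fourier j : C(Torus, ℂ)) :=
    Summable.of_norm (by simpa only [norm_smul, fourier_norm, mul_one] using ha)
  have h1 : HasSum (fun j => a j • (fourierLp 2 j : Lp ℂ 2 (@AddCircle.haarAddCircle (2 * π) _)))
      (ContinuousMap.toLp (E := ℂ) 2 AddCircle.haarAddCircle ℂ (∑' j, a j • fourier j)) := by
    have := (ContinuousMap.toLp (E := ℂ) 2 (@AddCircle.haarAddCircle (2 * π) _) ℂ).hasSum hs.hasSum
    simpa using this
  let L : Lp ℂ 2 (@AddCircle.haarAddCircle (2 * π) _) →L[ℂ] ℂ := (lp.evalCLM ℂ (fun _ : ℤ => ℂ) 2 k).comp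
    (fourierBasis (T := 2 * π)).repr.toContinuousLinearEquiv.toContinuousLinearMap
  have hL : ∀ f, L f = fourierCoeff (T := 2 * π) f k := fun f => fourierBasis_repr f k
  have e1 : ∀ j, L (a j • fourierLp 2 j) = a j * (Pi.single j 1 : ℤ → ℂ) k := by
    intro j
    rw [map_smul, hL, fourierLp, fourierCoeff_toLp, fourierCoeff_fourier, smul_eq_mul]
  have h4 : HasSum (fun j => a j * (Pi.single j 1 : ℤ → ℂ) k)
      (fourierCoeff (∑' j, a j • fourier j : C(Torus, ℂ)) k) := by
    have := L.hasSum h1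
    simpa only [e1, hL, fourierCoeff_toLp] using this
  have h5 : HasSum (fun j => a j * (Pi.single j 1 : ℤ → ℂ) k) (a k) := by
    convert hasSum_single k (f := fun j => a j * (Pi.single j 1 : ℤ → ℂ) k) fun j hj => ?_ using 1
    · simp
    · simp [hj.symm]
  rw [← h4.unique h5, hat]
  congr 1
  funext x
  rw [← (hasSum_series hr ha x).tsum_eq]
  have := (ContinuousMap.evalCLM ℂ x).hasSum hs.hasSum
  exact this.tsum_eq

/-- A square integrable function with absolutely summable Fourier coefficients is the sum of its
Fourier series. -/
lemma ae_eq_series {u : Torus → ℝ} (hu : MemLp u 2) (hr : IsReal (hat u))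
    (hs : Summable fun k => ‖hat u k‖) : u =ᵐ[volume] series (hat u) := by
  have hc : Continuous fun x => (series (hat u) x : ℂ) :=
    Complex.continuous_ofReal.comp (continuous_series hs)
  have hu' : MemLp (fun x => (u x : ℂ)) 2 (@AddCircle.haarAddCircle (2 * π) _) :=
    memLp_haarAddCircle_iff.2 hu.ofReal
  let F : C(Torus, ℂ) := ⟨_, hc⟩
  have key : hu'.toLp = ContinuousMap.toLp (E := ℂ) 2 (@AddCircle.haarAddCircle (2 * π) _) ℂ F := by
    apply (fourierBasis (T := 2 * π)).repr.injective
    ext k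
    rw [fourierBasis_repr, fourierBasis_repr, fourierCoeff_toLp,
      fourierCoeff_congr_ae hu'.coeFn_toLp]
    exact (hat_series hr hs k).symm
  have h1 := hu'.coeFn_toLp
  rw [key] at h1
  have h2 : (fun x => (u x : ℂ)) =ᵐ[volume] F := by
    rw [AddCircle.volume_eq_smul_haarAddCircle]
    exact Measure.smul_absolutelyContinuous (h1.symm.trans (ContinuousMap.coeFn_toLp _ F))
  filter_upwards [h2] with x hx
  exact Complex.ofReal_injective hx

lemma isReal_hat (u : Torus → ℝ) : IsReal (hat u) := fun k => by
  simp only [hat, fourierCoeff, ← integral_conj]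
  refine integral_congr_ae (Eventually.of_forall fun x => ?_)
  simp

lemma hat_zero {u : Torus → ℝ} (hu : ∫ x, u x = 0) : hat u 0 = 0 := by
  rw [hat, fourierCoeff, AddCircle.integral_haarAddCircle]
  simp [integral_complex_ofReal, hu]

lemma norm_der_le_of_le (h0 : a 0 = 0) {m n : ℕ} (h : m ≤ n) (k : ℤ) :
    ‖der m a k‖ ≤ ‖der n a k‖ := by
  rw [norm_der, norm_der]
  rcases eq_or_ne k 0 with rfl | hk
  · simp [h0]
  · exact mul_le_mul_of_nonneg_right (pow_le_pow_right₀ (one_le_abs_cast hk) h) (norm_nonneg _)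

lemma summable_der_of_le (h0 : a 0 = 0) {m n : ℕ} (h : m ≤ n)
    (hs : Summable fun k => ‖der n a k‖) : Summable fun k => ‖der m a k‖ :=
  hs.of_nonneg_of_le (fun _ => norm_nonneg _) (norm_der_le_of_le h0 h)

lemma der_apply_zero (h0 : a 0 = 0) (n : ℕ) : der n a 0 = 0 := by simp [der, h0]

lemma der_der (m n : ℕ) : der m (der n a) = der (m + n) a := by
  funext k; simp only [der]; ring

/-! ### Derivatives on the torus -/

lemma hasDerivAt_fourier_torus (k : ℤ) (y : ℝ) :
    HasDerivAt (fun y : ℝ => (fourier k (y : Torus) : ℂ)) (Complex.I * k * fourier k (y : Torus))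
      y := by
  convert hasDerivAt_fourier (2 * π) k y using 2
  have : (π : ℂ) ≠ 0 := by exact_mod_cast Real.pi_ne_zero
  push_cast
  field_simp

lemma hasDerivAt_series (h0 : a 0 = 0) (hs : Summable fun k => ‖der 1 a k‖) (y : ℝ) :
    HasDerivAt (fun y : ℝ => series a (y : Torus)) (series (der 1 a) (y : Torus)) y := by
  have hs0 : Summable fun k => ‖a k‖ := by
    simpa [der_zero] using summable_der_of_le h0 (Nat.zero_le 1) hs
  have := hasDerivAt_tsum (g := fun k (y : ℝ) => a k * fourier k (y : Torus))
    (g' := fun k (y : ℝ) => der 1 a k * fourier k (y : Torus)) hs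
    (fun k y => by
      refine ((hasDerivAt_fourier_torus k y).const_mul (a k)).congr_deriv ?_
      rw [der]; ring)
    (fun k y => (norm_mul_fourier _ _ _).le) (summable_mul_fourier hs0 ((0 : ℝ) : Torus)) y
  exact Complex.reCLM.hasFDerivAt.comp_hasDerivAt y this

lemma dx_coe (φ : Torus → ℝ) (y : ℝ) :
    dx φ (y : Torus) = deriv (fun y : ℝ => φ (y : Torus)) y := by
  have h : (fun h : ℝ => φ ((y : Torus) + (h : Torus))) =
      fun h => (fun y : ℝ => φ (y : Torus)) (y + h) := by
    funext h; simp only [AddCircle.coe_add]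
  rw [dx, h, deriv_comp_const_add (fun y : ℝ => φ (y : Torus)), add_zero]

lemma dx_series (h0 : a 0 = 0) (hs : Summable fun k => ‖der 1 a k‖) :
    dx (series a) = series (der 1 a) := by
  funext x
  induction x using QuotientAddGroup.induction_on with
  | H y => exact (dx_coe _ y).trans (hasDerivAt_series h0 hs y).deriv

lemma iterate_dx_series (n : ℕ) (h0 : a 0 = 0) (hs : Summable fun k => ‖der n a k‖) :
    dx^[n] (series a) = series (der n a) := by
  induction n with
  | zero => simp [der_zero]
  | succ n ih =>
    rw [Function.iterate_succ_apply', ih (summable_der_of_le h0 n.le_succ hs),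
      dx_series (der_apply_zero h0 n) (by rwa [← der_succ]), ← der_succ]

lemma contDiff_series (n : ℕ) (h0 : a 0 = 0) (hs : Summable fun k => ‖der n a k‖) :
    ContDiff ℝ n fun y : ℝ => series a (y : Torus) := by
  induction n generalizing a with
  | zero =>
    simp only [der_zero] at hs
    exact contDiff_zero.2 ((continuous_series hs).comp continuous_quotient_mk')
  | succ n ih =>
    have h1 := summable_der_of_le h0 (Nat.le_add_left 1 n) hs
    rw [Nat.cast_add, Nat.cast_one, contDiff_succ_iff_deriv]
    refine ⟨fun y => (hasDerivAt_series h0 h1 y).differentiableAt, by simp, ?_⟩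
    rw [funext fun y => (hasDerivAt_series h0 h1 y).deriv]
    exact ih (der_apply_zero h0 1) (by rwa [der_der])

lemma continuous_of_coe {X : Type*} [TopologicalSpace X] {φ : Torus → X}
    (h : Continuous fun y : ℝ => φ (y : Torus)) : Continuous φ :=
  (QuotientAddGroup.isQuotientMap_mk _).continuous_iff.2 h

lemma continuous_dx {φ : Torus → ℝ} (hφ : ContDiff ℝ 1 fun y : ℝ => φ (y : Torus)) :
    Continuous (dx φ) := by
  refine continuous_of_coe ?_
  simp only [dx_coe]
  exact hφ.continuous_deriv le_rfl

lemma pair_dx (k : ℤ) {φ : Torus → ℝ} (hφ : ContDiff ℝ 1 fun y : ℝ => φ (y : Torus)) :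
    pair k (dx φ) = -(Complex.I * k) * pair k φ := by
  have hφc : Continuous φ := continuous_of_coe hφ.continuous
  have hc : Continuous fun x : Torus => (fourier k x : ℂ) := ContinuousMap.continuous _
  have c1 : Continuous fun x : Torus => (fourier k x : ℂ) * (dx φ x : ℂ) :=
    hc.mul (Complex.continuous_ofReal.comp (continuous_dx hφ))
  have c2 : Continuous fun x : Torus => (fourier k x : ℂ) * (φ x : ℂ) :=
    hc.mul (Complex.continuous_ofReal.comp hφc)
  have hd : ∀ y : ℝ, HasDerivAt (fun y : ℝ => (fourier k (y : Torus) : ℂ) * (φ (y : Torus) : ℂ))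
      (Complex.I * k * (fourier k (y : Torus) * (φ (y : Torus) : ℂ)) +
        fourier k (y : Torus) * (dx φ (y : Torus) : ℂ)) y := fun y => by
    have h1 : HasDerivAt (fun y : ℝ => φ (y : Torus)) (dx φ (y : Torus)) y := by
      rw [dx_coe]; exact (hφ.differentiable one_ne_zero y).hasDerivAt
    refine ((hasDerivAt_fourier_torus k y).mul h1.ofReal_comp).congr_deriv ?_
    ring
  have c3 : Continuous fun x : Torus => Complex.I * k * (fourier k x * (φ x : ℂ)) +
        fourier k x * (dx φ x : ℂ) := (continuous_const.mul c2).add c1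
  have e := intervalIntegral.integral_eq_sub_of_hasDerivAt (a := 0) (b := 0 + 2 * π)
    (fun y _ => hd y) ((c3.comp continuous_quotient_mk').intervalIntegrable _ _)
  rw [AddCircle.intervalIntegral_preimage (2 * π) 0 fun x : Torus =>
    Complex.I * k * (fourier k x * (φ x : ℂ)) + fourier k x * (dx φ x : ℂ)] at e
  have hp : ((0 + 2 * π : ℝ) : Torus) = ((0 : ℝ) : Torus) := by
    rw [zero_add, AddCircle.coe_period]; rfl
  rw [hp, sub_self, integral_add, integral_const_mul] at e
  · rw [pair, pair]; linear_combination e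
  · exact (continuous_const.mul c2).integrable_of_hasCompactSupport
      (HasCompactSupport.of_compactSpace _)
  · exact c1.integrable_of_hasCompactSupport (HasCompactSupport.of_compactSpace _)

lemma contDiff_dx {φ : Torus → ℝ} (hφ : ContDiff ℝ (⊤ : ℕ∞) fun y : ℝ => φ (y : Torus)) :
    ContDiff ℝ (⊤ : ℕ∞) fun y : ℝ => dx φ (y : Torus) := by
  simp only [dx_coe]
  exact (contDiff_infty_iff_deriv.1 hφ).2

lemma contDiff_iterate_dx {φ : Torus → ℝ} (hφ : ContDiff ℝ (⊤ : ℕ∞) fun y : ℝ => φ (y : Torus))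
    (n : ℕ) : ContDiff ℝ (⊤ : ℕ∞) fun y : ℝ => (dx^[n] φ) (y : Torus) := by
  induction n with
  | zero => exact hφ
  | succ n ih => simp only [Function.iterate_succ_apply']; exact contDiff_dx ih

lemma pair_iterate_dx (k : ℤ) {φ : Torus → ℝ}
    (hφ : ContDiff ℝ (⊤ : ℕ∞) fun y : ℝ => φ (y : Torus)) (n : ℕ) :
    pair k (dx^[n] φ) = (-(Complex.I * k)) ^ n * pair k φ := by
  induction n with
  | zero => simp
  | succ n ih =>
    rw [Function.iterate_succ_apply', pair_dx k ((contDiff_iterate_dx hφ n).of_le (by simp)), ih]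
    ring

lemma integral_series_mul_iterate_dx (n : ℕ) (hr : IsReal a) (h0 : a 0 = 0)
    (hs : Summable fun k => ‖der n a k‖) {φ : Torus → ℝ}
    (hφ : ContDiff ℝ (⊤ : ℕ∞) fun y : ℝ => φ (y : Torus)) :
    ∫ x, series a x * (dx^[n] φ) x = (-1) ^ n * ∫ x, series (der n a) x * φ x := by
  have hs0 : Summable fun k => ‖a k‖ := by
    simpa only [der_zero] using summable_der_of_le h0 (Nat.zero_le n) hs
  have h1 := hasSum_pair hr hs0 (continuous_of_coe (contDiff_iterate_dx hφ n).continuous)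
  have h2 := (hasSum_pair (hr.der n) hs (continuous_of_coe hφ.continuous)).mul_left ((-1) ^ n)
  have : (fun k => a k * pair k (dx^[n] φ)) = fun k => (-1) ^ n * (der n a k * pair k φ) := by
    funext k
    rw [pair_iterate_dx k hφ, der, neg_pow]
    ring
  rw [this] at h1
  exact_mod_cast h1.unique h2

lemma isWeakDeriv_series (n : ℕ) (hr : IsReal a) (h0 : a 0 = 0)
    (hs : Summable fun k => ‖der n a k‖) : IsWeakDeriv n (series a) (series (der n a)) := by
  have hs0 : Summable fun k => ‖a k‖ := by
    simpa only [der_zero] using summable_der_of_le h0 (Nat.zero_le n) hs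
  exact ⟨integrable_of_continuous (continuous_series hs0),
    integrable_of_continuous (continuous_series hs),
    fun φ hφ => integral_series_mul_iterate_dx n hr h0 hs hφ⟩

end Series

/-! ### Norms of Fourier series -/

section Series

variable {a b : ℤ → ℂ}

lemma exists_coe_eq_norm_eq (x : Torus) : ∃ z : ℝ, (z : Torus) = x ∧ ‖x‖ = |z| := by
  induction x using QuotientAddGroup.induction_on with
  | H y =>
    refine ⟨y - round ((2 * π)⁻¹ * y) * (2 * π), ?_, AddCircle.norm_eq (2 * π)⟩
    rw [AddCircle.coe_sub, sub_eq_self, ← zsmul_eq_mul, AddCircle.coe_zsmul, AddCircle.coe_period,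
      smul_zero]

lemma lipschitzWith_series (h0 : a 0 = 0) (hs : Summable fun k => ‖der 1 a k‖) {K : ℝ≥0}
    (hK : ∑' k, ‖der 1 a k‖ ≤ K) : LipschitzWith K (series a) := by
  have hl : LipschitzWith K fun y : ℝ => series a (y : Torus) := by
    refine lipschitzWith_of_nnnorm_deriv_le
      (fun y => (hasDerivAt_series h0 hs y).differentiableAt) fun y => ?_
    rw [(hasDerivAt_series h0 hs y).deriv, ← NNReal.coe_le_coe, coe_nnnorm]
    exact (abs_series_le hs _).trans hK
  refine LipschitzWith.of_dist_le_mul fun x y => ?_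
  obtain ⟨z, hz, hz'⟩ := exists_coe_eq_norm_eq (x - y)
  induction y using QuotientAddGroup.induction_on with
  | H y =>
    have hx : x = ((y + z : ℝ) : Torus) := by
      rw [AddCircle.coe_add, hz]; exact (add_sub_cancel _ _).symm
    rw [dist_eq_norm x, hz', hx]
    refine (hl.dist_le_mul (y + z) y).trans (le_of_eq ?_)
    rw [Real.dist_eq, add_sub_cancel_left]

lemma holderNorm_series_le {α : ℝ≥0} (hα : α ≤ 1) (h0 : a 0 = 0)
    (hs : Summable fun k => ‖der 4 a k‖) :
    holderNorm 3 α (series a) ≤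
      (4 + ((2 * π).toNNReal ^ ((1 : ℝ) - α) : ℝ≥0)) * ENNReal.ofReal (∑' k, ‖der 4 a k‖) := by
  have hsum : ∀ j ∈ Finset.range (3 + 1), Summable fun k => ‖der j a k‖ := fun j hj =>
    summable_der_of_le h0 (by rw [Finset.mem_range] at hj; omega) hs
  have hle : ∀ j ∈ Finset.range (3 + 1), ∑' k, ‖der j a k‖ ≤ ∑' k, ‖der 4 a k‖ := fun j hj =>
    (hsum j hj).tsum_le_tsum (norm_der_le_of_le h0 (by rw [Finset.mem_range] at hj; omega)) hs
  rw [holderNorm, add_mul]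
  refine add_le_add ?_ ?_
  · refine (Finset.sum_le_card_nsmul _ _ (ENNReal.ofReal (∑' k, ‖der 4 a k‖)) fun j hj => ?_).trans
      (by simp)
    refine iSup_le fun x => ?_
    rw [iterate_dx_series j h0 (hsum j hj), Real.enorm_eq_ofReal_abs]
    exact ENNReal.ofReal_le_ofReal ((abs_series_le (hsum j hj) x).trans (hle j hj))
  · rw [iterate_dx_series 3 h0 (hsum 3 (by simp))]
    have hl : LipschitzWith (∑' k, ‖der 4 a k‖).toNNReal (series (der 3 a)) :=
      lipschitzWith_series (der_apply_zero h0 3) (by rwa [der_der])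
        (by rw [der_der, Real.coe_toNNReal _ (tsum_nonneg fun _ => norm_nonneg _)])
    have hd : ∀ x y : Torus, edist x y ≤ (2 * π).toNNReal := fun x y => by
      rw [edist_nndist, ENNReal.coe_le_coe, ← NNReal.coe_le_coe, coe_nndist, dist_eq_norm,
        Real.coe_toNNReal _ Real.two_pi_pos.le]
      refine (AddCircle.norm_le_half_period _ Real.two_pi_pos.ne').trans ?_
      rw [abs_of_pos Real.two_pi_pos]
      linarith [Real.two_pi_pos]
    have := ((holderWith_one.2 hl).of_le hd hα).eHolderNorm_le
    refine this.trans (le_of_eq ?_)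
    push_cast
    rw [mul_comm]
    rfl

lemma eLpNorm_top_series_le (hs : Summable fun k => ‖a k‖) :
    eLpNorm (series a) ∞ volume ≤ ENNReal.ofReal (∑' k, ‖a k‖) := by
  rw [eLpNorm_exponent_top]
  refine eLpNormEssSup_le_of_ae_bound (Eventually.of_forall fun x => ?_)
  exact abs_series_le hs x

lemma eLpNorm_one_series_le (hs : Summable fun k => ‖a k‖) :
    eLpNorm (series a) 1 volume ≤ ENNReal.ofReal (2 * π) * ENNReal.ofReal (∑' k, ‖a k‖) := by
  refine (eLpNorm_le_of_ae_bound (C := ∑' k, ‖a k‖)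
    (Eventually.of_forall fun x => abs_series_le hs x)).trans (le_of_eq ?_)
  rw [AddCircle.measure_univ]
  simp

lemma memLp_series (hs : Summable fun k => ‖a k‖) (p : ℝ≥0∞) : MemLp (series a) p :=
  MemLp.of_bound (continuous_series hs).aestronglyMeasurable (∑' k, ‖a k‖)
    (Eventually.of_forall fun x => abs_series_le hs x)

/-- The product of two Fourier series. -/
noncomputable def cauchy (a b : ℤ → ℂ) (k : ℤ) : ℂ := ∑' l, a l * b (k - l)

/-- The bijection `(k, l) ↦ (l, k - l)`. -/
def convEquiv : ℤ × ℤ ≃ ℤ × ℤ where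
  toFun p := (p.2, p.1 - p.2)
  invFun p := (p.1 + p.2, p.1)
  left_inv p := by simp
  right_inv p := by simp

lemma summable_norm_cauchy (ha : Summable fun k => ‖a k‖) (hb : Summable fun k => ‖b k‖) :
    Summable (fun p : ℤ × ℤ => ‖a p.2 * b (p.1 - p.2)‖) := by
  have h := (summable_mul_of_summable_norm (f := fun k => (‖a k‖ : ℝ)) (g := fun k => (‖b k‖ : ℝ))
    (by simpa using ha) (by simpa using hb))
  simp only [norm_mul]
  exact convEquiv.summable_iff.2 h

lemma summable_norm_cauchy_apply (ha : Summable fun k => ‖a k‖) (hb : Summable fun k => ‖b k‖) :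
    (Summable fun k => ‖cauchy a b k‖) ∧ ∀ k, Summable fun l => a l * b (k - l) := by
  have h := summable_norm_cauchy ha hb
  have h1 : ∀ k, Summable fun l => ‖a l * b (k - l)‖ := fun k => h.prod_factor k
  exact ⟨h.prod.of_nonneg_of_le (fun _ => norm_nonneg _) fun k => norm_tsum_le_tsum_norm (h1 k),
    fun k => (h1 k).of_norm⟩

lemma tsum_norm_cauchy_le (ha : Summable fun k => ‖a k‖) (hb : Summable fun k => ‖b k‖) :
    ∑' k, ‖cauchy a b k‖ ≤ (∑' k, ‖a k‖) * ∑' k, ‖b k‖ := by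
  have h := summable_norm_cauchy ha hb
  have h1 : (∑' k, ‖a k‖) * ∑' k, ‖b k‖ = ∑' k, ∑' l, ‖a l * b (k - l)‖ := by
    rw [tsum_mul_tsum_of_summable_norm (by simpa using ha) (by simpa using hb),
      ← convEquiv.tsum_eq, ← h.tsum_prod]
    simp only [norm_mul]
    rfl
  rw [h1]
  exact (summable_norm_cauchy_apply ha hb).1.tsum_le_tsum
    (fun k => norm_tsum_le_tsum_norm (h.prod_factor k)) h.prod

lemma series_mul_series (ha : Summable fun k => ‖a k‖) (hb : Summable fun k => ‖b k‖)
    (hra : IsReal a) (hrb : IsReal b) (x : Torus) :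
    HasSum (fun k => cauchy a b k * fourier k x) ((series a x * series b x : ℝ) : ℂ) := by
  have h1 := summable_mul_of_summable_norm (f := fun k => a k * (fourier k x : ℂ))
    (g := fun k => b k * (fourier k x : ℂ)) (by simpa only [norm_mul_fourier] using ha)
    (by simpa only [norm_mul_fourier] using hb)
  have h2 := (hasSum_series hra ha x).mul (hasSum_series hrb hb x) h1
  rw [← convEquiv.hasSum_iff] at h2
  have h3 := h2.prod_fiberwise (g := fun k => cauchy a b k * fourier k x) fun k => by
    have h := ((summable_norm_cauchy_apply ha hb).2 k).hasSum.mul_right (fourier k x : ℂ)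
    have e : (fun l => a l * b (k - l) * (fourier k x : ℂ)) =
        fun l => a l * fourier l x * (b (k - l) * fourier (k - l) x) := by
      funext l
      rw [show (fourier k x : ℂ) = fourier l x * fourier (k - l) x by
        rw [← fourier_add, add_sub_cancel]]
      ring
    rw [e] at h
    exact h
  push_cast
  exact h3

lemma series_cauchy (ha : Summable fun k => ‖a k‖) (hb : Summable fun k => ‖b k‖)
    (hra : IsReal a) (hrb : IsReal b) (x : Torus) :
    series (cauchy a b) x = series a x * series b x := by
  rw [series, (series_mul_series ha hb hra hrb x).tsum_eq, Complex.ofReal_re]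

lemma series_add (ha : Summable fun k => ‖a k‖) (hb : Summable fun k => ‖b k‖) (x : Torus) :
    series (fun k => a k + b k) x = series a x + series b x := by
  simp only [series, add_mul]
  rw [(summable_mul_fourier ha x).tsum_add (summable_mul_fourier hb x), Complex.add_re]

lemma series_const_mul (c : ℝ) (x : Torus) :
    series (fun k => c * a k) x = c * series a x := by
  simp only [series, mul_assoc]
  rw [tsum_mul_left, Complex.re_ofReal_mul]

end Series

lemma tendsto_modes : Tendsto modes atTop atTop := by
  refine tendsto_atTop_finset_of_monotone (fun m n h k hk => ?_) fun k => ⟨k.natAbs, ?_⟩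
  · rw [mem_modes] at hk ⊢
    exact hk.trans (by exact_mod_cast h)
  · rw [mem_modes]
    exact (Int.natCast_natAbs k).ge

/-- Fourier series with coefficients depending continuously on time are jointly measurable. -/
lemma stronglyMeasurable_series {c : ℝ → ℤ → ℂ} (hc : ∀ k, Continuous fun t => c t k)
    {ν : Measure ℝ} [SFinite ν] (hs : ∀ᵐ t ∂ν, Summable fun k => ‖c t k‖) :
    AEStronglyMeasurable (fun p : ℝ × Torus => series (c p.1) p.2)
      (ν.prod (volume : Measure Torus)) := by
  have h1 : ∀ n : ℕ, Continuous fun p : ℝ × Torus =>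
      (∑ k ∈ modes n, c p.1 k * (fourier k p.2 : ℂ)).re := fun n =>
    Complex.continuous_re.comp (continuous_finsetSum _ fun k _ =>
      ((hc k).comp continuous_fst).mul ((ContinuousMap.continuous _).comp continuous_snd))
  refine aestronglyMeasurable_of_tendsto_ae atTop (fun n => (h1 n).aestronglyMeasurable) ?_
  have h2 := Measure.quasiMeasurePreserving_fst (μ := ν) (ν := (volume : Measure Torus)) |>.ae hs
  filter_upwards [h2] with p hp
  exact (Complex.continuous_re.tendsto _).comp
    ((summable_mul_fourier hp p.2).hasSum.comp tendsto_modes)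


/-! ### Series of nonnegative functions of time -/

section TimeSeries

variable {g : ℤ → ℝ → ℝ} {T M : ℝ}

lemma lintegral_tsum_le (hg : ∀ k t, 0 ≤ g k t) (hc : ∀ k, Continuous (g k)) (hT : 0 ≤ T)
    (h : ∀ S : Finset ℤ, ∫ t in (0 : ℝ)..T, ∑ k ∈ S, g k t ≤ M) :
    ∫⁻ t in Ioo 0 T, ∑' k, ENNReal.ofReal (g k t) ≤ ENNReal.ofReal M := by
  rw [lintegral_tsum fun k => (hc k).measurable.ennreal_ofReal.aemeasurable]
  rw [ENNReal.tsum_eq_iSup_sum]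
  refine iSup_le fun S => ?_
  rw [← lintegral_finsetSum _ fun k _ => (hc k).measurable.ennreal_ofReal]
  simp only [← ENNReal.ofReal_sum_of_nonneg fun k (_ : k ∈ S) => hg k _]
  rw [← ofReal_integral_eq_lintegral_ofReal]
  · refine ENNReal.ofReal_le_ofReal ?_
    rw [← integral_Ioc_eq_integral_Ioo, ← intervalIntegral.integral_of_le hT]
    exact h S
  · exact ((continuous_finsetSum _ fun k _ => hc k).integrableOn_Icc).mono_set Ioo_subset_Icc_self
  · exact Eventually.of_forall fun t => Finset.sum_nonneg fun k _ => hg k t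

lemma ae_summable_of_integral_le (hg : ∀ k t, 0 ≤ g k t) (hc : ∀ k, Continuous (g k)) (hT : 0 ≤ T)
    (h : ∀ S : Finset ℤ, ∫ t in (0 : ℝ)..T, ∑ k ∈ S, g k t ≤ M) :
    ∀ᵐ t ∂(volume : Measure ℝ).restrict (Ioo 0 T), Summable fun k => g k t := by
  have hm : Measurable fun t => ∑' k, ENNReal.ofReal (g k t) :=
    Measurable.tsum fun k => (hc k).measurable.ennreal_ofReal
  filter_upwards [ae_lt_top hm ((lintegral_tsum_le hg hc hT h).trans_lt ENNReal.ofReal_lt_top).ne]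
    with t ht
  have := ENNReal.summable_toReal ht.ne
  simpa only [ENNReal.toReal_ofReal (hg _ _)] using this

lemma lintegral_ofReal_tsum_le (hg : ∀ k t, 0 ≤ g k t) (hc : ∀ k, Continuous (g k)) (hT : 0 ≤ T)
    (h : ∀ S : Finset ℤ, ∫ t in (0 : ℝ)..T, ∑ k ∈ S, g k t ≤ M) :
    ∫⁻ t in Ioo 0 T, ENNReal.ofReal (∑' k, g k t) ≤ ENNReal.ofReal M := by
  refine le_trans (lintegral_mono_ae ?_) (lintegral_tsum_le hg hc hT h)
  filter_upwards [ae_summable_of_integral_le hg hc hT h] with t ht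
  rw [ENNReal.ofReal_tsum_of_nonneg (fun k => hg k t) ht]

lemma integrableOn_tsum (hg : ∀ k t, 0 ≤ g k t) (hc : ∀ k, Continuous (g k)) (hT : 0 ≤ T)
    (h : ∀ S : Finset ℤ, ∫ t in (0 : ℝ)..T, ∑ k ∈ S, g k t ≤ M) :
    IntegrableOn (fun t => ∑' k, g k t) (Ioo 0 T) := by
  refine ⟨?_, ?_⟩
  · have hm : Measurable fun t => (∑' k, ENNReal.ofReal (g k t)).toReal :=
      (Measurable.tsum fun k => (hc k).measurable.ennreal_ofReal).ennreal_toReal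
    refine hm.aestronglyMeasurable.congr ?_
    filter_upwards [ae_summable_of_integral_le hg hc hT h] with t ht
    rw [← ENNReal.ofReal_tsum_of_nonneg (fun k => hg k t) ht,
      ENNReal.toReal_ofReal (tsum_nonneg fun k => hg k t)]
  · rw [hasFiniteIntegral_iff_ofReal (Eventually.of_forall fun t => tsum_nonneg fun k => hg k t)]
    exact (lintegral_ofReal_tsum_le hg hc hT h).trans_lt ENNReal.ofReal_lt_top

lemma integral_tsum_le (hg : ∀ k t, 0 ≤ g k t) (hc : ∀ k, Continuous (g k)) (hT : 0 ≤ T)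
    (hM : 0 ≤ M) (h : ∀ S : Finset ℤ, ∫ t in (0 : ℝ)..T, ∑ k ∈ S, g k t ≤ M) :
    ∫ t in Ioo 0 T, ∑' k, g k t ≤ M := by
  rw [integral_eq_lintegral_of_nonneg_ae
    (Eventually.of_forall fun t => tsum_nonneg fun k => hg k t)
    (integrableOn_tsum hg hc hT h).aestronglyMeasurable]
  exact ENNReal.toReal_le_of_le_ofReal hM (lintegral_ofReal_tsum_le hg hc hT h)

end TimeSeries

/-! ### Membership in the function spaces -/

/-- The coefficients `c t` of a time dependent real Fourier series with zero mean, with the bounds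
which place it in the regularity classes of the solutions. -/
structure IsRegularCurve (c : ℝ → ℤ → ℂ) : Prop where
  symm : ∀ t, IsReal (c t)
  zero : ∀ t, c t 0 = 0
  cont : ∀ k, Continuous fun t => c t k
  bounded : ∃ E, ∀ t, 0 ≤ t → ∀ S : Finset ℤ, ∑ k ∈ S, ‖c t k‖ ≤ E
  int_wiener : ∃ M, ∀ T, 0 ≤ T → ∀ S : Finset ℤ,
    ∫ t in (0 : ℝ)..T, ∑ k ∈ S, ‖der 4 (c t) k‖ ≤ M
  int_energy : ∃ M, ∀ T, 0 ≤ T → ∀ S : Finset ℤ,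
    ∫ t in (0 : ℝ)..T, ∑ k ∈ S, |(k : ℝ)| ^ 8 * ‖c t k‖ ^ 2 ≤ M
  dominated : ∀ T, 0 ≤ T → ∃ g : ℤ → ℝ, Summable g ∧
    ∀ t ∈ Icc 0 T, ∀ k : ℤ, |(k : ℝ)| ^ 4 * ‖c t k‖ ^ 2 ≤ g k

lemma abs_rpow_two_mul (k : ℤ) (n : ℕ) : |(k : ℝ)| ^ (2 * (n : ℝ)) = |(k : ℝ)| ^ (2 * n) := by
  rw [← Real.rpow_natCast]; push_cast; rfl

lemma hNormSq_series {a : ℤ → ℂ} (hr : IsReal a) (hs : Summable fun k => ‖a k‖) (n : ℕ) :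
    hNormSq n (series a) = ∑' k : ℤ, |(k : ℝ)| ^ (2 * n) * ‖a k‖ ^ 2 := by
  simp only [hNormSq, hat_series hr hs, abs_rpow_two_mul]

lemma integral_series {a : ℤ → ℂ} (hr : IsReal a) (h0 : a 0 = 0) (hs : Summable fun k => ‖a k‖) :
    ∫ x, series a x = 0 := by
  have h := hat_series hr hs 0
  rw [h0, hat, fourierCoeff, AddCircle.integral_haarAddCircle] at h
  have hp : (2 * π)⁻¹ ≠ 0 := inv_ne_zero Real.two_pi_pos.ne'
  simp only [neg_zero, fourier_zero, one_smul, integral_complex_ofReal, smul_eq_zero, hp,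
    false_or, Complex.ofReal_eq_zero] at h
  exact h

lemma memHdot_series {a : ℤ → ℂ} (hr : IsReal a) (h0 : a 0 = 0) (hs : Summable fun k => ‖a k‖)
    (n : ℕ) (h : Summable fun k : ℤ => |(k : ℝ)| ^ (2 * n) * ‖a k‖ ^ 2) :
    MemHdot n (series a) :=
  ⟨memLp_series hs 2, integral_series hr h0 hs, by
    simpa only [hat_series hr hs, abs_rpow_two_mul] using h⟩

/-- The square of the Wiener norm of order three is controlled by the energy of order four. -/
lemma sq_tsum_der_three_le {a : ℤ → ℂ} (h0 : a 0 = 0)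
    (h : Summable fun k : ℤ => |(k : ℝ)| ^ 8 * ‖a k‖ ^ 2) :
    (∑' k, ‖der 3 a k‖) ^ 2 ≤
      (∑' k : ℤ, 1 / (k : ℝ) ^ 2) * ∑' k : ℤ, |(k : ℝ)| ^ 8 * ‖a k‖ ^ 2 := by
  have hk : Summable fun k : ℤ => 1 / (k : ℝ) ^ 2 := Real.summable_one_div_int_pow.2 one_lt_two
  set R := (∑' k : ℤ, 1 / (k : ℝ) ^ 2) * ∑' k : ℤ, |(k : ℝ)| ^ 8 * ‖a k‖ ^ 2
  have hR : 0 ≤ R := mul_nonneg (tsum_nonneg fun k => by positivity)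
    (tsum_nonneg fun k => by positivity)
  refine (Real.le_sqrt (tsum_nonneg fun k => norm_nonneg _) hR).1 ?_
  refine Real.tsum_le_of_sum_le (fun k => norm_nonneg _) fun S => Real.le_sqrt_of_sq_le ?_
  have e : ∀ k ∈ S, ‖der 3 a k‖ = |(k : ℝ)|⁻¹ * (|(k : ℝ)| ^ 4 * ‖a k‖) := fun k _ => by
    rw [norm_der]
    rcases eq_or_ne k 0 with rfl | hk
    · simp [h0]
    · have : |(k : ℝ)| ≠ 0 := by simpa using hk
      field_simp
  rw [Finset.sum_congr rfl e]
  refine (Finset.sum_mul_sq_le_sq_mul_sq _ _ _).trans (mul_le_mul ?_ ?_ ?_ ?_)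
  · refine le_trans (le_of_eq (Finset.sum_congr rfl fun k _ => ?_))
      (hk.sum_le_tsum S fun k _ => by positivity)
    rw [inv_pow, sq_abs, one_div]
  · refine le_trans (le_of_eq (Finset.sum_congr rfl fun k _ => ?_))
      (h.sum_le_tsum S fun k _ => by positivity)
    ring
  · exact Finset.sum_nonneg fun k _ => by positivity
  · exact tsum_nonneg fun k => by positivity

namespace IsRegularCurve

variable {c : ℝ → ℤ → ℂ} (hc : IsRegularCurve c) {T : ℝ}

end IsRegularCurve

namespace IsRegularCurve

variable {c : ℝ → ℤ → ℂ} {T : ℝ}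

lemma summable (hc : IsRegularCurve c) {t : ℝ} (ht : 0 ≤ t) : Summable fun k => ‖c t k‖ := by
  obtain ⟨E, hE⟩ := hc.bounded
  exact summable_of_sum_le (fun _ => norm_nonneg _) (hE t ht)

lemma continuous_der (hc : IsRegularCurve c) (n : ℕ) (k : ℤ) :
    Continuous fun t => der n (c t) k :=
  continuous_const.mul (hc.cont k)

lemma continuous_energy (hc : IsRegularCurve c) (n : ℕ) (k : ℤ) :
    Continuous fun t => |(k : ℝ)| ^ n * ‖c t k‖ ^ 2 :=
  continuous_const.mul ((hc.cont k).norm.pow 2)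

lemma ae_summable_der (hc : IsRegularCurve c) (hT : 0 ≤ T) :
    ∀ᵐ t ∂(volume : Measure ℝ).restrict (Ioo 0 T), Summable fun k => ‖der 4 (c t) k‖ := by
  obtain ⟨M, hM⟩ := hc.int_wiener
  exact ae_summable_of_integral_le (g := fun k t => ‖der 4 (c t) k‖) (fun _ _ => norm_nonneg _)
    (fun k => (hc.continuous_der 4 k).norm) hT (hM T hT)

lemma lintegral_der_lt_top (hc : IsRegularCurve c) (hT : 0 ≤ T) :
    ∫⁻ t in Ioo 0 T, ENNReal.ofReal (∑' k, ‖der 4 (c t) k‖) < ∞ := by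
  obtain ⟨M, hM⟩ := hc.int_wiener
  exact (lintegral_ofReal_tsum_le (g := fun k t => ‖der 4 (c t) k‖) (fun _ _ => norm_nonneg _)
    (fun k => (hc.continuous_der 4 k).norm) hT (hM T hT)).trans_lt ENNReal.ofReal_lt_top

lemma ae_summable_energy (hc : IsRegularCurve c) (hT : 0 ≤ T) :
    ∀ᵐ t ∂(volume : Measure ℝ).restrict (Ioo 0 T),
      Summable fun k : ℤ => |(k : ℝ)| ^ 8 * ‖c t k‖ ^ 2 := by
  obtain ⟨M, hM⟩ := hc.int_energy
  exact ae_summable_of_integral_le (g := fun k t => |(k : ℝ)| ^ 8 * ‖c t k‖ ^ 2)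
    (fun _ _ => by positivity) (hc.continuous_energy 8) hT (hM T hT)

lemma lintegral_energy_lt_top (hc : IsRegularCurve c) (hT : 0 ≤ T) :
    ∫⁻ t in Ioo 0 T, ENNReal.ofReal (∑' k : ℤ, |(k : ℝ)| ^ 8 * ‖c t k‖ ^ 2) < ∞ := by
  obtain ⟨M, hM⟩ := hc.int_energy
  exact (lintegral_ofReal_tsum_le (g := fun k t => |(k : ℝ)| ^ 8 * ‖c t k‖ ^ 2)
    (fun _ _ => by positivity) (hc.continuous_energy 8) hT (hM T hT)).trans_lt
    ENNReal.ofReal_lt_top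

lemma ae_nonneg (T : ℝ) : ∀ᵐ t ∂(volume : Measure ℝ).restrict (Ioo 0 T), 0 ≤ t := by
  filter_upwards [ae_restrict_mem measurableSet_Ioo] with t ht using ht.1.le

lemma txMeasurable_der (hc : IsRegularCurve c) (hT : 0 ≤ T) {n : ℕ} (hn : n ≤ 4) :
    TXMeasurable T fun t => series (der n (c t)) :=
  stronglyMeasurable_series (c := fun t => der n (c t)) (hc.continuous_der n) (by
    filter_upwards [hc.ae_summable_der hT] with t ht using summable_der_of_le (hc.zero t) hn ht)

lemma txMeasurable (hc : IsRegularCurve c) (hT : 0 ≤ T) : TXMeasurable T fun t => series (c t) := by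
  simpa only [der_zero] using hc.txMeasurable_der hT (Nat.zero_le 4)

lemma isTXDeriv (hc : IsRegularCurve c) (hT : 0 ≤ T) {n : ℕ} (hn : n ≤ 4) :
    IsTXDeriv T n (fun t => series (c t)) fun t => series (der n (c t)) := by
  refine ⟨hc.txMeasurable_der hT hn, ?_⟩
  filter_upwards [hc.ae_summable_der hT] with t ht
  exact isWeakDeriv_series n (hc.symm t) (hc.zero t) (summable_der_of_le (hc.zero t) hn ht)

lemma memLinfty (hc : IsRegularCurve c) (hT : 0 ≤ T) : MemLinfty T fun t => series (c t) := by
  obtain ⟨E, hE⟩ := hc.bounded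
  refine MemLp.of_bound (hc.txMeasurable hT) E ?_
  have h2 := Measure.quasiMeasurePreserving_fst (ν := (volume : Measure Torus)) |>.ae (ae_nonneg T)
  filter_upwards [h2] with p hp
  exact (abs_series_le (hc.summable hp) _).trans
    (Real.tsum_le_of_sum_le (fun _ => norm_nonneg _) (hE _ hp))

lemma memLW_three_one (hc : IsRegularCurve c) (hT : 0 ≤ T) :
    MemLW T 1 3 1 fun t => series (c t) := by
  refine ⟨hc.txMeasurable hT, _, hc.isTXDeriv hT (by norm_num), ?_⟩
  refine lt_of_le_of_lt (lintegral_mono_ae (g := fun t => 2 * ENNReal.ofReal (2 * π) *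
    ENNReal.ofReal (∑' k, ‖der 4 (c t) k‖)) ?_) ?_
  · filter_upwards [hc.ae_summable_der hT] with t ht
    have h : ∀ n ≤ 4, eLpNorm (series (der n (c t))) 1 volume ≤
        ENNReal.ofReal (2 * π) * ENNReal.ofReal (∑' k, ‖der 4 (c t) k‖) := fun n hn => by
      have hs := summable_der_of_le (hc.zero t) hn ht
      exact (eLpNorm_one_series_le hs).trans (mul_le_mul_right (ENNReal.ofReal_le_ofReal
        (hs.tsum_le_tsum (norm_der_le_of_le (hc.zero t) hn) ht)) _)
    have h0 := h 0 (by norm_num)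
    rw [der_zero] at h0
    rw [ENNReal.rpow_one, mul_assoc]
    exact (add_le_add h0 (h 3 (by norm_num))).trans (two_mul _).ge
  · rw [lintegral_const_mul' _ _ (by finiteness)]
    exact ENNReal.mul_lt_top (by finiteness) (hc.lintegral_der_lt_top hT)

lemma memLW_three_top (hc : IsRegularCurve c) (hT : 0 ≤ T) :
    MemLW T (4 / 3) 3 ∞ fun t => series (c t) := by
  refine ⟨hc.txMeasurable hT, _, hc.isTXDeriv hT (by norm_num), ?_⟩
  set K : ℝ := ∑' k : ℤ, 1 / (k : ℝ) ^ 2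
  have hK : 0 ≤ K := tsum_nonneg fun k => by positivity
  refine lt_of_le_of_lt (lintegral_mono_ae (g := fun t => 1 + ENNReal.ofReal (4 * K) *
    ENNReal.ofReal (∑' k : ℤ, |(k : ℝ)| ^ 8 * ‖c t k‖ ^ 2)) ?_) ?_
  · filter_upwards [hc.ae_summable_der hT, hc.ae_summable_energy hT] with t ht ht'
    have hs3 := summable_der_of_le (hc.zero t) (show 3 ≤ 4 by norm_num) ht
    have hs0 := summable_der_of_le (hc.zero t) (show 0 ≤ 4 by norm_num) ht
    have h3 := eLpNorm_top_series_le hs3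
    have h0 := (eLpNorm_top_series_le hs0).trans (ENNReal.ofReal_le_ofReal
      (hs0.tsum_le_tsum (norm_der_le_of_le (hc.zero t) (show 0 ≤ 3 by norm_num)) hs3))
    rw [der_zero] at h0
    set w := ∑' k, ‖der 3 (c t) k‖
    have hw : 0 ≤ w := tsum_nonneg fun _ => norm_nonneg _
    have hx : eLpNorm (series (c t)) ∞ volume + eLpNorm (series (der 3 (c t))) ∞ volume ≤
        ENNReal.ofReal (2 * w) := by
      refine (add_le_add h0 h3).trans (le_of_eq ?_)
      rw [two_mul, ENNReal.ofReal_add hw hw]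
    refine (ENNReal.rpow_le_rpow hx (by norm_num)).trans ?_
    -- `x ^ (4 / 3) ≤ 1 + x ^ 2`
    rcases le_total (ENNReal.ofReal (2 * w)) 1 with h1 | h1
    · exact (ENNReal.rpow_le_one h1 (by norm_num)).trans le_self_add
    · refine (ENNReal.rpow_le_rpow_of_exponent_le h1 (show (4 / 3 : ℝ) ≤ (2 : ℕ) by norm_num)).trans
        (le_trans ?_ le_add_self)
      rw [ENNReal.rpow_natCast, ← ENNReal.ofReal_pow (by positivity),
        ← ENNReal.ofReal_mul (by positivity)]
      refine ENNReal.ofReal_le_ofReal ?_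
      have := sq_tsum_der_three_le (hc.zero t) ht'
      nlinarith
  · rw [lintegral_add_left measurable_const, lintegral_const_mul' _ _ (by finiteness)]
    refine ENNReal.add_lt_top.2 ⟨?_, ENNReal.mul_lt_top (by finiteness)
      (hc.lintegral_energy_lt_top hT)⟩
    simp

lemma memLHolder (hc : IsRegularCurve c) (hT : 0 ≤ T) {α : ℝ≥0} (hα : α ≤ 1) :
    MemLHolder T 3 α fun t => series (c t) := by
  refine ⟨hc.txMeasurable hT, fun t => series (c t), ?_, ?_⟩
  · filter_upwards [hc.ae_summable_der hT] with t ht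
    exact ⟨EventuallyEq.rfl,
      contDiff_series 3 (hc.zero t) (summable_der_of_le (hc.zero t) (by norm_num) ht)⟩
  · refine lt_of_le_of_lt (lintegral_mono_ae ?_) (?_ : ∫⁻ t in Ioo 0 T,
      (4 + ((2 * π).toNNReal ^ ((1 : ℝ) - α) : ℝ≥0)) *
        ENNReal.ofReal (∑' k, ‖der 4 (c t) k‖) < ∞)
    · filter_upwards [hc.ae_summable_der hT] with t ht
      exact holderNorm_series_le hα (hc.zero t) ht
    · rw [lintegral_const_mul' _ _ (by finiteness)]
      exact ENNReal.mul_lt_top (by finiteness) (hc.lintegral_der_lt_top hT)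

lemma lintegral_eLpNorm_top_lt_top (hc : IsRegularCurve c) (hT : 0 ≤ T) {n : ℕ} (hn : n ≤ 4) :
    ∫⁻ t in Ioo 0 T, eLpNorm (series (der n (c t))) ∞ volume < ∞ := by
  refine lt_of_le_of_lt (lintegral_mono_ae ?_) (hc.lintegral_der_lt_top hT)
  filter_upwards [hc.ae_summable_der hT] with t ht
  have hs := summable_der_of_le (hc.zero t) hn ht
  exact (eLpNorm_top_series_le hs).trans (ENNReal.ofReal_le_ofReal
    (hs.tsum_le_tsum (norm_der_le_of_le (hc.zero t) hn) ht))

lemma memMW_four (hc : IsRegularCurve c) (hT : 0 ≤ T) : MemMW T 4 fun t => series (c t) := by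
  have h0 := hc.lintegral_eLpNorm_top_lt_top hT (Nat.zero_le 4)
  simp only [der_zero] at h0
  refine ⟨hc.txMeasurable hT, h0, (volume : Measure ℝ).restrict (Ioo 0 T),
    fun t => series (der 4 (c t)), inferInstance, ?_, ?_, ?_⟩
  · rw [Measure.restrict_restrict measurableSet_Ioo, inter_self]
    exact hc.txMeasurable_der hT le_rfl
  · rw [Measure.restrict_restrict measurableSet_Ioo, inter_self]
    exact hc.lintegral_eLpNorm_top_lt_top hT le_rfl
  · intro η hη _
    rw [Measure.restrict_restrict measurableSet_Ioo, inter_self, ← integral_const_mul]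
    refine integral_congr_ae ?_
    filter_upwards [hc.ae_summable_der hT] with t ht
    exact integral_series_mul_iterate_dx 4 (hc.symm t) (hc.zero t) ht
      (hη.comp (contDiff_const.prodMk contDiff_id))

lemma memL2Hdot_four (hc : IsRegularCurve c) (hT : 0 ≤ T) :
    MemL2Hdot T 4 fun t => series (c t) := by
  refine ⟨hc.txMeasurable hT, ?_, ?_⟩
  · filter_upwards [hc.ae_summable_energy hT, ae_nonneg T] with t ht ht0
    exact_mod_cast memHdot_series (hc.symm t) (hc.zero t) (hc.summable ht0) 4 ht
  · refine lt_of_le_of_lt (lintegral_mono_ae ?_) (hc.lintegral_energy_lt_top hT)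
    filter_upwards [ae_nonneg T] with t ht0
    have := hNormSq_series (hc.symm t) (hc.summable ht0) 4
    rw [Nat.cast_ofNat] at this
    rw [this]

lemma summable_energy_two (hc : IsRegularCurve c) {t : ℝ} (ht : 0 ≤ t) :
    Summable fun k : ℤ => |(k : ℝ)| ^ 4 * ‖c t k‖ ^ 2 := by
  obtain ⟨g, hg, h⟩ := hc.dominated t ht
  exact hg.of_nonneg_of_le (fun _ => by positivity) (h t ⟨ht, le_rfl⟩)

lemma memHdot_two (hc : IsRegularCurve c) {t : ℝ} (ht : 0 ≤ t) : MemHdot 2 (series (c t)) := by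
  exact_mod_cast memHdot_series (hc.symm t) (hc.zero t) (hc.summable ht) 2
    (hc.summable_energy_two ht)

lemma memL2Hdot_two (hc : IsRegularCurve c) (hT : 0 ≤ T) :
    MemL2Hdot T 2 fun t => series (c t) := by
  refine ⟨hc.txMeasurable hT, ?_, ?_⟩
  · filter_upwards [ae_nonneg T] with t ht0 using hc.memHdot_two ht0
  · refine lt_of_le_of_lt (lintegral_mono_ae ?_) (hc.lintegral_energy_lt_top hT)
    filter_upwards [hc.ae_summable_energy hT, ae_nonneg T] with t ht ht0
    have := hNormSq_series (hc.symm t) (hc.summable ht0) 2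
    rw [Nat.cast_ofNat] at this
    rw [this]
    refine ENNReal.ofReal_le_ofReal ((hc.summable_energy_two ht0).tsum_le_tsum (fun k => ?_) ht)
    rcases eq_or_ne k 0 with rfl | hk
    · simp
    · exact mul_le_mul_of_nonneg_right (pow_le_pow_right₀ (one_le_abs_cast hk) (by norm_num))
        (by positivity)

lemma memCHdot_two (hc : IsRegularCurve c) : MemCHdot T 2 fun t => series (c t) := by
  intro t₀ ht₀
  refine ⟨hc.memHdot_two ht₀.1, ?_⟩
  obtain ⟨g, hg, h⟩ := hc.dominated T (ht₀.1.trans ht₀.2)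
  have e : ∀ t ∈ Icc 0 T, hNormSq 2 (fun x => series (c t) x - series (c t₀) x) =
      ∑' k : ℤ, |(k : ℝ)| ^ 4 * ‖c t k - c t₀ k‖ ^ 2 := fun t ht => by
    have h1 := hc.summable ht.1
    have h2 := hc.summable ht₀.1
    have h3 : Summable fun k => ‖c t k - c t₀ k‖ :=
      (h1.add h2).of_nonneg_of_le (fun _ => norm_nonneg _) fun k => norm_sub_le _ _
    have h4 : IsReal fun k => c t k - c t₀ k := fun k => by
      simp only [hc.symm t k, hc.symm t₀ k, map_sub]
    have := hNormSq_series h4 h3 2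
    rw [Nat.cast_ofNat] at this
    rw [← this]
    congr 1
    funext x
    exact (series_sub h1 h2 x).symm
  have key : Tendsto (fun t => ∑' k : ℤ, |(k : ℝ)| ^ 4 * ‖c t k - c t₀ k‖ ^ 2) (𝓝[Icc 0 T] t₀)
      (𝓝 (∑' k : ℤ, |(k : ℝ)| ^ 4 * ‖c t₀ k - c t₀ k‖ ^ 2)) := by
    refine tendsto_tsum_of_dominated_convergence (bound := fun k => 4 * g k) (hg.mul_left 4)
      (fun k => ?_) ?_
    · have : Continuous fun t => |(k : ℝ)| ^ 4 * ‖c t k - c t₀ k‖ ^ 2 :=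
        continuous_const.mul (((hc.cont k).sub continuous_const).norm.pow 2)
      exact (this.tendsto t₀).mono_left nhdsWithin_le_nhds
    · filter_upwards [self_mem_nhdsWithin] with t ht k
      rw [Real.norm_of_nonneg (by positivity)]
      have h1 := h t ht k
      have h2 := h t₀ ht₀ k
      have h3 : ‖c t k - c t₀ k‖ ^ 2 ≤ 2 * ‖c t k‖ ^ 2 + 2 * ‖c t₀ k‖ ^ 2 := by
        have := norm_sub_le (c t k) (c t₀ k)
        nlinarith [sq_nonneg (‖c t k‖ - ‖c t₀ k‖), norm_nonneg (c t k - c t₀ k),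
          norm_nonneg (c t k), norm_nonneg (c t₀ k)]
      nlinarith [mul_le_mul_of_nonneg_left h3 (show 0 ≤ |(k : ℝ)| ^ 4 by positivity)]
  simp only [sub_self, norm_zero, ne_eq, OfNat.ofNat_ne_zero, not_false_eq_true, zero_pow,
    mul_zero, tsum_zero] at key
  refine key.congr' ?_
  filter_upwards [self_mem_nhdsWithin] with t ht using (e t ht).symm

lemma inWienerClass (hc : IsRegularCurve c) (hT : 0 ≤ T) :
    InWienerClass T fun t => series (c t) :=
  ⟨hc.memLinfty hT, hc.memLW_three_top hT, fun _ hα => hc.memLHolder hT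
    (hα.le.trans (by rw [← NNReal.coe_le_coe]; norm_num)), hc.memMW_four hT, hc.memL2Hdot_two hT⟩

end IsRegularCurve

/-! ### Test functions -/

section Test

variable {φ : ℝ → Torus → ℝ}

lemma continuous_of_coe_prod {X : Type*} [TopologicalSpace X] {ψ : ℝ × Torus → X}
    (h : Continuous fun p : ℝ × ℝ => ψ (p.1, (p.2 : Torus))) : Continuous ψ :=
  (IsOpenQuotientMap.id.prodMap QuotientAddGroup.isOpenQuotientMap_mk).isQuotientMap.continuous_iff.2
    h

lemma contDiff_slice (hφ : ContDiff ℝ 1 fun p : ℝ × ℝ => φ p.1 (p.2 : Torus)) (t : ℝ) :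
    ContDiff ℝ 1 fun y : ℝ => φ t (y : Torus) :=
  hφ.comp (contDiff_const.prodMk contDiff_id)

lemma hasDerivAt_time_coe (hφ : ContDiff ℝ 1 fun p : ℝ × ℝ => φ p.1 (p.2 : Torus)) (t y : ℝ) :
    HasDerivAt (fun τ => φ τ (y : Torus))
      (fderiv ℝ (fun p : ℝ × ℝ => φ p.1 (p.2 : Torus)) (t, y) (1, 0)) t := by
  have h := (hφ.differentiable one_ne_zero (t, y)).hasFDerivAt
  exact h.comp_hasDerivAt (f := fun τ : ℝ => (τ, y)) t
    ((hasDerivAt_id t).prodMk (hasDerivAt_const t y))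

lemma hasDerivAt_time (hφ : ContDiff ℝ 1 fun p : ℝ × ℝ => φ p.1 (p.2 : Torus)) (t : ℝ)
    (x : Torus) : HasDerivAt (fun τ => φ τ x) (deriv (fun τ => φ τ x) t) t := by
  induction x using QuotientAddGroup.induction_on with
  | H y => exact (hasDerivAt_time_coe hφ t y).differentiableAt.hasDerivAt

lemma continuous_uncurry (hφ : ContDiff ℝ 1 fun p : ℝ × ℝ => φ p.1 (p.2 : Torus)) :
    Continuous fun p : ℝ × Torus => φ p.1 p.2 :=
  continuous_of_coe_prod hφ.continuous

lemma continuous_time_deriv (hφ : ContDiff ℝ 1 fun p : ℝ × ℝ => φ p.1 (p.2 : Torus)) :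
    Continuous fun p : ℝ × Torus => deriv (fun τ => φ τ p.2) p.1 := by
  refine continuous_of_coe_prod ?_
  have e : (fun p : ℝ × ℝ => deriv (fun τ => φ τ (p.2 : Torus)) p.1) =
      fun p => fderiv ℝ (fun p : ℝ × ℝ => φ p.1 (p.2 : Torus)) p (1, 0) := by
    funext p
    exact (hasDerivAt_time_coe hφ p.1 p.2).deriv
  exact e ▸ (hφ.continuous_fderiv one_ne_zero).clm_apply continuous_const

lemma continuous_uncurry_dx (hφ : ContDiff ℝ 1 fun p : ℝ × ℝ => φ p.1 (p.2 : Torus)) :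
    Continuous fun p : ℝ × Torus => dx (φ p.1) p.2 := by
  refine continuous_of_coe_prod ?_
  have e : (fun p : ℝ × ℝ => dx (φ p.1) (p.2 : Torus)) =
      fun p => fderiv ℝ (fun p : ℝ × ℝ => φ p.1 (p.2 : Torus)) p (0, 1) := by
    funext p
    rw [dx_coe]
    have h := (hφ.differentiable one_ne_zero (p.1, p.2)).hasFDerivAt
    exact (h.comp_hasDerivAt (f := fun y : ℝ => (p.1, y)) p.2
      ((hasDerivAt_const p.2 p.1).prodMk (hasDerivAt_id p.2))).deriv
  exact e ▸ (hφ.continuous_fderiv one_ne_zero).clm_apply continuous_const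

lemma continuous_mode_mul {ψ : ℝ → Torus → ℝ} (hψ : Continuous fun p : ℝ × Torus => ψ p.1 p.2)
    (k : ℤ) : Continuous fun p : ℝ × Torus => (fourier k p.2 : ℂ) * (ψ p.1 p.2 : ℂ) :=
  ((ContinuousMap.continuous _).comp continuous_snd).mul (Complex.continuous_ofReal.comp hψ)

lemma continuous_pair {ψ : ℝ → Torus → ℝ} (hψ : Continuous fun p : ℝ × Torus => ψ p.1 p.2)
    (k : ℤ) : Continuous fun t => pair k (ψ t) := by
  have := continuous_parametric_integral_of_continuous (μ := (volume : Measure Torus))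
    (f := fun t x => (fourier k x : ℂ) * (ψ t x : ℂ)) (continuous_mode_mul hψ k) isCompact_univ
  rw [Measure.restrict_univ] at this
  exact this

lemma exists_bound_on_Icc {ψ : ℝ → Torus → ℝ} (hψ : Continuous fun p : ℝ × Torus => ψ p.1 p.2)
    (s t : ℝ) : ∃ B, 0 ≤ B ∧ ∀ τ ∈ Icc s t, ∀ x, |ψ τ x| ≤ B := by
  obtain ⟨B, hB⟩ := (isCompact_Icc.prod isCompact_univ :
    IsCompact (Icc s t ×ˢ (univ : Set Torus))).exists_bound_of_continuousOn hψ.continuousOn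
  exact ⟨max B 0, le_max_right _ _, fun τ hτ x => (hB (τ, x) ⟨hτ, mem_univ x⟩).trans
    (le_max_left _ _)⟩

lemma hasDerivAt_pair (hφ : ContDiff ℝ 1 fun p : ℝ × ℝ => φ p.1 (p.2 : Torus)) (k : ℤ) (t : ℝ) :
    HasDerivAt (fun t => pair k (φ t)) (pair k fun x => deriv (fun τ => φ τ x) t) t := by
  have hd := continuous_time_deriv hφ
  obtain ⟨B, -, hB⟩ := exists_bound_on_Icc (ψ := fun t x => deriv (fun τ => φ τ x) t) hd
    (t - 1) (t + 1)
  have h1 : ∀ s, Continuous fun x : Torus => (fourier k x : ℂ) * (φ s x : ℂ) := fun s =>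
    (continuous_mode_mul (continuous_uncurry hφ) k).comp (Continuous.prodMk_right s)
  have h2 : Continuous fun x : Torus => (fourier k x : ℂ) * ((deriv (fun τ => φ τ x) t : ℝ) : ℂ) :=
    (continuous_mode_mul (ψ := fun t x => deriv (fun τ => φ τ x) t) hd k).comp
      (Continuous.prodMk_right t)
  refine (hasDerivAt_integral_of_dominated_loc_of_deriv_le (μ := (volume : Measure Torus))
    (F := fun t x => (fourier k x : ℂ) * (φ t x : ℂ))
    (F' := fun t x => (fourier k x : ℂ) * ((deriv (fun τ => φ τ x) t : ℝ) : ℂ))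
    (bound := fun _ => B) (Icc_mem_nhds (sub_one_lt t) (lt_add_one t))
    (Eventually.of_forall fun s => (h1 s).aestronglyMeasurable)
    ((h1 t).integrable_of_hasCompactSupport (HasCompactSupport.of_compactSpace _))
    h2.aestronglyMeasurable (Eventually.of_forall fun x s hs => ?_) (integrable_const B)
    (Eventually.of_forall fun x s _ => ?_)).2
  · rw [norm_mul, norm_fourier_apply, one_mul, Complex.norm_real]
    exact hB s hs x
  · exact (hasDerivAt_time hφ s x).ofReal_comp.const_mul _

end Test

/-! ### The weak formulation -/

section Weak

variable {T : ℝ} {c Q : ℝ → ℤ → ℂ} {a : ℤ → ℂ}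

/-- The weak form of the conservation law on a single Fourier mode. -/
lemma mode_weak_law (hT : 0 ≤ T) (k : ℤ) (hQ : Continuous fun t => Q t k)
    (hev : ∀ t, 0 ≤ t → c t k = a k + ∫ s in (0)..t, -(Complex.I * k) * Q s k)
    {φ : ℝ → Torus → ℝ} (hφ : ContDiff ℝ 1 fun p : ℝ × ℝ => φ p.1 (p.2 : Torus))
    (hφT : ∀ x, φ T x = 0) :
    -(a k * pair k (φ 0)) - ∫ t in Ioo 0 T, c t k * pair k (fun x => deriv (fun τ => φ τ x) t) =
      ∫ t in Ioo 0 T, Q t k * pair k (dx (φ t)) := by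
  have hQ' : Continuous fun t => -(Complex.I * k) * Q t k := continuous_const.mul hQ
  set G : ℝ → ℂ := fun t => a k + ∫ s in (0)..t, -(Complex.I * k) * Q s k
  have hG : ∀ t, HasDerivAt G (-(Complex.I * k) * Q t k) t := fun t =>
    (intervalIntegral.integral_hasDerivAt_right (hQ'.intervalIntegrable _ _)
      (hQ'.stronglyMeasurableAtFilter _ _) hQ'.continuousAt).const_add _
  have hp' : Continuous fun t => pair k fun x => deriv (fun τ => φ τ x) t :=
    continuous_pair (ψ := fun t x => deriv (fun τ => φ τ x) t) (continuous_time_deriv hφ) k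
  have key := intervalIntegral.integral_mul_deriv_eq_deriv_mul (a := 0) (b := T)
    (fun t _ => hG t) (fun t _ => hasDerivAt_pair hφ k t) (hQ'.intervalIntegrable _ _)
    (hp'.intervalIntegrable _ _)
  have e0 : G 0 = a k := by simp [G]
  have eT : pair k (φ T) = 0 := by simp [pair, hφT]
  rw [e0, eT, mul_zero, zero_sub, intervalIntegral.integral_of_le hT,
    intervalIntegral.integral_of_le hT, integral_Ioc_eq_integral_Ioo,
    integral_Ioc_eq_integral_Ioo] at key
  have e1 : ∫ t in Ioo 0 T, c t k * pair k (fun x => deriv (fun τ => φ τ x) t) =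
      ∫ t in Ioo 0 T, G t * pair k (fun x => deriv (fun τ => φ τ x) t) :=
    setIntegral_congr_fun measurableSet_Ioo fun t ht => by simp only [hev t ht.1.le, G]
  have e2 : ∫ t in Ioo 0 T, Q t k * pair k (dx (φ t)) =
      ∫ t in Ioo 0 T, -(Complex.I * k) * Q t k * pair k (φ t) :=
    setIntegral_congr_fun measurableSet_Ioo fun t _ => by
      simp only [pair_dx k (contDiff_slice hφ t)]; ring
  rw [e1, e2, key]
  ring

/-- Summation over the modes of the time integrals of a pairing. -/
lemma hasSum_integral_pair (hcc : ∀ k, Continuous fun t => c t k) (hr : ∀ t, IsReal (c t))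
    {w : ℝ → ℝ} (hw : IntegrableOn w (Ioo 0 T))
    (hs : ∀ᵐ t ∂(volume : Measure ℝ).restrict (Ioo 0 T),
      (Summable fun k => ‖c t k‖) ∧ ∑' k, ‖c t k‖ ≤ w t)
    {ψ : ℝ → Torus → ℝ} (hψ : Continuous fun p : ℝ × Torus => ψ p.1 p.2) :
    HasSum (fun k => ∫ t in Ioo 0 T, c t k * pair k (ψ t))
      ((∫ t in Ioo 0 T, ∫ x, series (c t) x * ψ t x : ℝ) : ℂ) := by
  obtain ⟨B, hB0, hB⟩ := exists_bound_on_Icc hψ 0 T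
  have hint : ∀ {f : ℝ → ℂ}, Continuous f → IntegrableOn f (Ioo 0 T) := fun hf =>
    hf.integrableOn_Icc.mono_set Ioo_subset_Icc_self
  have hsum : Summable fun k => ∫ t in Ioo 0 T, ‖c t k * pair k (ψ t)‖ := by
    have h1 : Summable fun k => ∫ t in Ioo 0 T, ‖c t k‖ := by
      refine summable_of_sum_le (c := ∫ t in Ioo 0 T, w t)
        (fun k => integral_nonneg fun t => norm_nonneg _) fun S => ?_
      rw [← integral_finsetSum S fun k _ => (hint (hcc k)).norm]
      refine integral_mono_ae (integrable_finsetSum S fun k _ => (hint (hcc k)).norm) hw ?_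
      filter_upwards [hs] with t ht
      exact (ht.1.sum_le_tsum S fun _ _ => norm_nonneg _).trans ht.2
    refine (h1.mul_right (B * (2 * π))).of_nonneg_of_le
      (fun k => integral_nonneg fun t => norm_nonneg _) fun k => ?_
    rw [← integral_mul_const]
    refine setIntegral_mono_on (hint ((hcc k).mul (continuous_pair hψ k))).norm
      ((hint (hcc k)).norm.mul_const _) measurableSet_Ioo fun t ht => ?_
    rw [norm_mul]
    exact mul_le_mul_of_nonneg_left (norm_pair_le k (hB t (Ioo_subset_Icc_self ht)))
      (norm_nonneg _)
  have key := hasSum_integral_of_summable_integral_norm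
    (fun k => hint ((hcc k).mul (continuous_pair hψ k))) hsum
  have e : ((∫ t in Ioo 0 T, ∫ x, series (c t) x * ψ t x : ℝ) : ℂ) =
      ∫ t in Ioo 0 T, ∑' k, c t k * pair k (ψ t) := by
    rw [← integral_complex_ofReal]
    refine integral_congr_ae ?_
    filter_upwards [hs] with t ht
    exact (hasSum_pair (hr t) ht.1 (hψ.comp (Continuous.prodMk_right t))).tsum_eq.symm
  rw [e]
  exact key

theorem weakConservationLaw_series (hT : 0 ≤ T) (hcc : ∀ k, Continuous fun t => c t k)
    (hcr : ∀ t, IsReal (c t)) (hQc : ∀ k, Continuous fun t => Q t k) (hQr : ∀ t, IsReal (Q t))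
    {w w' : ℝ → ℝ} (hw : IntegrableOn w (Ioo 0 T)) (hw' : IntegrableOn w' (Ioo 0 T))
    (hcs : ∀ᵐ t ∂(volume : Measure ℝ).restrict (Ioo 0 T),
      (Summable fun k => ‖c t k‖) ∧ ∑' k, ‖c t k‖ ≤ w t)
    (hQs : ∀ᵐ t ∂(volume : Measure ℝ).restrict (Ioo 0 T),
      (Summable fun k => ‖Q t k‖) ∧ ∑' k, ‖Q t k‖ ≤ w' t)
    (hra : IsReal a) (hsa : Summable fun k => ‖a k‖)
    (hev : ∀ k t, 0 ≤ t → c t k = a k + ∫ s in (0)..t, -(Complex.I * k) * Q s k)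
    {u₀ : Torus → ℝ} (hu₀ : u₀ =ᵐ[volume] series a) {q : ℝ → Torus → ℝ}
    (hq : ∀ᵐ t ∂(volume : Measure ℝ).restrict (Ioo 0 T), q t = series (Q t)) :
    WeakConservationLaw T u₀ (fun t => series (c t)) q := by
  rintro φ ⟨hφ, T', hT', hφ'⟩
  have h0 := hasSum_pair hra hsa (ψ := φ 0) ((continuous_uncurry hφ).comp (Continuous.prodMk_right 0))
  have h1 := hasSum_integral_pair hcc hcr hw hcs
    (ψ := fun t x => deriv (fun τ => φ τ x) t) (continuous_time_deriv hφ)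
  have h2 := hasSum_integral_pair hQc hQr hw' hQs (ψ := fun t => dx (φ t)) (continuous_uncurry_dx hφ)
  have e : (fun k => -(a k * pair k (φ 0)) -
      ∫ t in Ioo 0 T, c t k * pair k (fun x => deriv (fun τ => φ τ x) t)) =
      fun k => ∫ t in Ioo 0 T, Q t k * pair k (dx (φ t)) := funext fun k =>
    mode_weak_law hT k (hQc k) (hev k) hφ (hφ' T hT'.le)
  have h3 : HasSum (fun k => ∫ t in Ioo 0 T, Q t k * pair k (dx (φ t))) _ :=
    e ▸ h0.neg.sub h1
  have h4 := h3.unique h2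
  have e0 : ∫ x, u₀ x * φ 0 x = ∫ x, series a x * φ 0 x := by
    refine integral_congr_ae ?_
    filter_upwards [hu₀] with x hx
    rw [hx]
  have e1 : ∫ t in Ioo 0 T, ∫ x, q t x * dx (φ t) x =
      ∫ t in Ioo 0 T, ∫ x, series (Q t) x * dx (φ t) x := by
    refine integral_congr_ae ?_
    filter_upwards [hq] with t ht
    rw [ht]
  rw [e0, e1]
  exact_mod_cast h4

end Weak

/-! ### From the Fourier system to the thin film system -/

namespace IsFourierSolution

variable {C : System} {a : Fin 2 → ℤ → ℂ} {E r M γ T : ℝ} {v : ℝ → Fin 2 → ℤ → ℂ}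

/-- The identity `‖vₖ(t)‖² = ‖aₖ‖² + 2 ∫₀ᵗ Re⟨vₖ, v̇ₖ⟩`, estimated on `[0,T]`. -/
lemma sq_norm_le (hv : IsFourierSolution C a E r M γ v) {t : ℝ} (ht : t ∈ Icc 0 T) (i : Fin 2)
    (k : ℤ) :
    ‖v t i k‖ ^ 2 ≤ ‖a i k‖ ^ 2 + 2 * ∫ s in (0)..T, ‖v s i k‖ * ‖C.rhs (v s) i k‖ := by
  have hR := hv.rhs_cont i k
  set G : ℝ → ℂ := fun t => a i k + ∫ s in (0)..t, C.rhs (v s) i k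
  have hG : ∀ t, HasDerivAt G (C.rhs (v t) i k) t := fun t =>
    (intervalIntegral.integral_hasDerivAt_right (hR.intervalIntegrable _ _)
      (hR.stronglyMeasurableAtFilter _ _) hR.continuousAt).const_add _
  have hGv : ∀ s, 0 ≤ s → v s i k = G s := fun s hs => hv.evol s hs i k
  have hGc : Continuous G := continuous_iff_continuousAt.2 fun t => (hG t).continuousAt
  have hd : Continuous fun s => 2 * inner ℝ (G s) (C.rhs (v s) i k) :=
    continuous_const.mul (hGc.inner hR)
  have key := intervalIntegral.integral_eq_sub_of_hasDerivAt (a := 0) (b := t)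
    (fun s _ => (hG s).norm_sq) (hd.intervalIntegrable _ _)
  have e0 : G 0 = a i k := by simp [G]
  have hc : Continuous fun s => 2 * (‖v s i k‖ * ‖C.rhs (v s) i k‖) :=
    continuous_const.mul ((hv.cont i k).norm.mul hR.norm)
  rw [hGv t ht.1, ← sub_le_iff_le_add', ← e0, ← key, ← intervalIntegral.integral_const_mul]
  refine (intervalIntegral.integral_mono_on ht.1 (hd.intervalIntegrable _ _)
    (hc.intervalIntegrable _ _) fun s hs => ?_).trans
    (intervalIntegral.integral_mono_interval le_rfl ht.1 ht.2
      (Eventually.of_forall fun s => by positivity)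
      (hc.intervalIntegrable _ _))
  rw [hGv s hs.1]
  exact mul_le_mul_of_nonneg_left (real_inner_le_norm _ _) two_pos.le

lemma isReal (hv : IsFourierSolution C a E r M γ v) (t : ℝ) (i : Fin 2) : IsReal (v t i) :=
  hv.symm t i

lemma sum_le_of_nonneg {f : Fin 2 → ℤ → ℝ} (hf : ∀ i k, 0 ≤ f i k) (i : Fin 2) (S : Finset ℤ) :
    ∑ k ∈ S, f i k ≤ ∑ j, ∑ k ∈ S, f j k :=
  Finset.single_le_sum (f := fun j => ∑ k ∈ S, f j k)
    (fun j _ => Finset.sum_nonneg fun k _ => hf j k) (Finset.mem_univ i)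

lemma integral_sum_le_of_nonneg {f : ℝ → Fin 2 → ℤ → ℝ} (hf : ∀ t i k, 0 ≤ f t i k)
    (hc : ∀ i k, Continuous fun t => f t i k) (hT : 0 ≤ T) (i : Fin 2) (S : Finset ℤ) :
    ∫ t in (0)..T, ∑ k ∈ S, f t i k ≤ ∫ t in (0)..T, ∑ j, ∑ k ∈ S, f t j k := by
  have h1 : ∀ j, Continuous fun t => ∑ k ∈ S, f t j k := fun j =>
    continuous_finsetSum S fun k _ => hc j k
  exact intervalIntegral.integral_mono_on hT ((h1 i).intervalIntegrable _ _)
    ((continuous_finsetSum _ fun j _ => h1 j).intervalIntegrable _ _)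
    fun t _ => sum_le_of_nonneg (hf t) i S

lemma isRegularCurve (hv : IsFourierSolution C a E r M γ v) (hr : 0 ≤ r) (hE : 0 ≤ E)
    (i : Fin 2) : IsRegularCurve fun t => v t i where
  symm t := hv.isReal t i
  zero t := (hv.bounded t).1 i
  cont k := hv.cont i k
  bounded := ⟨E, fun t ht S => by
    refine (sum_le_of_nonneg (fun _ _ => norm_nonneg _) i S).trans ((hv.wiener_le t ht S).trans ?_)
    exact mul_le_of_le_one_right hE (Real.exp_le_one_iff.2 (by nlinarith))⟩
  int_wiener := ⟨M, fun T hT S => by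
    simp only [norm_der]
    exact (integral_sum_le_of_nonneg (f := fun t i k => |(k : ℝ)| ^ 4 * ‖v t i k‖)
      (fun _ _ _ => by positivity) (fun j k => continuous_const.mul (hv.cont j k).norm)
      hT i S).trans (hv.int_wiener T hT S)⟩
  int_energy := ⟨M, fun T hT S =>
    (integral_sum_le_of_nonneg (f := fun t i k => |(k : ℝ)| ^ 8 * ‖v t i k‖ ^ 2)
      (fun _ _ _ => by positivity) (fun j k => continuous_const.mul ((hv.cont j k).norm.pow 2))
      hT i S).trans (hv.int_energy T hT S)⟩
  dominated T hT := by
    refine ⟨fun k => |(k : ℝ)| ^ 4 * ‖a i k‖ ^ 2 +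
      2 * ∫ s in (0)..T, |(k : ℝ)| ^ 4 * (‖v s i k‖ * ‖C.rhs (v s) i k‖), ?_, fun t ht k => ?_⟩
    · have hc : ∀ j (k : ℤ), Continuous fun s : ℝ =>
          |(k : ℝ)| ^ 4 * (‖v s j k‖ * ‖C.rhs (v s) j k‖) := fun j k =>
        continuous_const.mul ((hv.cont j k).norm.mul (hv.rhs_cont j k).norm)
      refine Summable.add ?_ (Summable.mul_left 2 ?_)
      · simp only [← hv.init]
        exact summable_of_sum_le (fun k => by positivity) fun S =>
          (sum_le_of_nonneg (f := fun i k => |(k : ℝ)| ^ 4 * ‖v 0 i k‖ ^ 2)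
            (fun _ _ => by positivity) i S).trans ((hv.bounded 0).2 S)
      · refine summable_of_sum_le (c := M * (M + T))
          (fun k => intervalIntegral.integral_nonneg hT fun s _ => by positivity) fun S => ?_
        rw [← intervalIntegral.integral_finsetSum fun k _ => (hc i k).intervalIntegrable _ _]
        exact (integral_sum_le_of_nonneg
          (f := fun s i k => |(k : ℝ)| ^ 4 * (‖v s i k‖ * ‖C.rhs (v s) i k‖))
          (fun _ _ _ => by positivity) hc hT i S).trans (hv.int_rate T hT S)
    · have h := mul_le_mul_of_nonneg_left (hv.sq_norm_le ht i k)
        (show 0 ≤ |(k : ℝ)| ^ 4 by positivity)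
      refine h.trans (le_of_eq ?_)
      simp only [intervalIntegral.integral_const_mul]
      ring

end IsFourierSolution

namespace System

variable {C : System} {E α β κ : ℝ} {u : Fin 2 → ℤ → ℂ}

/-- The Fourier coefficients of the flux `(uᵢ + mᵢ) ∑ⱼ (Aᵢⱼ ∂ₓ³uⱼ - Bᵢⱼ ∂ₓuⱼ)`. -/
noncomputable def flux (C : System) (u : Fin 2 → ℤ → ℂ) (i : Fin 2) (k : ℤ) : ℂ :=
  -Complex.I * (C.m i * C.force u i k + C.conv u i k)

lemma rhs_eq_flux (C : System) (u : Fin 2 → ℤ → ℂ) (i : Fin 2) (k : ℤ) :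
    C.rhs u i k = -(Complex.I * k) * C.flux u i k := by
  rw [rhs, flux]
  linear_combination (-(k : ℂ)) * (C.m i * C.force u i k + C.conv u i k) * Complex.I_mul_I

lemma isReal_force (hu : ∀ i, IsReal (u i)) (i : Fin 2) :
    IsReal fun k => -Complex.I * C.force u i k := fun k => by
  simp only [force_neg hu, map_mul, map_neg, Complex.conj_I]; ring

lemma flux_eq_cauchy (C : System) (u : Fin 2 → ℤ → ℂ) (i : Fin 2) :
    C.flux u i = fun k => C.m i * (-Complex.I * C.force u i k) +
      cauchy (u i) (fun k => -Complex.I * C.force u i k) k := by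
  funext k
  rw [flux, conv, cauchy, mul_add, ← tsum_mul_left]
  congr 1
  · ring
  · exact tsum_congr fun l => by ring

lemma isReal_flux (hu : ∀ i, IsReal (u i)) (i : Fin 2) : IsReal (C.flux u i) := fun k => by
  simp only [flux, force_neg hu, conv_neg hu, map_mul, map_add, map_neg, Complex.conj_I,
    Complex.conj_ofReal]
  ring

lemma norm_mul_force_le (h : C.Admissible E α β κ) (u : Fin 2 → ℤ → ℂ) (i : Fin 2) (k : ℤ) :
    ‖-Complex.I * C.force u i k‖ ≤ ∑ j, (C.A i j + C.B i j) * ‖der 4 (u j) k‖ := by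
  rw [norm_mul, norm_neg, Complex.norm_I, one_mul]
  refine (norm_force_le h u i k).trans (Finset.sum_le_sum fun j _ => ?_)
  have hA := h.A_nonneg i j
  have hB := h.B_nonneg i j
  rw [norm_der]
  rcases eq_or_ne k 0 with rfl | hk
  · simp
  have h1 := one_le_abs_cast hk
  have h3 := pow_le_pow_right₀ h1 (show 3 ≤ 4 by norm_num)
  have h4 := pow_le_pow_right₀ h1 (show 1 ≤ 4 by norm_num)
  rw [pow_one] at h4
  have h5 : C.A i j * |(k : ℝ)| ^ 3 + C.B i j * |(k : ℝ)| ≤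
      (C.A i j + C.B i j) * |(k : ℝ)| ^ 4 := by
    rw [add_mul]
    exact add_le_add (mul_le_mul_of_nonneg_left h3 hA) (mul_le_mul_of_nonneg_left h4 hB)
  exact (mul_le_mul_of_nonneg_right h5 (norm_nonneg _)).trans (mul_assoc _ _ _).le

lemma summable_norm_force (h : C.Admissible E α β κ)
    (hs : ∀ i, Summable fun k => ‖der 4 (u i) k‖) (i : Fin 2) :
    Summable fun k => ‖-Complex.I * C.force u i k‖ :=
  (summable_sum fun j _ => (hs j).mul_left (C.A i j + C.B i j)).of_nonneg_of_le
    (fun _ => norm_nonneg _) fun k => norm_mul_force_le h u i k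

lemma tsum_norm_force_le (h : C.Admissible E α β κ)
    (hs : ∀ i, Summable fun k => ‖der 4 (u i) k‖) (i : Fin 2) :
    ∑' k, ‖-Complex.I * C.force u i k‖ ≤
      ∑ j, (C.A i j + C.B i j) * ∑' k, ‖der 4 (u j) k‖ := by
  have h1 : ∀ j ∈ Finset.univ, Summable fun k => (C.A i j + C.B i j) * ‖der 4 (u j) k‖ :=
    fun j _ => (hs j).mul_left (C.A i j + C.B i j)
  refine ((summable_norm_force h hs i).tsum_le_tsum (norm_mul_force_le h u i)
    (summable_sum h1)).trans (le_of_eq ?_)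
  rw [Summable.tsum_finsetSum h1]
  simp only [tsum_mul_left]

lemma series_force (h0 : ∀ i, u i 0 = 0) (hs : ∀ i, Summable fun k => ‖der 4 (u i) k‖)
    (i : Fin 2) (x : Torus) :
    series (fun k => -Complex.I * C.force u i k) x =
      ∑ j, (C.A i j * series (der 3 (u j)) x - C.B i j * series (der 1 (u j)) x) := by
  have h1 : ∀ j, Summable fun k => der 1 (u j) k * (fourier k x : ℂ) := fun j =>
    summable_mul_fourier (summable_der_of_le (h0 j) (by norm_num) (hs j)) x
  have h3 : ∀ j, Summable fun k => der 3 (u j) k * (fourier k x : ℂ) := fun j =>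
    summable_mul_fourier (summable_der_of_le (h0 j) (by norm_num) (hs j)) x
  have e : (fun k => -Complex.I * C.force u i k * (fourier k x : ℂ)) = fun k =>
      ∑ j, ((C.A i j : ℂ) * (der 3 (u j) k * fourier k x) -
        (C.B i j : ℂ) * (der 1 (u j) k * fourier k x)) := by
    funext k
    rw [force, Finset.mul_sum, Finset.sum_mul]
    refine Finset.sum_congr rfl fun j _ => ?_
    simp only [der]
    push_cast
    linear_combination (-(C.A i j : ℂ)) * Complex.I * k ^ 3 * u j k * fourier k x * Complex.I_mul_I
  simp only [series]
  rw [e, Summable.tsum_finsetSum fun j _ => ((h3 j).mul_left _).sub ((h1 j).mul_left _),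
    Complex.re_sum]
  refine Finset.sum_congr rfl fun j _ => ?_
  rw [((h3 j).mul_left _).tsum_sub ((h1 j).mul_left _), tsum_mul_left, tsum_mul_left,
    Complex.sub_re, Complex.re_ofReal_mul, Complex.re_ofReal_mul]

lemma summable_norm_flux (h : C.Admissible E α β κ) (h0 : ∀ i, u i 0 = 0)
    (hs : ∀ i, Summable fun k => ‖der 4 (u i) k‖) (i : Fin 2) :
    Summable fun k => ‖C.flux u i k‖ := by
  have hF := summable_norm_force h hs i
  have hu : Summable fun k => ‖u i k‖ := by
    simpa only [der_zero] using summable_der_of_le (h0 i) (Nat.zero_le 4) (hs i)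
  rw [flux_eq_cauchy]
  refine ((hF.mul_left |C.m i|).add (summable_norm_cauchy_apply hu hF).1).of_nonneg_of_le
    (fun _ => norm_nonneg _) fun k => (norm_add_le _ _).trans (le_of_eq ?_)
  rw [norm_mul (C.m i : ℂ), Complex.norm_real, Real.norm_eq_abs]

lemma tsum_norm_flux_le (h : C.Admissible E α β κ) (h0 : ∀ i, u i 0 = 0)
    (hs : ∀ i, Summable fun k => ‖der 4 (u i) k‖) (i : Fin 2) {K : ℝ}
    (hK : ∑' k, ‖u i k‖ ≤ K) :
    ∑' k, ‖C.flux u i k‖ ≤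
      (C.m i + K) * ∑ j, (C.A i j + C.B i j) * ∑' k, ‖der 4 (u j) k‖ := by
  have hF := summable_norm_force h hs i
  have hu : Summable fun k => ‖u i k‖ := by
    simpa only [der_zero] using summable_der_of_le (h0 i) (Nat.zero_le 4) (hs i)
  have hc := (summable_norm_cauchy_apply hu hF).1
  have h1 : ∑' k, ‖C.flux u i k‖ ≤ C.m i * (∑' k, ‖-Complex.I * C.force u i k‖) +
      ∑' k, ‖cauchy (u i) (fun k => -Complex.I * C.force u i k) k‖ := by
    rw [← tsum_mul_left, ← (hF.mul_left _).tsum_add hc]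
    refine (summable_norm_flux h h0 hs i).tsum_le_tsum (fun k => ?_) ((hF.mul_left _).add hc)
    rw [flux_eq_cauchy]
    refine (norm_add_le _ _).trans (le_of_eq ?_)
    rw [norm_mul (C.m i : ℂ), Complex.norm_real, Real.norm_of_nonneg (h.m_nonneg i)]
  have hF0 : 0 ≤ ∑' k, ‖-Complex.I * C.force u i k‖ := tsum_nonneg fun _ => norm_nonneg _
  refine h1.trans ((add_le_add_right ((tsum_norm_cauchy_le hu hF).trans
    (mul_le_mul_of_nonneg_right hK hF0)) _).trans ?_)
  rw [← add_mul]
  exact mul_le_mul_of_nonneg_left (tsum_norm_force_le h hs i)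
    (add_nonneg (h.m_nonneg i) ((tsum_nonneg fun _ => norm_nonneg _).trans hK))

lemma series_flux (h : C.Admissible E α β κ) (hr : ∀ i, IsReal (u i)) (h0 : ∀ i, u i 0 = 0)
    (hs : ∀ i, Summable fun k => ‖der 4 (u i) k‖) (i : Fin 2) (x : Torus) :
    series (C.flux u i) x = (series (u i) x + C.m i) *
      ∑ j, (C.A i j * series (der 3 (u j)) x - C.B i j * series (der 1 (u j)) x) := by
  have hF := summable_norm_force h hs i
  have hu : Summable fun k => ‖u i k‖ := by
    simpa only [der_zero] using summable_der_of_le (h0 i) (Nat.zero_le 4) (hs i)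
  rw [flux_eq_cauchy, series_add _ (summable_norm_cauchy_apply hu hF).1, series_const_mul,
    series_cauchy hu hF (hr i) (isReal_force hr i), series_force h0 hs]
  · ring
  · simpa only [norm_mul (C.m i : ℂ)] using hF.mul_left ‖(C.m i : ℂ)‖

lemma continuous_flux (h : C.Admissible E α β κ) {M : ℝ} {w : ℝ → Fin 2 → ℤ → ℂ}
    (hw : ∀ t, BoundedH2 M (w t)) (hc : ∀ i k, Continuous fun t => w t i k) (i : Fin 2) (k : ℤ) :
    Continuous fun t => C.flux (w t) i k := by
  refine continuous_const.mul ((continuous_const.mul ?_).add ?_)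
  · exact continuous_finsetSum _ fun j _ => continuous_const.mul (hc j k)
  · exact continuous_iff_continuousAt.2 fun t =>
      tendsto_conv h hw (hw t) (fun i k => (hc i k).continuousAt) i k

end System

namespace IsFourierSolution

variable {C : System} {a : Fin 2 → ℤ → ℂ} {E α β κ r M γ T : ℝ} {v : ℝ → Fin 2 → ℤ → ℂ}

/-- The flux of the solution with the coefficients `v`, as a function on the torus. -/
noncomputable def flux (C : System) (v : ℝ → Fin 2 → ℤ → ℂ) (i : Fin 2) (t : ℝ) (x : Torus) : ℝ :=
  (series (v t i) x + C.m i) *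
    ∑ j, (C.A i j * series (der 3 (v t j)) x - C.B i j * series (der 1 (v t j)) x)

lemma ae_summable_der (hv : IsFourierSolution C a E r M γ v) (hr : 0 ≤ r) (hE : 0 ≤ E)
    (hT : 0 ≤ T) : ∀ᵐ t ∂(volume : Measure ℝ).restrict (Ioo 0 T),
      ∀ i, Summable fun k => ‖der 4 (v t i) k‖ :=
  ae_all_iff.2 fun i => (hv.isRegularCurve hr hE i).ae_summable_der hT

lemma ae_flux_eq (hv : IsFourierSolution C a E r M γ v) (h : C.Admissible E α β κ) (hr : 0 ≤ r)
    (hT : 0 ≤ T) (i : Fin 2) : ∀ᵐ t ∂(volume : Measure ℝ).restrict (Ioo 0 T),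
      flux C v i t = series (C.flux (v t) i) := by
  filter_upwards [hv.ae_summable_der hr h.E_nonneg hT] with t ht
  funext x
  exact (System.series_flux h (hv.isReal t) (hv.bounded t).1 ht i x).symm

/-- The majorant in time of the Wiener norm of the flux. -/
lemma exists_flux_bound (hv : IsFourierSolution C a E r M γ v) (h : C.Admissible E α β κ)
    (hr : 0 ≤ r) (hT : 0 ≤ T) (i : Fin 2) : ∃ w : ℝ → ℝ, IntegrableOn w (Ioo 0 T) ∧
      ∀ᵐ t ∂(volume : Measure ℝ).restrict (Ioo 0 T),
        (Summable fun k => ‖C.flux (v t) i k‖) ∧ ∑' k, ‖C.flux (v t) i k‖ ≤ w t := by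
  obtain ⟨K, hK⟩ := (hv.isRegularCurve hr h.E_nonneg i).bounded
  refine ⟨fun t => (C.m i + K) * ∑ j, (C.A i j + C.B i j) * ∑' k, ‖der 4 (v t j) k‖, ?_, ?_⟩
  · refine Integrable.const_mul (integrable_finsetSum _ fun j _ => Integrable.const_mul ?_ _) _
    have hj := hv.isRegularCurve hr h.E_nonneg j
    obtain ⟨M', hM'⟩ := hj.int_wiener
    exact integrableOn_tsum (g := fun k t => ‖der 4 (v t j) k‖) (fun _ _ => norm_nonneg _)
      (fun k => (hj.continuous_der 4 k).norm) hT (hM' T hT)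
  · filter_upwards [hv.ae_summable_der hr h.E_nonneg hT, IsRegularCurve.ae_nonneg T] with t ht ht0
    exact ⟨System.summable_norm_flux h (hv.bounded t).1 ht i,
      System.tsum_norm_flux_le h (hv.bounded t).1 ht i
        (Real.tsum_le_of_sum_le (fun _ => norm_nonneg _) (hK t ht0))⟩

lemma txIntegrable_flux (hv : IsFourierSolution C a E r M γ v) (h : C.Admissible E α β κ)
    (hr : 0 ≤ r) (hT : 0 ≤ T) (i : Fin 2) : TXIntegrable T (flux C v i) := by
  obtain ⟨w, hw, hb⟩ := hv.exists_flux_bound h hr hT i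
  have hreg := fun j => hv.isRegularCurve hr h.E_nonneg j
  refine (hw.comp_fst (volume : Measure Torus)).mono' ?_ ?_
  · refine AEStronglyMeasurable.mul (((hreg i).txMeasurable hT).add aestronglyMeasurable_const) ?_
    exact Finset.aestronglyMeasurable_fun_sum _ fun j _ =>
      (((hreg j).txMeasurable_der hT (by norm_num)).const_mul _).sub
        (((hreg j).txMeasurable_der hT (by norm_num)).const_mul _)
  · have h2 := Measure.quasiMeasurePreserving_fst (ν := (volume : Measure Torus)) |>.ae
      (hb.and (hv.ae_flux_eq h hr hT i))
    filter_upwards [h2] with p hp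
    rw [hp.2]
    exact (abs_series_le hp.1.1 _).trans hp.1.2

lemma weakConservationLaw (hv : IsFourierSolution C a E r M γ v) (h : C.Admissible E α β κ)
    (hr : 0 ≤ r) (hT : 0 ≤ T) (i : Fin 2) {u₀ : Torus → ℝ} (hu₀ : u₀ =ᵐ[volume] series (a i)) :
    WeakConservationLaw T u₀ (fun t => series (v t i)) (flux C v i) := by
  have hreg := hv.isRegularCurve hr h.E_nonneg i
  have ha : v 0 i = a i := funext (hv.init i)
  obtain ⟨K, hK⟩ := hreg.bounded
  obtain ⟨w, hw, hb⟩ := hv.exists_flux_bound h hr hT i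
  refine weakConservationLaw_series (Q := fun t => C.flux (v t) i) (a := a i) (w := fun _ => K)
    hT hreg.cont hreg.symm (System.continuous_flux h hv.bounded hv.cont i)
    (fun t => System.isReal_flux (hv.isReal t) i) (integrableOn_const (by simp)) hw ?_ hb
    (ha ▸ hreg.symm 0) (ha ▸ hreg.summable le_rfl) (fun k t ht => ?_) hu₀
    (hv.ae_flux_eq h hr hT i)
  · filter_upwards [IsRegularCurve.ae_nonneg T] with t ht
    exact ⟨hreg.summable ht, Real.tsum_le_of_sum_le (fun _ => norm_nonneg _) (hK t ht)⟩
  · simp only [← System.rhs_eq_flux]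
    exact hv.evol t ht i k

end IsFourierSolution

/-! ### Norms of the solution -/

lemma tsum_add_tsum_le {f : Fin 2 → ℤ → ℝ} (hf : ∀ i k, 0 ≤ f i k) {B : ℝ}
    (h : ∀ S : Finset ℤ, ∑ i, ∑ k ∈ S, f i k ≤ B) :
    (∀ i, Summable (f i)) ∧ ∑' k, f 0 k + ∑' k, f 1 k ≤ B := by
  have hs : ∀ i, Summable (f i) := fun i => summable_of_sum_le (hf i) fun S =>
    (IsFourierSolution.sum_le_of_nonneg hf i S).trans (h S)
  refine ⟨hs, ?_⟩
  rw [← (hs 0).tsum_add (hs 1)]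
  refine ((hs 0).add (hs 1)).tsum_le_of_sum_le fun S => ?_
  simpa only [Fin.sum_univ_two, Finset.sum_add_distrib] using h S

lemma hNormSq_mono {a : ℤ → ℂ} (hr : IsReal a) (h0 : a 0 = 0) (hs : Summable fun k => ‖a k‖)
    (h2 : Summable fun k : ℤ => |(k : ℝ)| ^ 4 * ‖a k‖ ^ 2) {s : ℝ} (hs2 : s ≤ 2) :
    hNormSq s (series a) ≤ ∑' k : ℤ, |(k : ℝ)| ^ 4 * ‖a k‖ ^ 2 := by
  have hle : ∀ k : ℤ, |(k : ℝ)| ^ (2 * s) * ‖a k‖ ^ 2 ≤ |(k : ℝ)| ^ 4 * ‖a k‖ ^ 2 := fun k => by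
    rcases eq_or_ne k 0 with rfl | hk
    · simp [h0]
    · refine mul_le_mul_of_nonneg_right ?_ (sq_nonneg _)
      rw [← Real.rpow_natCast]
      exact Real.rpow_le_rpow_of_exponent_le (one_le_abs_cast hk) (by push_cast; linarith)
  simp only [hNormSq, hat_series hr hs]
  exact (h2.of_nonneg_of_le (fun k => by positivity) hle).tsum_le_tsum hle h2

namespace IsFourierSolution

variable {C : System} {a : Fin 2 → ℤ → ℂ} {E r M γ T : ℝ} {v : ℝ → Fin 2 → ℤ → ℂ}

lemma eLpNorm_top_add_le (hv : IsFourierSolution C a E r M γ v) {t : ℝ} (ht : 0 ≤ t) :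
    eLpNorm (series (v t 0)) ∞ volume + eLpNorm (series (v t 1)) ∞ volume ≤
      ENNReal.ofReal (E * Real.exp (-r * t)) := by
  obtain ⟨hs, hle⟩ := tsum_add_tsum_le (f := fun i k => ‖v t i k‖) (fun _ _ => norm_nonneg _)
    (hv.wiener_le t ht)
  refine (add_le_add (eLpNorm_top_series_le (hs 0)) (eLpNorm_top_series_le (hs 1))).trans ?_
  rw [← ENNReal.ofReal_add (tsum_nonneg fun _ => norm_nonneg _) (tsum_nonneg fun _ => norm_nonneg _)]
  exact ENNReal.ofReal_le_ofReal hle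

lemma sobolevE_le (hv : IsFourierSolution C a E r M γ v) {t : ℝ} (ht : 0 ≤ t) {s : ℝ}
    (hs : s ≤ 2) :
    sobolevE s (series (v t 0)) (series (v t 1)) ≤ M * Real.exp (-γ * t) := by
  obtain ⟨h2, hle⟩ := tsum_add_tsum_le (f := fun i k => |(k : ℝ)| ^ 4 * ‖v t i k‖ ^ 2)
    (fun _ _ => by positivity) (hv.energy_le t ht)
  have h1 := (tsum_add_tsum_le (f := fun i k => ‖v t i k‖) (fun _ _ => norm_nonneg _)
    (hv.wiener_le t ht)).1
  exact (add_le_add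
    (hNormSq_mono (hv.isReal t 0) ((hv.bounded t).1 0) (h1 0) (h2 0) hs)
    (hNormSq_mono (hv.isReal t 1) ((hv.bounded t).1 1) (h1 1) (h2 1) hs)).trans hle

lemma integral_sobolevE_four (hv : IsFourierSolution C a E r M γ v) (hr : 0 ≤ r) (hE : 0 ≤ E)
    (hM : 0 ≤ M) (hT : 0 ≤ T) :
    IntegrableOn (fun t => sobolevE 4 (series (v t 0)) (series (v t 1))) (Ioo 0 T) ∧
      ∫ t in Ioo 0 T, sobolevE 4 (series (v t 0)) (series (v t 1)) ≤ 2 * M := by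
  have hreg := fun i => hv.isRegularCurve hr hE i
  have hint : ∀ i, ∀ S : Finset ℤ, ∫ t in (0)..T, ∑ k ∈ S, |(k : ℝ)| ^ 8 * ‖v t i k‖ ^ 2 ≤ M :=
    fun i S => (integral_sum_le_of_nonneg (f := fun t i k => |(k : ℝ)| ^ 8 * ‖v t i k‖ ^ 2)
      (fun _ _ _ => by positivity) (fun j k => continuous_const.mul ((hv.cont j k).norm.pow 2))
      hT i S).trans (hv.int_energy T hT S)
  have h1 : ∀ i, IntegrableOn (fun t => ∑' k : ℤ, |(k : ℝ)| ^ 8 * ‖v t i k‖ ^ 2) (Ioo 0 T) :=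
    fun i => integrableOn_tsum (g := fun k t => |(k : ℝ)| ^ 8 * ‖v t i k‖ ^ 2)
      (fun _ _ => by positivity) ((hreg i).continuous_energy 8) hT (hint i)
  have h2 : ∀ i, ∫ t in Ioo 0 T, ∑' k : ℤ, |(k : ℝ)| ^ 8 * ‖v t i k‖ ^ 2 ≤ M :=
    fun i => integral_tsum_le (g := fun k t => |(k : ℝ)| ^ 8 * ‖v t i k‖ ^ 2)
      (fun _ _ => by positivity) ((hreg i).continuous_energy 8) hT hM (hint i)
  have e : EqOn (fun t => ∑' k : ℤ, |(k : ℝ)| ^ 8 * ‖v t 0 k‖ ^ 2 +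
      ∑' k : ℤ, |(k : ℝ)| ^ 8 * ‖v t 1 k‖ ^ 2)
      (fun t => sobolevE 4 (series (v t 0)) (series (v t 1))) (Ioo 0 T) := fun t ht => by
    have h := fun i => hNormSq_series (hv.isReal t i) ((hreg i).summable ht.1.le) 4
    simp only [Nat.cast_ofNat] at h
    simp only [sobolevE, h]
  refine ⟨((h1 0).add (h1 1)).congr_fun e measurableSet_Ioo, ?_⟩
  rw [← setIntegral_congr_fun measurableSet_Ioo e, integral_add (h1 0) (h1 1)]
  linarith [h2 0, h2 1]

end IsFourierSolution

/-! ### The thin film Muskat system -/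

namespace Params

/-- The thin film Muskat system with the means `m` and `n` of the unknowns. -/
noncomputable def system (P : Params) (m n : ℝ) : System where
  m := ![m, n]
  A := ![![P.Aγ, P.A], ![P.Aμ, P.Aμ]]
  B := ![![P.bρ, P.b], ![P.bμ, P.bμ]]

end Params

/-- A function in `Ḣ²` has absolutely summable Fourier coefficients, `|û| ≤ k⁻⁴ + k⁴ |û|²`, and is
the sum of its Fourier series. -/
lemma fourier_data_of_memHdot_two {u : Torus → ℝ} (hu : MemHdot 2 u) :
    hat u 0 = 0 ∧ IsReal (hat u) ∧ (Summable fun k : ℤ => |(k : ℝ)| ^ 4 * ‖hat u k‖ ^ 2) ∧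
      (Summable fun k => ‖hat u k‖) ∧ u =ᵐ[volume] series (hat u) ∧
      wienerNorm 0 u = ∑' k, ‖hat u k‖ := by
  obtain ⟨h2, h0, hs⟩ := hu
  have h0' := hat_zero h0
  have hs' : Summable fun k : ℤ => |(k : ℝ)| ^ 4 * ‖hat u k‖ ^ 2 := by
    have := fun k : ℤ => abs_rpow_two_mul k 2
    simp only [Nat.cast_ofNat] at this
    simpa only [this] using hs
  have hk : Summable fun k : ℤ => 1 / (k : ℝ) ^ 4 := Real.summable_one_div_int_pow.2 (by norm_num)
  have hs1 : Summable fun k => ‖hat u k‖ := by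
    refine (hk.add hs').of_nonneg_of_le (fun _ => norm_nonneg _) fun k => ?_
    rcases eq_or_ne k 0 with rfl | hk0
    · simp [h0']
    · have hp : 0 < |(k : ℝ)| ^ 4 := by
        have := one_le_abs_cast hk0
        positivity
      rw [show (k : ℝ) ^ 4 = |(k : ℝ)| ^ 4 by rw [← abs_pow, abs_of_nonneg (by positivity)]]
      have h1 := sq_nonneg (1 - |(k : ℝ)| ^ 4 * ‖hat u k‖)
      have h2 : |(k : ℝ)| ^ 4 * ‖hat u k‖ ≤ 1 + (|(k : ℝ)| ^ 4 * ‖hat u k‖) ^ 2 := by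
        nlinarith
      rw [← mul_le_mul_iff_right₀ hp]
      refine h2.trans (le_of_eq ?_)
      field_simp
  refine ⟨h0', isReal_hat u, hs', hs1, ae_eq_series h2 (isReal_hat u) hs1, ?_⟩
  rw [wienerNorm]
  refine tsum_congr fun k => ?_
  rw [Real.rpow_zero, one_mul]

theorem Params.admissible_system (P : Params) (hP : P.Positive) (f₀ g₀ : Torus → ℝ)
    (hE : 0 ≤ size f₀ g₀) (hm : 0 ≤ mean f₀) (hn : 0 ≤ mean g₀)
    (hσ : 0 < min (min (σ1A P f₀ g₀) (σ2A P f₀ g₀)) (min (σ1b P f₀ g₀) (σ2b P f₀ g₀)))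
    (h₁ : 0 < mean g₀ * P.Aμ - (mean f₀ * P.A + mean g₀ * P.Aμ) / 2
      - (P.Aγ + 13 / 4 * P.A + 17 / 4 * P.Aμ) * size f₀ g₀) :
    ∃ α κ, (P.system (mean f₀) (mean g₀)).Admissible (size f₀ g₀) α
      (min (σ1b P f₀ g₀) (σ2b P f₀ g₀)) κ := by
  obtain ⟨hG, hμm, hμp, hρm, hρp, hγf, hγh⟩ := hP
  have hb : 0 < P.b := hρp
  have hbμ : 0 < P.bμ := mul_pos (div_pos hμm hμp) hb
  have hbρ : 0 < P.bρ := mul_pos (div_pos hρm hρp) hb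
  have hA : 0 < P.A := div_pos hγh hG
  have hAμ : 0 < P.Aμ := mul_pos (div_pos hμm hμp) hA
  have hAγ : 0 < P.Aγ := mul_pos (div_pos (add_pos hγf hγh) hγh) hA
  obtain ⟨hσA, hσb⟩ := lt_min_iff.1 hσ
  obtain ⟨hσ1, hσ2⟩ := lt_min_iff.1 hσA
  obtain ⟨hτ1, hτ2⟩ := lt_min_iff.1 hσb
  set β := min (σ1b P f₀ g₀) (σ2b P f₀ g₀)
  have hβ1 : β ≤ σ1b P f₀ g₀ := min_le_left _ _
  have hβ2 : β ≤ σ2b P f₀ g₀ := min_le_right _ _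
  simp only [σ1A, σ2A, σ1b, σ2b] at hσ1 hσ2 hτ1 hτ2 hβ1 hβ2
  set E := size f₀ g₀
  set m := mean f₀
  set n := mean g₀
  have pA : 0 ≤ P.A * E := by positivity
  have pAμ : 0 ≤ P.Aμ * E := by positivity
  have pAγ : 0 ≤ P.Aγ * E := by positivity
  have pb : 0 ≤ P.b * E := by positivity
  have pbμ : 0 ≤ P.bμ * E := by positivity
  have pbρ : 0 ≤ P.bρ * E := by positivity
  -- `σ2A` does not control `2 A_μ 𝓔₀`, but the smallness condition of the `Ḣ²` estimate does.
  have hα3 : 0 < n * P.Aμ - m * P.A - 2 * P.Aμ * E := by linarith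
  set α := min (min (m * P.Aγ - n * P.Aμ - (P.Aμ + 2 * P.Aγ + 2 * P.A) * E)
    (n * P.Aμ - m * P.A - (P.Aμ + 2 * P.Aγ + 2 * P.A) * E)) (n * P.Aμ - m * P.A - 2 * P.Aμ * E)
  have a1 : α ≤ m * P.Aγ - n * P.Aμ - (P.Aμ + 2 * P.Aγ + 2 * P.A) * E :=
    (min_le_left _ _).trans (min_le_left _ _)
  have a2 : α ≤ n * P.Aμ - m * P.A - (P.Aμ + 2 * P.Aγ + 2 * P.A) * E :=
    (min_le_left _ _).trans (min_le_right _ _)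
  have a3 : α ≤ n * P.Aμ - m * P.A - 2 * P.Aμ * E := min_le_right _ _
  refine ⟨α, n * P.Aμ - (m * P.A + n * P.Aμ) / 2 - (P.Aγ + 13 / 4 * P.A + 17 / 4 * P.Aμ) * E,
    ?_, ?_, ?_, hE, lt_min (lt_min hσ1 hσ2) hα3, hσb.le, h₁, ?_, ?_, ?_, ?_⟩
  · intro i; fin_cases i <;> simp [Params.system, hm, hn]
  · intro i j; fin_cases i <;> fin_cases j <;> simp [Params.system, hA.le, hAμ.le, hAγ.le]
  · intro i j; fin_cases i <;> fin_cases j <;> simp [Params.system, hb.le, hbμ.le, hbρ.le]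
  · intro i j
    fin_cases i <;> fin_cases j <;> simp [Params.system] <;> linarith
  · intro i j
    fin_cases i <;> fin_cases j <;> simp [Params.system] <;> linarith
  · intro i
    fin_cases i <;> simp [Params.system] <;> linarith
  · intro i
    fin_cases i <;> simp [Params.system] <;> linarith

end Muskat

theorem theorem3 (P : Muskat.Params) (hP : P.Positive) (f₀ g₀ : Muskat.Torus → ℝ)
    (hf₀ : Muskat.MemHdot 2 (Muskat.fluct f₀)) (hg₀ : Muskat.MemHdot 2 (Muskat.fluct g₀))
    (hsize : Muskat.size f₀ g₀ < min (Muskat.mean f₀) (Muskat.mean g₀))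
    (hσ : 0 < min (min (Muskat.σ1A P f₀ g₀) (Muskat.σ2A P f₀ g₀))
      (min (Muskat.σ1b P f₀ g₀) (Muskat.σ2b P f₀ g₀)))
    (h₁ : 0 < Muskat.mean g₀ * P.Aμ - (Muskat.mean f₀ * P.A + Muskat.mean g₀ * P.Aμ) / 2
      - (P.Aγ + 13 / 4 * P.A + 17 / 4 * P.Aμ) * Muskat.size f₀ g₀)
    (h₂ : 0 < Muskat.mean f₀ * P.Aγ - (Muskat.mean f₀ * P.A + Muskat.mean g₀ * P.Aμ) / 2
      - (P.Aγ + 13 / 4 * P.A + 17 / 4 * P.Aμ) * Muskat.size f₀ g₀) :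
    ∃ (c₁ c₂ c₃ : ℝ) (c : ℝ → ℝ), 0 < c₁ ∧ 0 < c₂ ∧ 0 < c₃ ∧
      (∀ s : ℝ, 0 ≤ s → s < 2 → 0 < c s) ∧
      ∃ f g : ℝ → Muskat.Torus → ℝ,
        -- global weak solution with the regularity and the decay known for Wiener data
        (∀ T : ℝ, 0 < T → Muskat.IsWeakSolution P f₀ g₀ T f g ∧
          Muskat.InWienerClass T f ∧ Muskat.InWienerClass T g) ∧
        (∃ δA : ℝ, 0 < δA ∧ ∀ T : ℝ, 0 < T →
          MeasureTheory.eLpNorm (f T) ⊤ MeasureTheory.volume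
            + MeasureTheory.eLpNorm (g T) ⊤ MeasureTheory.volume
          ≤ ENNReal.ofReal (Muskat.size f₀ g₀ *
              Real.exp (-(δA + min (Muskat.σ1b P f₀ g₀) (Muskat.σ2b P f₀ g₀)) * T))) ∧
        -- propagation of Sobolev regularity
        ∀ T : ℝ, 0 < T →
          (Muskat.MemCHdot T 2 f ∧ Muskat.MemL2Hdot T 4 f) ∧
          (Muskat.MemCHdot T 2 g ∧ Muskat.MemL2Hdot T 4 g) ∧
          MeasureTheory.IntegrableOn (fun t => Muskat.sobolevE 4 (f t) (g t)) (Set.Ioo 0 T) ∧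
          Muskat.sobolevE 2 (f T) (g T)
            + c₁ * ∫ t in Set.Ioo 0 T, Muskat.sobolevE 4 (f t) (g t) ≤ c₂ ∧
          ∀ s : ℝ, 0 ≤ s → s < 2 →
            Muskat.sobolevE s (f T) (g T) ≤ c₃ * Real.exp (-(c s) * T) := by
  have hF := Muskat.fourier_data_of_memHdot_two hf₀
  have hG := Muskat.fourier_data_of_memHdot_two hg₀
  set a : Fin 2 → ℤ → ℂ := ![Muskat.hat (Muskat.fluct f₀), Muskat.hat (Muskat.fluct g₀)] with ha
  have hsizeEq : Muskat.size f₀ g₀ = ∑' k, ‖a 0 k‖ + ∑' k, ‖a 1 k‖ :=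
    congrArg₂ (· + ·) hF.2.2.2.2.2 hG.2.2.2.2.2
  have has : ∀ i, Summable fun k => ‖a i k‖ := by
    intro i; fin_cases i
    exacts [hF.2.2.2.1, hG.2.2.2.1]
  have hae : ∀ i, Summable fun k : ℤ => |(k : ℝ)| ^ 4 * ‖a i k‖ ^ 2 := by
    intro i; fin_cases i
    exacts [hF.2.2.1, hG.2.2.1]
  have hE : 0 ≤ Muskat.size f₀ g₀ := by
    rw [hsizeEq]
    exact add_nonneg (tsum_nonneg fun _ => norm_nonneg _) (tsum_nonneg fun _ => norm_nonneg _)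
  obtain ⟨hm, hn⟩ := lt_min_iff.1 (hE.trans_lt hsize)
  obtain ⟨α, κ, hadm⟩ := P.admissible_system hP f₀ g₀ hE hm.le hn.le hσ h₁
  set β := min (Muskat.σ1b P f₀ g₀) (Muskat.σ2b P f₀ g₀)
  have hα := hadm.α_pos
  have hβ := hadm.β_nonneg
  -- The Wiener norm decays with every rate below `α + β`; the rate `α / 2 + β` gives `δ_A = α / 2`.
  have hr : 0 < α / 2 + β := by positivity
  obtain ⟨M, γ, v, hM, hγ, hv⟩ := Muskat.exists_isFourierSolution hadm hr (by linarith)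
    (a := a) (M₀ := ∑' k : ℤ, |(k : ℝ)| ^ 4 * ‖a 0 k‖ ^ 2 + ∑' k : ℤ, |(k : ℝ)| ^ 4 * ‖a 1 k‖ ^ 2)
    (by intro i; fin_cases i; exacts [hF.1, hG.1])
    (by intro i; fin_cases i; exacts [hF.2.1, hG.2.1])
    (fun S => by
      rw [hsizeEq, Fin.sum_univ_two]
      exact add_le_add ((has 0).sum_le_tsum S fun _ _ => norm_nonneg _)
        ((has 1).sum_le_tsum S fun _ _ => norm_nonneg _))
    (fun S => by
      rw [Fin.sum_univ_two]
      exact add_le_add ((hae 0).sum_le_tsum S fun _ _ => by positivity)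
        ((hae 1).sum_le_tsum S fun _ _ => by positivity))
  have hreg := fun i => hv.isRegularCurve hr.le hE i
  -- Both time integrals of the fourth order norms and `E₂` are at most `M`, hence `c₂ = 3 M`; for zero
  -- mean functions `E_s ≤ E₂`, so `c` does not have to depend on `s`.
  refine ⟨1, 3 * M, M, fun _ => γ, one_pos, by positivity, hM, fun _ _ _ => hγ,
    fun t => Muskat.series (v t 0), fun t => Muskat.series (v t 1), fun T hT => ?_,
    ⟨α / 2, by positivity, fun T hT => hv.eLpNorm_top_add_le hT.le⟩, fun T hT => ?_⟩
  · refine ⟨⟨(hreg 0).memLW_three_one hT.le, (hreg 1).memLW_three_one hT.le, ?_, ?_⟩,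
      (hreg 0).inWienerClass hT.le, (hreg 1).inWienerClass hT.le⟩
    · filter_upwards [Muskat.IsRegularCurve.ae_nonneg T] with t ht
      exact ⟨Muskat.integral_series ((hreg 0).symm t) ((hreg 0).zero t) ((hreg 0).summable ht),
        Muskat.integral_series ((hreg 1).symm t) ((hreg 1).zero t) ((hreg 1).summable ht)⟩
    · refine ⟨_, _, _, _, Muskat.IsFourierSolution.flux _ v 0, Muskat.IsFourierSolution.flux _ v 1,
        (hreg 0).isTXDeriv hT.le (n := 1) (by norm_num),
        (hreg 0).isTXDeriv hT.le (n := 3) (by norm_num),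
        (hreg 1).isTXDeriv hT.le (n := 1) (by norm_num),
        (hreg 1).isTXDeriv hT.le (n := 3) (by norm_num),
        fun t x => ?_, fun t x => ?_, hv.txIntegrable_flux hadm hr.le hT.le 0,
        hv.txIntegrable_flux hadm hr.le hT.le 1,
        hv.weakConservationLaw hadm hr.le hT.le 0 hF.2.2.2.2.1,
        hv.weakConservationLaw hadm hr.le hT.le 1 hG.2.2.2.2.1⟩
      all_goals
        simp only [Muskat.IsFourierSolution.flux, Muskat.Params.system, Fin.sum_univ_two,
          Matrix.cons_val_zero, Matrix.cons_val_one]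
        ring
  · obtain ⟨hi, hle⟩ := hv.integral_sobolevE_four hr.le hE hM.le hT.le
    refine ⟨⟨(hreg 0).memCHdot_two, (hreg 0).memL2Hdot_four hT.le⟩,
      ⟨(hreg 1).memCHdot_two, (hreg 1).memL2Hdot_four hT.le⟩, hi, ?_,
      fun s _ hs => hv.sobolevE_le hT.le hs.le⟩
    have h2 := hv.sobolevE_le hT.le le_rfl
    have h3 : M * Real.exp (-γ * T) ≤ M :=
      mul_le_of_le_one_right hM.le (Real.exp_le_one_iff.2 (by nlinarith))
    linarith
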